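/- **Setting.** Let $\mathcal A=[K]$ be the arms, $\mathcal S$ a finite set of latent states, $\mathcal X$ a measurable space of contexts and $\Theta$ a measurable space of reward parameters. For $a\in\mathcal A$, $x\in\mathcal X$, $s\in\mathcal S$, $\theta\in\Theta$ let $P(\cdot\mid a,x,s;\theta)$ be a probability distribution on $\mathbb R$ (a Markov kernel) with mean $\mu(a,x,s;\theta)\in[0,1]$ that is $\sigma^2$-sub-Gaussian, i.e. $\mathbb E_{R\sim P(\cdot\mid a,x,s;\theta)}\big[e^{\lambda(R-\mu(a,x,s;\theta))}\big]\le e^{\sigma^2\lambda^2/2}$ for all $\lambda>0$. The true parameters $(\theta_*,\phi_*)$, where $\phi_*$ is a row-stochastic $\mathcal S\times\mathcal S$ matrix, are drawn from a prior $P_1(\theta,\phi)$, under which the rows of $\phi_*$ are independent and $\phi_{*,s}\sim\mathsf{Dir}((\alpha_{s,s'})_{s'\in\mathcal S})$ with all $\alpha_{s,s'}>0$; the initial latent state $S_1$ is drawn from a prior $P_1(s)$, independently of $(\theta_*,\phi_*)$. In round $t=1,2,\dots$ the agent sees a context $X_t$, chooses $A_t\in\mathcal A$ and observes $R_t\sim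 P(\cdot\mid A_t,X_t,S_t;\theta_*)$; then $S_{t+1}\sim\phi_{*,S_t}$ (each conditionally on everything drawn before). The contexts come from an arbitrary process: $X_t$ is drawn from an arbitrary kernel applied to the observed history $\mathcal H_t=(X_\ell,A_\ell,R_\ell)_{\ell<t}$, and is conditionally independent given $\mathcal H_t$ of everything else drawn before. **umTS.** In round $t$ the agent draws, with fresh randomness, $(B_t,\theta_t)$ from the joint posterior $P_t(s,\theta)=\mathbb P(S_t=s,\theta_*=\theta\mid\mathcal H_t)$ and plays $A_t=\arg\max_{a\in\mathcal A}\mu(a,X_t,B_t;\theta_t)$ (with any fixed measurable tie-breaking rule). Let $A_{t,*}=\arg\max_{a\in\mathcal A}\mu(a,X_t,S_t;\theta_*)$. The $n$-round Bayes regret is $$\mathcal{BR}(n)=\mathbb E\Big[\sum_{t=1}^n\mu(A_{t,*},X_t,S_t;\theta_*)-\mu(A_t,X_t,S_t;\theta_*)\Big],$$ where the expectation is over the parameters, latent states, contexts, rewards and the agent's randomness. **Theorem.** Let $\bar\mu(a,x,s)=\int_\Theta\mu(a,x,s;\theta)\,P_1(d\theta)$, let $p=1-\min_{s\in\mathcal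 S}\alpha_{s,s}/\sum_{s'\in\mathcal S}\alpha_{s,s'}$ and $\tilde L=1+pn$. For every $\sigma$ there is a constant $C>0$, depending on $\sigma$ only, such that in every such problem, for all $\varepsilon,\delta>0$ such that $$\big\{\forall a\in\mathcal A,\ x\in\mathcal X,\ s\in\mathcal S:\ |\bar\mu(a,x,s)-\mu(a,x,s;\theta_*)|\le\varepsilon\big\}$$ holds with probability at least $1-\delta$ (its complement has outer measure at most $\delta$, should it not be measurable), and all $n\ge2$, the Bayes regret of umTS satisfies $$\mathcal{BR}(n)\le C\Big(\delta n+\varepsilon n+n^{2/3}\sqrt{|\mathcal S|\,\tilde L\log n}\Big).$$ -/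

import Mathlib

open MeasureTheory ProbabilityTheory

/-- The Dirichlet distribution `Dir(α)` as a law on vectors: the law of `(g i / ∑ j, g j)_i` for
independent `g i ∼ Gamma(α i, 1)`. For `α i > 0` it is carried by the probability simplex. -/
noncomputable def dirichletMeasure {ι : Type*} [Fintype ι] (α : ι → ℝ) : Measure (ι → ℝ) :=
  (Measure.pi fun i => gammaMeasure (α i) 1).map fun g i => g i / ∑ j, g j

/-- Row-stochastic matrices: `φ s` is the law of the successor of the latent state `s`. -/
abbrev TransitionMatrix (S : Type*) [Fintype S] : Type _ := S → stdSimplex ℝ S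

section Transition

variable {S : Type*} [Fintype S] [MeasurableSpace S] [MeasurableSingletonClass S]

theorem measurable_transition_entry (s' : S) :
    Measurable fun z : TransitionMatrix S × S => (z.1 z.2 : S → ℝ) s' := by
  refine measurable_from_prod_countable_left fun s => ?_
  exact (measurable_pi_apply s').comp (measurable_subtype_coe.comp (measurable_pi_apply s))

/-- The Markov kernel `(φ, s) ↦ φ(s, ·)`. -/
noncomputable def transitionKernel (S : Type*) [Fintype S] [MeasurableSpace S]
    [MeasurableSingletonClass S] : Kernel (TransitionMatrix S × S) S where
  toFun z := ∑ s' : S, ENNReal.ofReal ((z.1 z.2 : S → ℝ) s') • Measure.dirac s'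
  measurable' := by
    refine Measure.measurable_of_measurable_coe _ fun E _ => ?_
    simp only [Measure.finsetSum_apply, Measure.smul_apply, smul_eq_mul]
    exact Finset.measurable_sum _ fun s' _ =>
      ((measurable_transition_entry s').ennreal_ofReal).mul_const _

instance : IsMarkovKernel (transitionKernel S) where
  isProbabilityMeasure z := ⟨by
    change (∑ s' : S, ENNReal.ofReal ((z.1 z.2 : S → ℝ) s') • Measure.dirac s')
      Set.univ = 1
    have h0 : ∀ s' ∈ Finset.univ, 0 ≤ (z.1 z.2 : S → ℝ) s' := fun s' _ => (z.1 z.2).2.1 s'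
    have h1 : ∑ s', (z.1 z.2 : S → ℝ) s' = 1 := (z.1 z.2).2.2
    simp only [Measure.finsetSum_apply, Measure.smul_apply, smul_eq_mul, measure_univ, mul_one]
    rw [← ENNReal.ofReal_sum_of_nonneg h0, h1, ENNReal.ofReal_one]⟩

end Transition

/-- What the agent has observed before round `t` (rounds are counted from `0`): the contexts,
actions and rewards of the rounds `0, …, t - 1`. -/
abbrev History (K : ℕ) (X : Type*) (t : ℕ) : Type _ := Fin t → X × Fin K × ℝ

/-- A non-stationary latent bandit with `K` arms, latent states `S`, reward parameters `Θ`, contexts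
`X`, and a prior over its unknown parameters. -/
structure LatentBandit (K : ℕ) (S Θ X : Type*) [Fintype S] [MeasurableSpace S]
    [MeasurableSpace Θ] [MeasurableSpace X] where
  /-- The conditional reward distribution `P(· ∣ a, x, s; θ)`. -/
  rewardLaw : Kernel (Fin K × X × S × Θ) ℝ
  /-- The prior of the pair `(θ, φ)` of reward parameter and transition matrix. -/
  prior : Measure (Θ × TransitionMatrix S)
  /-- The law of the initial latent state. -/
  initial : Measure S
  /-- The arbitrary process that generates the contexts: the law of the context of round `t`
  given the observed history. -/
  contextLaw : ∀ t, Kernel (History K X t) X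
  markov_rewardLaw : IsMarkovKernel rewardLaw
  isProbabilityMeasure_prior : IsProbabilityMeasure prior
  isProbabilityMeasure_initial : IsProbabilityMeasure initial
  markov_contextLaw : ∀ t, IsMarkovKernel (contextLaw t)

namespace LatentBandit

variable {K : ℕ} {S Θ X : Type*} [Fintype S] [MeasurableSpace S]
  [MeasurableSpace Θ] [MeasurableSpace X]

attribute [instance] markov_rewardLaw isProbabilityMeasure_prior isProbabilityMeasure_initial
  markov_contextLaw

/-- The mean reward `μ(a, x, s; θ)`. -/
noncomputable def mean (M : LatentBandit K S Θ X) (a : Fin K) (x : X) (s : S) (θ : Θ) : ℝ :=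
  ∫ r, r ∂M.rewardLaw (a, x, s, θ)

/-- The prior mean `μ̄(a, x, s)` of the mean reward. -/
noncomputable def priorMean (M : LatentBandit K S Θ X) (a : Fin K) (x : X) (s : S) : ℝ :=
  ∫ θ, M.mean a x s θ ∂M.prior.fst

/-- All rewards have a mean and are sub-Gaussian with variance proxy `σ²`. -/
def IsSubGaussian (M : LatentBandit K S Θ X) (σ : ℝ) : Prop :=
  ∀ a x s θ, Integrable (fun r : ℝ => r) (M.rewardLaw (a, x, s, θ)) ∧
    ∀ l : ℝ, 0 < l →
      Integrable (fun r : ℝ => Real.exp (l * (r - M.mean a x s θ))) (M.rewardLaw (a, x, s, θ)) ∧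
      ∫ r, Real.exp (l * (r - M.mean a x s θ)) ∂M.rewardLaw (a, x, s, θ)
        ≤ Real.exp (σ ^ 2 * l ^ 2 / 2)

/-- Under the prior, the rows of the transition matrix are independent and row `s` has law
`Dir(α s)`. -/
def HasDirichletPrior (M : LatentBandit K S Θ X) (α : S → S → ℝ) : Prop :=
  HasLaw (fun z : Θ × TransitionMatrix S => fun s s' => (z.2 s : S → ℝ) s')
    (Measure.pi fun s => dirichletMeasure (α s)) M.prior

/-- A measurable choice `(x, s, θ) ↦ argmax_a μ(a, x, s; θ)`. -/
structure IsArgmax (M : LatentBandit K S Θ X) (best : X × S × Θ → Fin K) : Prop where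
  measurable : Measurable best
  le_best : ∀ a x s θ, M.mean a x s θ ≤ M.mean (best (x, s, θ)) x s θ

end LatentBandit

/-- The random quantities of an interaction: the true parameters `θ`, `φ`, and in each round `t` the
latent state, the context, the pair (believed latent state, sampled reward parameter) that the agent
draws, the action and the reward. -/
structure Trajectory (K : ℕ) (S Θ X Ω : Type*) [Fintype S] where
  θ : Ω → Θ
  φ : Ω → TransitionMatrix S
  state : ℕ → Ω → S
  context : ℕ → Ω → X
  belief : ℕ → Ω → S × Θ
  action : ℕ → Ω → Fin K
  reward : ℕ → Ω → ℝ

/-- Everything drawn before the context of round `t`: the parameters, the latent states of the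
rounds `0, …, t`, the agent's samples of the rounds `0, …, t - 1`, and the observed history. -/
abbrev Past (K : ℕ) (S Θ X : Type*) [Fintype S] (t : ℕ) : Type _ :=
  (Θ × TransitionMatrix S) × (Fin (t + 1) → S) × (Fin t → S × Θ) × History K X t

namespace Trajectory

variable {K : ℕ} {S Θ X Ω : Type*} [Fintype S]

def history (T : Trajectory K S Θ X Ω) (t : ℕ) (ω : Ω) : History K X t :=
  fun i => (T.context i ω, T.action i ω, T.reward i ω)

def past (T : Trajectory K S Θ X Ω) (t : ℕ) (ω : Ω) : Past K S Θ X t :=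
  ((T.θ ω, T.φ ω), fun i => T.state i ω, fun i => T.belief i ω, T.history t ω)

variable [MeasurableSpace S] [MeasurableSingletonClass S]
  [MeasurableSpace Θ] [MeasurableSpace X] [MeasurableSpace Ω]

/-- Under `P`, the trajectory follows the environment `M`, whatever the agent does. -/
structure FollowsEnvironment (T : Trajectory K S Θ X Ω) (M : LatentBandit K S Θ X)
    (P : Measure Ω) : Prop where
  /-- The parameters have the prior law, and the initial state is independent of them. -/
  initial : HasLaw (fun ω => ((T.θ ω, T.φ ω), T.state 0 ω)) (M.prior.prod M.initial) P
  context : ∀ t, HasCondDistrib (T.context t) (T.past t)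
    ((M.contextLaw t).comap (fun z : Past K S Θ X t => z.2.2.2) (by fun_prop)) P
  /-- The reward of round `t` has law `P(· ∣ A_t, X_t, S_t; θ)` given all that precedes it. -/
  reward : ∀ t, HasCondDistrib (T.reward t)
    (fun ω => (T.past t ω, T.context t ω, T.belief t ω, T.action t ω))
    (M.rewardLaw.comap
      (fun z : Past K S Θ X t × X × (S × Θ) × Fin K =>
        (z.2.2.2, z.2.1, z.1.2.1 (Fin.last t), z.1.1.1)) (by fun_prop)) P
  /-- The next latent state has law `φ(S_t, ·)` given all that precedes it. -/
  state : ∀ t, HasCondDistrib (T.state (t + 1))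
    (fun ω => (T.past t ω, T.context t ω, T.belief t ω, T.action t ω, T.reward t ω))
    ((transitionKernel S).comap
      (fun z : Past K S Θ X t × X × (S × Θ) × Fin K × ℝ =>
        (z.1.1.2, z.1.2.1 (Fin.last t))) (by fun_prop)) P

/-- Under `P`, the agent is uncertainty-aware model-based Thompson sampling (umTS): `posterior t` is
the joint posterior of `(S_t, θ)` given the observed history, in round `t` the agent draws
`(B_t, θ_t)` from it (with fresh randomness), and plays the best action for `(B_t, θ_t)` in the
current context. -/
structure IsUmTS (T : Trajectory K S Θ X Ω) (best : X × S × Θ → Fin K)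
    (posterior : ∀ t, Kernel (History K X t) (S × Θ)) (P : Measure Ω) : Prop where
  markov : ∀ t, IsMarkovKernel (posterior t)
  isPosterior : ∀ t,
    HasCondDistrib (fun ω => (T.state t ω, T.θ ω)) (T.history t) (posterior t) P
  sampling : ∀ t, HasCondDistrib (T.belief t) (fun ω => (T.past t ω, T.context t ω))
    ((posterior t).comap (fun z : Past K S Θ X t × X => z.1.2.2.2) (by fun_prop)) P
  action_eq : ∀ t ω, T.action t ω = best (T.context t ω, T.belief t ω)

/-- The `n`-round Bayes regret: the expectation, over parameters, latent states, contexts, rewards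
and the agent's randomness, of `∑ t < n, μ(A_{t,*}, X_t, S_t; θ) - μ(A_t, X_t, S_t; θ)`, where
`A_{t,*}` is the best action for the true latent state and reward parameter. -/
noncomputable def bayesRegret (T : Trajectory K S Θ X Ω) (M : LatentBandit K S Θ X)
    (best : X × S × Θ → Fin K) (P : Measure Ω) (n : ℕ) : ℝ :=
  ∫ ω, ∑ t ∈ Finset.range n,
    (M.mean (best (T.context t ω, T.state t ω, T.θ ω)) (T.context t ω) (T.state t ω) (T.θ ω)
      - M.mean (T.action t ω) (T.context t ω) (T.state t ω) (T.θ ω)) ∂P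

end Trajectory

/-- The maximal prior probability of a change, `1 - min_s α_{s,s} / ∑_{s'} α_{s,s'}`. -/
noncomputable def changeProb {S : Type*} [Fintype S] (α : S → S → ℝ) : ℝ :=
  1 - ⨅ s, α s s / ∑ s', α s s'

/-! Posterior matching is the starting point: given the history and the context, `(B_t, θ_t)` and
`(S_t, θ)` have the same law (`lintegral_posterior_match`). Hence the prior mean of the best action
in the true state and that of the played action in the believed state have the same expectation, and
up to `ε` and the bad event the regret of a round is the expected gap between the prior mean of the
played action in the believed state and its true mean (`integral_instantRegret_le`).

The gaps are controlled by a score `g(H_t, s)` for each latent state, reset at the start of each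
block of `period` rounds. It accumulates `l(c - r) - (l(c - r))² - w`, where `c` is the prior mean
under `s` and `r` the reward, weighted by the conditional probability that the belief was `s` given
the action. The weight replaces the indicator of `B_t = s` because the score must be a function of
the observed history, which does not contain `B_t`; otherwise posterior matching would not apply to
it. For the true state, while it does not change within the block and `θ` is close to its prior
mean, `exp g` is a supermartingale (`lintegral_exp_confStat_le`). So the true state is rarely scored
above `level`, and by matching neither is the believed one (`measure_level_lt_confStat_le`). On the
other hand a score is frozen above `level`, so the increments of each state sum to at most `level +
1` per block, on every path (`sum_confIncr_le`). In expectation these increments, summed over the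
states, dominate the gaps of the rounds whose belief is not ruled out (`integral_gap_le`).

Blocks with a change are given up: each change costs at most `period` rounds. The expected number of
changes is `O(1 + pn)` (`integral_changeCount_le`), which is not immediate because the state visited
depends on the random matrix. The proof uses that, for a Dirichlet row, the probability of leaving a
state is independent of where the jump goes. Given the jump directions, the jump chain is therefore
independent of the leaving probabilities, and the Laplace transforms of the holding times can be
bounded along it by Hölder's inequality.

Altogether the regret is at most of order `nδ + nε + period · L̃ + n l + |S| (n / period) log n /
l`, and `le_of_forall_mul_le` balances the last three terms. -/

/-! ### Gamma variables: scaling, and independence of ratios and sum. -/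

section Dirichlet

/-- The substitution `x ↦ c * x` in the Gamma density. The exponential factor is the only trace of
the density that is not homogeneous. -/
theorem lintegral_gammaMeasure_scale {a c : ℝ} (ha : 0 < a) (hc : 0 < c) {f : ℝ → ENNReal}
    (hf : Measurable f) :
    ∫⁻ x, f x ∂gammaMeasure a 1
      = ∫⁻ x, f (c * x) * ENNReal.ofReal (c ^ a * Real.exp (-((c - 1) * x)))
          ∂gammaMeasure a 1 := by
  have hm : Measurable (gammaPDF a 1) := (measurable_gammaPDFReal a 1).ennreal_ofReal
  have hw : Measurable fun x : ℝ => ENNReal.ofReal (c ^ a * Real.exp (-((c - 1) * x))) := by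
    fun_prop
  unfold gammaMeasure
  rw [lintegral_withDensity_eq_lintegral_mul _ hm hf,
    lintegral_withDensity_eq_lintegral_mul _ hm (by fun_prop)]
  conv_lhs => rw [← Real.smul_map_volume_mul_left hc.ne']
  rw [lintegral_smul_measure, lintegral_map (hm.mul hf) (by fun_prop), abs_of_pos hc,
    smul_eq_mul, ← lintegral_const_mul' _ _ ENNReal.ofReal_ne_top]
  refine lintegral_congr fun x => ?_
  simp only [Pi.mul_apply]
  have key : ENNReal.ofReal c * gammaPDF a 1 (c * x)
      = gammaPDF a 1 x * ENNReal.ofReal (c ^ a * Real.exp (-((c - 1) * x))) := by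
    rcases lt_or_ge x 0 with hx | hx
    · rw [gammaPDF_of_neg hx, gammaPDF_of_neg (mul_neg_of_pos_of_neg hc hx)]; simp
    · rw [gammaPDF_of_nonneg hx, gammaPDF_of_nonneg (by positivity), ← ENNReal.ofReal_mul hc.le,
        ← ENNReal.ofReal_mul (by have := Real.Gamma_pos_of_pos ha; positivity)]
      congr 1
      rw [Real.mul_rpow hc.le hx, Real.rpow_sub_one hc.ne',
        show -(1 * (c * x)) = -(1 * x) + -((c - 1) * x) by ring, Real.exp_add]
      field_simp
  rw [← mul_assoc, key]; ring

theorem ae_pos_gammaMeasure (a : ℝ) : ∀ᵐ x ∂gammaMeasure a 1, 0 < x := by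
  have h : {x : ℝ | ¬ 0 < x} = Set.Iic 0 := by ext; simp
  rw [ae_iff, h, gammaMeasure, withDensity_apply _ measurableSet_Iic,
    setLIntegral_congr Iio_ae_eq_Iic.symm]
  exact lintegral_gammaPDF_of_nonpos le_rfl

variable {ι : Type*} [Fintype ι]

/-- The law of independent `Gamma(α i, 1)` variables. -/
noncomputable abbrev piGamma (α : ι → ℝ) : Measure (ι → ℝ) :=
  Measure.pi fun i => gammaMeasure (α i) 1

theorem isProbabilityMeasure_piGamma {α : ι → ℝ} (hα : ∀ i, 0 < α i) :
    IsProbabilityMeasure (piGamma α) := by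
  have := fun i => isProbabilityMeasure_gammaMeasure (hα i) one_pos
  infer_instance

theorem ae_pos_piGamma {α : ι → ℝ} (hα : ∀ i, 0 < α i) : ∀ᵐ g ∂piGamma α, ∀ i, 0 < g i := by
  have := fun i => isProbabilityMeasure_gammaMeasure (hα i) one_pos
  refine Filter.eventually_all.2 fun i => ?_
  exact (Measure.quasiMeasurePreserving_eval (fun i => gammaMeasure (α i) 1) i).ae
    (ae_pos_gammaMeasure (α i))

theorem pi_withDensity_prod {μ : ι → Measure ℝ} [∀ i, IsProbabilityMeasure (μ i)]
    {f : ι → ℝ → ENNReal} (hf : ∀ i, Measurable (f i))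
    (hfi : ∀ i, ∫⁻ x, f i x ∂μ i = 1) :
    (Measure.pi μ).withDensity (fun g => ∏ i, f i (g i))
      = Measure.pi fun i => (μ i).withDensity (f i) := by
  have : ∀ i, IsProbabilityMeasure ((μ i).withDensity (f i)) := fun i =>
    ⟨by rw [withDensity_apply _ MeasurableSet.univ, setLIntegral_univ, hfi]⟩
  symm
  refine Measure.pi_eq fun s hs => ?_
  rw [withDensity_apply _ (MeasurableSet.univ_pi hs), ← lintegral_indicator
    (MeasurableSet.univ_pi hs)]
  have h1 : ∀ g : ι → ℝ, (Set.univ.pi s).indicator (fun g => ∏ i, f i (g i)) g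
      = ∏ i, (s i).indicator (f i) (g i) := by
    intro g
    by_cases hg : g ∈ Set.univ.pi s
    · rw [Set.indicator_of_mem hg]
      exact Finset.prod_congr rfl fun i _ => by
        rw [Set.indicator_of_mem (hg i (Set.mem_univ i))]
    · rw [Set.indicator_of_notMem hg]
      simp only [Set.mem_univ_pi, not_forall] at hg
      obtain ⟨i, hi⟩ := hg
      exact (Finset.prod_eq_zero (Finset.mem_univ i) (Set.indicator_of_notMem hi _)).symm
  simp_rw [h1]
  rw [lintegral_prod_eq_prod_lintegral_of_indepFun Finset.univ
    (fun i (g : ι → ℝ) => (s i).indicator (f i) (g i))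
    (iIndepFun_pi fun i => ((hf i).indicator (hs i)).aemeasurable)
    (fun i => ((hf i).indicator (hs i)).comp (measurable_pi_apply i))]
  refine Finset.prod_congr rfl fun i _ => ?_
  rw [withDensity_apply _ (hs i), ← lintegral_indicator (hs i)]
  exact (measurePreserving_eval μ i).lintegral_comp ((hf i).indicator (hs i))

/-- The product of the one-dimensional substitutions. What matters later is that the resulting
density depends on `g` only through `∑ i, g i`. -/
theorem lintegral_piGamma_scale {α : ι → ℝ} (hα : ∀ i, 0 < α i) {c : ℝ} (hc : 0 < c)
    {f : (ι → ℝ) → ENNReal} (hf : Measurable f) :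
    ∫⁻ g, f g ∂piGamma α
      = ∫⁻ g, f (fun i => c * g i)
          * ENNReal.ofReal (c ^ (∑ i, α i) * Real.exp (-((c - 1) * ∑ i, g i))) ∂piGamma α := by
  have := fun i => isProbabilityMeasure_gammaMeasure (hα i) one_pos
  set w : ι → ℝ → ENNReal := fun i x => ENNReal.ofReal (c ^ α i * Real.exp (-((c - 1) * x)))
    with hw
  have hwm : ∀ i, Measurable (w i) := fun i => by fun_prop
  have hw1 : ∀ i, ∫⁻ x, w i x ∂gammaMeasure (α i) 1 = 1 := fun i => by
    have := lintegral_gammaMeasure_scale (hα i) hc (f := fun _ => 1) measurable_const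
    simpa using this.symm
  have hd : ∀ i, IsProbabilityMeasure ((gammaMeasure (α i) 1).withDensity (w i)) := fun i =>
    ⟨by rw [withDensity_apply _ MeasurableSet.univ, setLIntegral_univ, hw1]⟩
  have h1 : ∀ i, gammaMeasure (α i) 1
      = ((gammaMeasure (α i) 1).withDensity (w i)).map (fun x => c * x) := fun i => by
    ext s hs
    rw [Measure.map_apply (by fun_prop) hs, withDensity_apply _ (by measurability),
      ← lintegral_indicator_one hs, lintegral_gammaMeasure_scale (hα i) hc
      (measurable_one.indicator hs), ← lintegral_indicator (by measurability)]
    refine lintegral_congr fun x => ?_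
    by_cases hx : c * x ∈ s <;> simp [Set.indicator, hx, hw]
  have hp : ∀ i, IsProbabilityMeasure
      (((gammaMeasure (α i) 1).withDensity (w i)).map (fun x => c * x)) := fun i =>
    Measure.isProbabilityMeasure_map (by fun_prop)
  have h2 : piGamma α
      = ((piGamma α).withDensity fun g => ∏ i, w i (g i)).map (fun g i => c * g i) := by
    rw [pi_withDensity_prod hwm hw1, Measure.pi_map_pi fun i => by fun_prop]
    unfold piGamma
    congr 1
    ext1 i
    exact h1 i
  conv_lhs => rw [h2]
  rw [lintegral_map hf (by fun_prop), lintegral_withDensity_eq_lintegral_mul _ (by fun_prop)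
    (by fun_prop)]
  refine lintegral_congr fun g => ?_
  simp only [Pi.mul_apply, hw]
  rw [mul_comm, ← ENNReal.ofReal_prod_of_nonneg fun i _ => by positivity, Finset.prod_mul_distrib,
    ← Real.exp_sum, Real.rpow_sum_of_pos hc, Finset.sum_neg_distrib, Finset.mul_sum]

/-- Independence of the sum from scale-invariant functions, without Jacobians. Once the factor `exp
(-∑ i, g i)` is removed from the density, what remains is homogeneous, so the law of the sum
weighted by `F` is determined up to a constant by its mass on `Iic 1`. -/
theorem lintegral_mul_sum_piGamma [Nonempty ι] {α : ι → ℝ} (hα : ∀ i, 0 < α i)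
    {F : (ι → ℝ) → ENNReal} (hF : Measurable F) (hF1 : ∀ g, F g ≤ 1)
    (hFs : ∀ c : ℝ, 0 < c → ∀ g, F (fun i => c * g i) = F g)
    {h : ℝ → ENNReal} (hh : Measurable h) :
    ∫⁻ g, F g * h (∑ i, g i) ∂piGamma α
      = (∫⁻ g, F g ∂piGamma α) * ∫⁻ g, h (∑ i, g i) ∂piGamma α := by
  have := isProbabilityMeasure_piGamma hα
  have hS : Measurable fun g : ι → ℝ => ∑ i, g i := by fun_prop
  have hE : Measurable fun g : ι → ℝ => ENNReal.ofReal (Real.exp (∑ i, g i)) := by fun_prop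
  -- The law of the sum under the weight `F`, tilted by `exp (∑ i, g i)` to cancel the exponential
  -- in the Gamma densities.
  let ν : ((ι → ℝ) → ENNReal) → Measure ℝ := fun F =>
    ((piGamma α).withDensity fun g => F g * ENNReal.ofReal (Real.exp (∑ i, g i))).map
      fun g => ∑ i, g i
  have hν : ∀ F, Measurable F → ∀ k : ℝ → ENNReal, Measurable k →
      ∫⁻ x, k x ∂ν F
        = ∫⁻ g, F g * ENNReal.ofReal (Real.exp (∑ i, g i)) * k (∑ i, g i) ∂piGamma α := by
    intro F hF k hk
    rw [lintegral_map hk hS]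
    exact lintegral_withDensity_eq_lintegral_mul _ (hF.mul hE) (hk.comp hS)
  have hscale : ∀ F, Measurable F → (∀ c : ℝ, 0 < c → ∀ g, F (fun i => c * g i) = F g) →
      ∀ T : ℝ, 0 < T → ν F (Set.Iic T) = ENNReal.ofReal (T ^ ∑ i, α i) * ν F (Set.Iic 1) := by
    intro F hF hFs T hT
    rw [← lintegral_indicator_one measurableSet_Iic, ← lintegral_indicator_one measurableSet_Iic,
      hν F hF _ (measurable_one.indicator measurableSet_Iic),
      hν F hF _ (measurable_one.indicator measurableSet_Iic),
      lintegral_piGamma_scale hα hT (f := fun g => F g * ENNReal.ofReal (Real.exp (∑ i, g i))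
        * (Set.Iic T).indicator 1 (∑ i, g i))
        ((hF.mul hE).mul ((measurable_one.indicator measurableSet_Iic).comp hS)),
      ← lintegral_const_mul' _ _ ENNReal.ofReal_ne_top]
    refine lintegral_congr fun g => ?_
    rw [hFs T hT, ← Finset.mul_sum]
    have h1 : (Set.Iic T).indicator (1 : ℝ → ENNReal) (T * ∑ i, g i)
        = (Set.Iic (1 : ℝ)).indicator 1 (∑ i, g i) := by
      have : T * ∑ i, g i ≤ T ↔ ∑ i, g i ≤ 1 := by
        constructor
        · intro h; by_contra hcon; push Not at hcon; nlinarith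
        · intro h; nlinarith
      simp only [Set.indicator, Set.mem_Iic, this, Pi.one_apply]
    rw [h1]
    have h2 : ENNReal.ofReal (Real.exp (T * ∑ i, g i))
          * ENNReal.ofReal (T ^ (∑ i, α i) * Real.exp (-((T - 1) * ∑ i, g i)))
        = ENNReal.ofReal (T ^ ∑ i, α i) * ENNReal.ofReal (Real.exp (∑ i, g i)) := by
      rw [← ENNReal.ofReal_mul (by positivity), ← ENNReal.ofReal_mul (by positivity)]
      congr 1
      rw [mul_left_comm, ← Real.exp_add]
      congr 2; ring
    calc _ = F g * (ENNReal.ofReal (Real.exp (T * ∑ i, g i))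
          * ENNReal.ofReal (T ^ (∑ i, α i) * Real.exp (-((T - 1) * ∑ i, g i))))
          * (Set.Iic (1 : ℝ)).indicator 1 (∑ i, g i) := by ring
      _ = _ := by rw [h2]; ring
  have hzero : ∀ F, Measurable F → ∀ T : ℝ, T ≤ 0 → ν F (Set.Iic T) = 0 := by
    intro F hF T hT
    rw [← lintegral_indicator_one measurableSet_Iic,
      hν F hF _ (measurable_one.indicator measurableSet_Iic)]
    refine (lintegral_congr_ae ?_).trans lintegral_zero
    filter_upwards [ae_pos_piGamma hα] with g hg
    have : 0 < ∑ i, g i := Finset.sum_pos (fun i _ => hg i) Finset.univ_nonempty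
    rw [Set.indicator_of_notMem (by simp; linarith), mul_zero]
  have hfin : ∀ F, Measurable F → (∀ g, F g ≤ 1) → ∀ T : ℝ, ν F (Set.Iic T) ≠ ⊤ := by
    intro F hF hF1 T
    rw [← lintegral_indicator_one measurableSet_Iic,
      hν F hF _ (measurable_one.indicator measurableSet_Iic)]
    refine ne_top_of_le_ne_top (b := ∫⁻ _, ENNReal.ofReal (Real.exp T) ∂piGamma α) (by simp)
      (lintegral_mono fun g => ?_)
    by_cases hg : ∑ i, g i ≤ T
    · rw [Set.indicator_of_mem (by simpa using hg), Pi.one_apply, mul_one]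
      calc _ ≤ 1 * ENNReal.ofReal (Real.exp (∑ i, g i)) := by gcongr; exact hF1 g
        _ ≤ _ := by rw [one_mul]; gcongr
    · rw [Set.indicator_of_notMem (by simpa using hg), mul_zero]; exact zero_le
  have h1m : Measurable fun _ : ι → ℝ => (1 : ENNReal) := measurable_const
  -- Both distribution functions are multiples of `T ^ ∑ i, α i` on `T > 0` and vanish for `T ≤ 0`,
  -- so the two measures are proportional.
  have hprop : ν (fun _ => 1) (Set.Iic 1) • ν F = ν F (Set.Iic 1) • ν (fun _ => 1) := by
    have hfin1 := hfin _ h1m (fun _ => le_rfl)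
    have hfinF := hfin F hF hF1
    have hIoc : ∀ F, (∀ T : ℝ, ν F (Set.Iic T) ≠ ⊤) → ∀ a b : ℝ, a < b →
        ν F (Set.Ioc a b) = ν F (Set.Iic b) - ν F (Set.Iic a) := by
      intro F hF a b hab
      rw [← measure_sdiff (Set.Iic_subset_Iic.2 hab.le) measurableSet_Iic.nullMeasurableSet (hF a)]
      congr 1
      ext; simp [and_comm]
    refine Measure.ext_of_Ioc' _ _ (fun a b hab => ?_) (fun a b hab => ?_)
    · rw [Measure.smul_apply, smul_eq_mul]
      exact ENNReal.mul_ne_top (hfin1 1)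
        (ne_top_of_le_ne_top (hfinF b) (measure_mono Set.Ioc_subset_Iic_self))
    · simp only [Measure.smul_apply, smul_eq_mul]
      rw [hIoc _ hfinF a b hab, hIoc _ hfin1 a b hab,
        ENNReal.mul_sub fun _ _ => hfin1 1, ENNReal.mul_sub fun _ _ => hfinF 1]
      have : ∀ T : ℝ, ν (fun _ => 1) (Set.Iic 1) * ν F (Set.Iic T)
          = ν F (Set.Iic 1) * ν (fun _ => 1) (Set.Iic T) := by
        intro T
        rcases le_or_gt T 0 with hT | hT
        · rw [hzero F hF T hT, hzero _ h1m T hT]; simp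
        · rw [hscale F hF hFs T hT, hscale _ h1m (fun _ _ _ => rfl) T hT]; ring
      rw [this a, this b]
  have hback : ∀ F, Measurable F → ∀ k : ℝ → ENNReal, Measurable k →
      ∫⁻ x, ENNReal.ofReal (Real.exp (-x)) * k x ∂ν F = ∫⁻ g, F g * k (∑ i, g i) ∂piGamma α := by
    intro F hF k hk
    rw [hν F hF _ (by fun_prop)]
    refine lintegral_congr fun g => ?_
    have : ENNReal.ofReal (Real.exp (∑ i, g i)) * ENNReal.ofReal (Real.exp (-∑ i, g i)) = 1 := by
      rw [← ENNReal.ofReal_mul (by positivity), ← Real.exp_add]; simp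
    calc _ = F g * (ENNReal.ofReal (Real.exp (∑ i, g i)) * ENNReal.ofReal (Real.exp (-∑ i, g i)))
          * k (∑ i, g i) := by ring
      _ = _ := by rw [this, mul_one]
  have hmul : ∀ k : ℝ → ENNReal, Measurable k →
      ν (fun _ => 1) (Set.Iic 1) * ∫⁻ g, F g * k (∑ i, g i) ∂piGamma α
        = ν F (Set.Iic 1) * ∫⁻ g, k (∑ i, g i) ∂piGamma α := by
    intro k hk
    have := congrArg (fun m => ∫⁻ x, ENNReal.ofReal (Real.exp (-x)) * k x ∂m) hprop
    simp only [lintegral_smul_measure, smul_eq_mul] at this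
    rw [hback F hF k hk, hback _ h1m k hk] at this
    simpa using this
  -- Were the constant zero, homogeneity would make `ν (fun _ => 1)` vanish, although undoing the
  -- tilt must give back total mass one.
  have hne : ν (fun _ => 1) (Set.Iic 1) ≠ 0 := by
    intro h0
    have hall : ∀ n : ℕ, ν (fun _ => 1) (Set.Iic (n : ℝ)) = 0 := by
      intro n
      rcases Nat.eq_zero_or_pos n with hn | hn
      · exact hzero _ h1m _ (by simp [hn])
      · rw [hscale _ h1m (fun _ _ _ => rfl) _ (by positivity), h0, mul_zero]
    have huniv : ν (fun _ => 1) = 0 := by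
      rw [← Measure.measure_univ_eq_zero]
      have : (Set.univ : Set ℝ) = ⋃ n : ℕ, Set.Iic (n : ℝ) := by
        symm
        rw [Set.eq_univ_iff_forall]
        exact fun x => Set.mem_iUnion.2 (exists_nat_ge x)
      rw [this]
      exact measure_iUnion_null hall
    have := hback _ h1m (fun _ => 1) measurable_const
    rw [huniv] at this
    simp at this
  have h1 := hmul (fun _ => 1) measurable_const
  simp only [mul_one, lintegral_const, measure_univ] at h1
  have h2 := hmul h hh
  rw [← h1, mul_assoc] at h2
  exact (ENNReal.mul_right_inj hne (hfin _ h1m (fun _ => le_rfl) 1)).1 h2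

end Dirichlet

/-! ### Dirichlet rows: means, and independence of the leaving probability from the jump direction.
-/

section DirichletRow

/-- A further independent coordinate may join `Y`. It serves to adjoin the Gamma variable of the
current state to the sum of the others. -/
theorem ProbabilityTheory.IndepFun.comp_snd_prodMk {Ω₁ Ω₂ A B : Type*} [MeasurableSpace Ω₁]
    [MeasurableSpace Ω₂] [MeasurableSpace A] [MeasurableSpace B] {μ : Measure Ω₁} {ν : Measure Ω₂}
    [IsProbabilityMeasure μ] [IsProbabilityMeasure ν] {X : Ω₂ → A} {Y : Ω₂ → B}
    (h : IndepFun X Y ν) (hX : Measurable X) (hY : Measurable Y) :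
    IndepFun (fun z : Ω₁ × Ω₂ => X z.2) (fun z => (z.1, Y z.2)) (μ.prod ν) := by
  rw [indepFun_iff_measure_inter_preimage_eq_mul] at h ⊢
  intro s t hs ht
  have hY' : Measurable fun z : Ω₁ × Ω₂ => (z.1, Y z.2) := by fun_prop
  have hX' : Measurable fun z : Ω₁ × Ω₂ => X z.2 := by fun_prop
  rw [Measure.prod_apply ((hX' hs).inter (hY' ht)), Measure.prod_apply (hX' hs),
    Measure.prod_apply (hY' ht)]
  have h1 : ∀ a : Ω₁, ν (Prod.mk a ⁻¹' ((fun z : Ω₁ × Ω₂ => X z.2) ⁻¹' s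
        ∩ (fun z : Ω₁ × Ω₂ => (z.1, Y z.2)) ⁻¹' t))
      = ν (X ⁻¹' s) * ν (Prod.mk a ⁻¹' ((fun z : Ω₁ × Ω₂ => (z.1, Y z.2)) ⁻¹' t)) := fun a =>
    h s (Prod.mk a ⁻¹' t) hs (measurable_prodMk_left ht)
  have h2 : ∀ a : Ω₁, ν (Prod.mk a ⁻¹' ((fun z : Ω₁ × Ω₂ => X z.2) ⁻¹' s)) = ν (X ⁻¹' s) :=
    fun a => rfl
  simp_rw [h1, h2]
  rw [lintegral_const_mul _ (measurable_measure_prodMk_left (hY' ht)), lintegral_const,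
    measure_univ, mul_one]

theorem ProbabilityTheory.IndepFun.of_comp_map {Ω E A B : Type*} [MeasurableSpace Ω]
    [MeasurableSpace E] [MeasurableSpace A] [MeasurableSpace B] {μ : Measure Ω} {f : Ω → E}
    (hf : Measurable f) {X : E → A} {Y : E → B} (hX : Measurable X) (hY : Measurable Y)
    (h : IndepFun (X ∘ f) (Y ∘ f) μ) : IndepFun X Y (μ.map f) := by
  rw [indepFun_iff_measure_inter_preimage_eq_mul] at h ⊢
  intro s t hs ht
  rw [Measure.map_apply hf ((hX hs).inter (hY ht)), Measure.map_apply hf (hX hs),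
    Measure.map_apply hf (hY ht)]
  exact h s t hs ht

theorem ProbabilityTheory.IndepFun.comp_measurePreserving {Ω E A B : Type*} [MeasurableSpace Ω]
    [MeasurableSpace E] [MeasurableSpace A] [MeasurableSpace B] {μ : Measure Ω} {ν : Measure E}
    {f : Ω → E} (hf : MeasurePreserving f μ ν) {X : E → A} {Y : E → B} (hX : Measurable X)
    (hY : Measurable Y) (h : IndepFun X Y ν) : IndepFun (X ∘ f) (Y ∘ f) μ := by
  rw [indepFun_iff_measure_inter_preimage_eq_mul] at h ⊢
  intro s t hs ht
  rw [Set.preimage_comp, Set.preimage_comp, ← Set.preimage_inter,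
    hf.measure_preimage ((hX hs).inter (hY ht)).nullMeasurableSet,
    hf.measure_preimage (hX hs).nullMeasurableSet, hf.measure_preimage (hY ht).nullMeasurableSet]
  exact h s t hs ht

section

variable {ι : Type*}

/-- The law of the jump direction: the distribution `φ` conditioned to avoid `i`. -/
noncomputable def jumpDirection [DecidableEq ι] (i : ι) (φ : ι → ℝ) : ι → ℝ :=
  fun j => if j = i then 0 else φ j / (1 - φ i)

theorem measurable_jumpDirection [DecidableEq ι] (i : ι) :
    Measurable (jumpDirection (ι := ι) i) := by
  refine measurable_pi_lambda _ fun j => ?_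
  unfold jumpDirection
  split_ifs <;> fun_prop

end

variable {ι : Type*} [Fintype ι]

/-- The ratios are invariant under scaling, so `lintegral_mul_sum_piGamma` applies to indicators. -/
theorem indepFun_ratio_sum_piGamma {α : ι → ℝ} (hα : ∀ i, 0 < α i) :
    IndepFun (fun (g : ι → ℝ) i => g i / ∑ j, g j) (fun g => ∑ j, g j) (piGamma α) := by
  have := isProbabilityMeasure_piGamma hα
  cases isEmpty_or_nonempty ι with
  | inl h =>
    have : (fun (g : ι → ℝ) i => g i / ∑ j, g j) = fun _ => fun i => isEmptyElim i := by
      ext g i; exact isEmptyElim i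
    rw [this]
    exact indepFun_const_left _ _
  | inr h =>
    have hR : Measurable fun (g : ι → ℝ) i => g i / ∑ j, g j := by fun_prop
    have hS : Measurable fun (g : ι → ℝ) => ∑ j, g j := by fun_prop
    rw [indepFun_iff_measure_inter_preimage_eq_mul]
    intro s t hs ht
    have key := lintegral_mul_sum_piGamma hα
      (F := fun g => s.indicator 1 (fun i => g i / ∑ j, g j)) (h := t.indicator 1)
      ((measurable_one.indicator hs).comp hR) (fun g => Set.indicator_le_self' (by simp) _)
      (fun c hc g => by
        simp only [← Finset.mul_sum, mul_div_mul_left _ _ hc.ne'])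
      (measurable_one.indicator ht)
    rw [← lintegral_indicator_one (hR hs), ← lintegral_indicator_one (hS ht),
      ← lintegral_indicator_one ((hR hs).inter (hS ht))]
    calc _ = _ := lintegral_congr fun g => by
          rw [Set.inter_indicator_one]; rfl
      _ = _ := key

/-- Multiplying the density with shape `a` by `x` gives `a` times the density with shape `a + 1`. -/
theorem lintegral_ofReal_gammaMeasure {a : ℝ} (ha : 0 < a) :
    ∫⁻ x, ENNReal.ofReal x ∂gammaMeasure a 1 = ENNReal.ofReal a := by
  have hm : ∀ a, Measurable (gammaPDF a 1) := fun a => (measurable_gammaPDFReal a 1).ennreal_ofReal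
  rw [gammaMeasure, lintegral_withDensity_eq_lintegral_mul _ (hm a) (by fun_prop)]
  have h : ∀ x : ℝ, gammaPDF a 1 x * ENNReal.ofReal x
      = ENNReal.ofReal a * gammaPDF (a + 1) 1 x := by
    intro x
    rcases lt_or_ge x 0 with hx | hx
    · rw [gammaPDF_of_neg hx, gammaPDF_of_neg hx]; simp
    · have hG := Real.Gamma_pos_of_pos ha
      rw [gammaPDF_of_nonneg hx, gammaPDF_of_nonneg hx,
        ← ENNReal.ofReal_mul (by positivity), ← ENNReal.ofReal_mul ha.le, Real.Gamma_add_one ha.ne']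
      congr 1
      rcases hx.eq_or_lt with rfl | hx0
      · simp [ha.ne']
      · rw [add_sub_cancel_right, Real.rpow_sub_one hx0.ne']
        field_simp
        simp
  simp only [Pi.mul_apply, h]
  rw [lintegral_const_mul _ (hm _), lintegral_gammaPDF_eq_one (by positivity) one_pos, mul_one]

theorem isProbabilityMeasure_dirichletMeasure {α : ι → ℝ} (hα : ∀ i, 0 < α i) :
    IsProbabilityMeasure (dirichletMeasure α) := by
  have := isProbabilityMeasure_piGamma hα
  exact Measure.isProbabilityMeasure_map (by fun_prop)

/-- Since `g i` is the product of its ratio and the independent sum, the mean of the ratio is the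
quotient of the means. -/
theorem lintegral_ofReal_dirichletMeasure {α : ι → ℝ} (hα : ∀ i, 0 < α i) (i : ι) :
    ∫⁻ φ, ENNReal.ofReal (φ i) ∂dirichletMeasure α = ENNReal.ofReal (α i / ∑ j, α j) := by
  have := isProbabilityMeasure_piGamma hα
  have := fun i => isProbabilityMeasure_gammaMeasure (hα i) one_pos
  have hne : Nonempty ι := ⟨i⟩
  have hsum : 0 < ∑ j, α j := Finset.sum_pos (fun i _ => hα i) Finset.univ_nonempty
  rw [dirichletMeasure, lintegral_map (by fun_prop) (by fun_prop)]
  have hg : ∀ i, ∫⁻ g, ENNReal.ofReal (g i) ∂piGamma α = ENNReal.ofReal (α i) := fun i =>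
    ((measurePreserving_eval (fun i => gammaMeasure (α i) 1) i).lintegral_comp
      ENNReal.measurable_ofReal).trans (lintegral_ofReal_gammaMeasure (hα i))
  have hs : ∫⁻ g : ι → ℝ, ENNReal.ofReal (∑ j, g j) ∂piGamma α = ENNReal.ofReal (∑ j, α j) := by
    rw [ENNReal.ofReal_sum_of_nonneg fun i _ => (hα i).le, ← Finset.sum_congr rfl fun i _ => hg i,
      ← lintegral_finsetSum _ fun i _ => by fun_prop]
    refine lintegral_congr_ae ?_
    filter_upwards [ae_pos_piGamma hα] with g hg
    exact ENNReal.ofReal_sum_of_nonneg fun i _ => (hg i).le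
  have hind := (indepFun_ratio_sum_piGamma hα).comp (φ := fun r : ι → ℝ => ENNReal.ofReal (r i))
    (ψ := ENNReal.ofReal) (by fun_prop) (by fun_prop)
  have hprod := lintegral_mul_eq_lintegral_mul_lintegral_of_indepFun
    (by fun_prop) (by fun_prop) hind
  have hl : ∫⁻ g, ((fun r : ι → ℝ => ENNReal.ofReal (r i)) ∘ (fun (g : ι → ℝ) i => g i / ∑ j, g j)
      * ENNReal.ofReal ∘ fun g : ι → ℝ => ∑ j, g j) g ∂piGamma α = ENNReal.ofReal (α i) := by
    rw [← hg i]
    refine lintegral_congr_ae ?_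
    filter_upwards [ae_pos_piGamma hα] with g hg
    have : 0 < ∑ i, g i := Finset.sum_pos (fun i _ => hg i) Finset.univ_nonempty
    simp only [Pi.mul_apply, Function.comp_apply]
    rw [← ENNReal.ofReal_mul (div_nonneg (hg i).le this.le), div_mul_cancel₀ _ this.ne']
  rw [hl] at hprod
  simp only [Function.comp_apply] at hprod
  rw [hs] at hprod
  rw [ENNReal.ofReal_div_of_pos hsum, hprod]
  exact (ENNReal.mul_div_cancel_right (by simpa using hsum) ENNReal.ofReal_ne_top).symm

theorem ae_mem_simplex_dirichletMeasure {α : ι → ℝ} [Nonempty ι] (hα : ∀ i, 0 < α i) :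
    ∀ᵐ φ ∂dirichletMeasure α, (∀ i, 0 ≤ φ i) ∧ ∑ i, φ i = 1 := by
  rw [dirichletMeasure, ae_map_iff (by fun_prop) (by measurability)]
  filter_upwards [ae_pos_piGamma hα] with g hg
  have : 0 < ∑ i, g i := Finset.sum_pos (fun i _ => hg i) Finset.univ_nonempty
  exact ⟨fun i => div_nonneg (hg i).le this.le, by rw [← Finset.sum_div, div_self this.ne']⟩

theorem lintegral_ofReal_one_sub_dirichletMeasure {α : ι → ℝ} (hα : ∀ i, 0 < α i) (i : ι) :
    ∫⁻ φ, ENNReal.ofReal (1 - φ i) ∂dirichletMeasure α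
      = ENNReal.ofReal (1 - α i / ∑ j, α j) := by
  classical
  have hne : Nonempty ι := ⟨i⟩
  have hsum : 0 < ∑ j, α j := Finset.sum_pos (fun i _ => hα i) Finset.univ_nonempty
  have h1 : 1 - α i / ∑ j, α j = ∑ k ∈ Finset.univ.erase i, α k / ∑ j, α j := by
    rw [← Finset.sum_div, ← Finset.add_sum_erase _ _ (Finset.mem_univ i)]
    rw [← Finset.add_sum_erase _ _ (Finset.mem_univ i)] at hsum
    field_simp
    ring
  rw [h1, ENNReal.ofReal_sum_of_nonneg fun k _ => div_nonneg (hα k).le hsum.le,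
    Finset.sum_congr rfl fun k _ => (lintegral_ofReal_dirichletMeasure hα k).symm,
    ← lintegral_finsetSum _ fun i _ => by fun_prop]
  refine lintegral_congr_ae ?_
  filter_upwards [ae_mem_simplex_dirichletMeasure hα] with φ hφ
  rw [← ENNReal.ofReal_sum_of_nonneg fun k _ => hφ.1 k]
  congr 1
  rw [← hφ.2, ← Finset.add_sum_erase _ _ (Finset.mem_univ i)]
  ring

/-- The direction is the vector of ratios among the Gamma variables other than `g i`, while `1 - φ
i` is a function of `g i` and of the sum of the others. The former is independent of the latter
pair. -/
theorem indepFun_jumpDirection [DecidableEq ι] {α : ι → ℝ} (hα : ∀ i, 0 < α i) (i : ι) :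
    IndepFun (jumpDirection i) (fun φ => 1 - φ i) (dirichletMeasure α) := by
  have := fun i => isProbabilityMeasure_gammaMeasure (hα i) one_pos
  have hne : Nonempty ι := ⟨i⟩
  refine IndepFun.of_comp_map (by fun_prop) (measurable_jumpDirection i) (by fun_prop) ?_
  have hpres := measurePreserving_piEquivPiSubtypeProd (fun i => gammaMeasure (α i) 1) (· = i)
  have h1 := (indepFun_ratio_sum_piGamma (α := fun j : {j // ¬ j = i} => α j)
    fun j => hα j).comp_snd_prodMk (μ := Measure.pi fun j : {j // j = i} => gammaMeasure (α j) 1)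
    (by fun_prop) (by fun_prop)
  have h2 := h1.comp (φ := fun (r : {j // ¬ j = i} → ℝ) (j : ι) =>
      if h : j = i then (0 : ℝ) else r ⟨j, h⟩)
    (ψ := fun z : ({j // j = i} → ℝ) × ℝ => z.2 / (z.1 ⟨i, rfl⟩ + z.2))
    (by refine measurable_pi_lambda _ fun j => ?_
        split_ifs <;> fun_prop) (by fun_prop)
  rw [Subsingleton.elim (Fintype.subtypeEq i) (Subtype.fintype fun j => j = i)] at h2
  refine (h2.comp_measurePreserving hpres ?_ ?_).congr ?_ ?_
  · refine measurable_pi_lambda _ fun j => ?_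
    by_cases h : j = i
    · simp only [Function.comp_apply, h, dite_true]; fun_prop
    · simp only [Function.comp_apply, h, dite_false]; fun_prop
  · simp only [Function.comp_def]; fun_prop
  all_goals
    filter_upwards [ae_pos_piGamma hα] with g hg
    have hs : 0 < ∑ i, g i := Finset.sum_pos (fun i _ => hg i) Finset.univ_nonempty
    have hsplit : ∑ k, g k = g i + ∑ k : {k // ¬ k = i}, g k := by
      rw [← Finset.add_sum_erase _ _ (Finset.mem_univ i)]
      congr 1
      exact Finset.sum_subtype _ (by simp) _
    have hrest : 1 - g i / ∑ k, g k = (∑ k : {k // ¬ k = i}, g k) / ∑ k, g k := by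
      rw [eq_div_iff hs.ne', sub_mul, div_mul_cancel₀ _ hs.ne', hsplit]; ring
  · ext j
    by_cases h : j = i
    · simp [jumpDirection, h]
    · simp only [jumpDirection, h, Function.comp_apply, dite_false, if_false, hrest]
      rw [div_div_div_cancel_right₀ hs.ne']
      rfl
  · simp only [Function.comp_apply]
    rw [hrest, hsplit]
    rfl

end DirichletRow

/-! ### Laplace transforms of holding times along the jump chain. -/

section JumpWeight

/-- Hölder's inequality with `k` exponents `1 / k` copes with states that occur in several pairs.
Within a pair the two states differ, so independence gives `B ^ 2`; single states would only yield
`B`, and in the end a tail `1 / k` that is not summable. -/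
theorem lintegral_prod_pairs_le {S Ω : Type*} [MeasurableSpace Ω] {μ : Measure Ω}
    {q : S → Ω → ENNReal} (hq : ∀ s, Measurable (q s)) (hind : iIndepFun q μ) {k : ℕ}
    {B : ENNReal} (hB : ∀ s, ∫⁻ ω, q s ω ^ k ∂μ ≤ B) (hk : k ≠ 0) (l : List (S × S))
    (hl : ∀ p ∈ l, p.1 ≠ p.2) (hlen : l.length = k) :
    ∫⁻ ω, (l.map fun p => q p.1 ω * q p.2 ω).prod ∂μ ≤ B ^ 2 := by
  have hz : ∀ p ∈ l, ∫⁻ ω, (q p.1 ω * q p.2 ω) ^ k ∂μ ≤ B ^ 2 := by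
    intro p hp
    have h1 := ((hind.indepFun (hl p hp)).comp (φ := fun x => x ^ k) (ψ := fun x => x ^ k)
      (by fun_prop) (by fun_prop))
    have h2 := lintegral_mul_eq_lintegral_mul_lintegral_of_indepFun
      (((hq p.1).pow_const k)) (((hq p.2).pow_const k)) h1
    simp only [Pi.mul_apply] at h2
    simp_rw [mul_pow]
    rw [h2, sq]
    exact mul_le_mul' (hB _) (hB _)
  have h3 : ∀ ω, (l.map fun p => q p.1 ω * q p.2 ω).prod
      = ∏ i : Fin l.length, ((q l[i].1 ω * q l[i].2 ω) ^ k) ^ ((k : ℝ)⁻¹) := by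
    intro ω
    simp_rw [ENNReal.pow_rpow_inv_natCast hk]
    exact (Fin.prod_univ_fun_getElem l fun p => q p.1 ω * q p.2 ω).symm
  simp_rw [h3]
  refine (ENNReal.lintegral_prod_norm_pow_le Finset.univ (fun i _ => ?_) ?_ fun i _ => by
    positivity).trans ?_
  · exact (((hq _).mul (hq _)).pow_const k).aemeasurable
  · simp [hlen, hk]
  · calc _ ≤ ∏ i : Fin l.length, (B ^ 2) ^ ((k : ℝ)⁻¹) :=
          Finset.prod_le_prod' fun i _ => ENNReal.rpow_le_rpow
            (hz _ (List.getElem_mem _)) (by positivity)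
      _ = _ := by
          rw [Finset.prod_const, Finset.card_univ, Fintype.card_fin, hlen,
            ENNReal.rpow_inv_natCast_pow hk]

variable {S : Type*} [Fintype S]

/-- The expectation of `∏ i < k, q (y i)` along the chain `y` with transition weights `r` that
starts at the given state. -/
noncomputable def jumpWeight (q : S → ENNReal) (r : S → S → ENNReal) : ℕ → S → ENNReal
  | 0, _ => 1
  | k + 1, s => q s * ∑ s', r s s' * jumpWeight q r k s'

theorem measurable_jumpWeight {Ω : Type*} [MeasurableSpace Ω] {q : S → Ω → ENNReal}
    {r : S → S → Ω → ENNReal} (hq : ∀ s, Measurable (q s)) (hr : ∀ s s', Measurable (r s s'))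
    (k : ℕ) (s : S) :
    Measurable fun ω => jumpWeight (fun s => q s ω) (fun s s' => r s s' ω) k s := by
  induction k generalizing s with
  | zero => exact measurable_const
  | succ k ih =>
    exact (hq s).mul (Finset.measurable_sum _ fun s' _ => (hr s s').mul (ih s'))

/-- The transition weights `r` are deterministic here, so the chain can be expanded over its paths
two steps at a time. Each pair of consecutive states moves to the list `l`, and after `k` pairs the
bound for lists applies. -/
theorem lintegral_prod_mul_jumpWeight_le {Ω : Type*} [MeasurableSpace Ω] {μ : Measure Ω}
    {q : S → Ω → ENNReal} (hq : ∀ s, Measurable (q s)) (hind : iIndepFun q μ) {k : ℕ}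
    {B : ENNReal} (hB : ∀ s, ∫⁻ ω, q s ω ^ k ∂μ ≤ B) (hk : k ≠ 0) {r : S → S → ENNReal}
    (hr0 : ∀ s, r s s = 0) (hr1 : ∀ s, ∑ s', r s s' ≤ 1) (j : ℕ) (l : List (S × S))
    (hl : ∀ p ∈ l, p.1 ≠ p.2) (hlen : l.length + j = k) (s : S) :
    ∫⁻ ω, (l.map fun p => q p.1 ω * q p.2 ω).prod
      * jumpWeight (fun s => q s ω) r (2 * j) s ∂μ ≤ B ^ 2 := by
  induction j generalizing l s with
  | zero =>
    simpa [jumpWeight] using lintegral_prod_pairs_le hq hind hB hk l hl (by simpa using hlen)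
  | succ j ih =>
    have hexp : ∀ ω, (l.map fun p => q p.1 ω * q p.2 ω).prod
        * jumpWeight (fun s => q s ω) r (2 * (j + 1)) s
        = ∑ s', r s s' * ∑ s'', r s' s'' *
          ((((s, s') :: l).map fun p => q p.1 ω * q p.2 ω).prod
            * jumpWeight (fun s => q s ω) r (2 * j) s'') := by
      intro ω
      rw [show 2 * (j + 1) = 2 * j + 1 + 1 by ring]
      simp only [jumpWeight, List.map_cons, List.prod_cons, Finset.mul_sum]
      refine Finset.sum_congr rfl fun s' _ => Finset.sum_congr rfl fun s'' _ => ?_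
      ring
    simp_rw [hexp]
    have hm : ∀ s' s'', Measurable fun ω =>
        (((s, s') :: l).map fun p => q p.1 ω * q p.2 ω).prod
            * jumpWeight (fun s => q s ω) r (2 * j) s'' := by
      intro s' s''
      refine Measurable.mul ?_ (measurable_jumpWeight hq (fun _ _ => measurable_const) _ _)
      have : (fun ω => (((s, s') :: l).map fun p => q p.1 ω * q p.2 ω).prod)
          = fun ω => ∏ i : Fin ((s, s') :: l).length,
            (q ((s, s') :: l)[i].1 ω * q ((s, s') :: l)[i].2 ω) := by
        ext ω
        exact (Fin.prod_univ_fun_getElem ((s, s') :: l) fun p => q p.1 ω * q p.2 ω).symm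
      rw [this]
      exact Finset.measurable_prod _ fun i _ => (hq _).mul (hq _)
    rw [lintegral_finsetSum _ fun s' _ => (Finset.measurable_sum _ fun s'' _ =>
      (hm s' s'').const_mul _).const_mul _]
    calc _ ≤ ∑ s', r s s' * B ^ 2 := by
          refine Finset.sum_le_sum fun s' _ => ?_
          rw [lintegral_const_mul _ (Finset.measurable_sum _ fun s'' _ =>
            (hm s' s'').const_mul _)]
          -- Pairs on the diagonal have weight zero, so only pairs of distinct states enter the
          -- list.
          by_cases hss : s = s'
          · rw [← hss, hr0]; simp
          gcongr
          rw [lintegral_finsetSum _ fun s'' _ => (hm s' s'').const_mul _]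
          calc _ ≤ ∑ s'', r s' s'' * B ^ 2 := by
                refine Finset.sum_le_sum fun s'' _ => ?_
                rw [lintegral_const_mul _ (hm s' s'')]
                gcongr
                refine ih _ ?_ (by simp; omega) s''
                intro p hp
                rcases List.mem_cons.1 hp with rfl | hp
                · exact hss
                · exact hl p hp
            _ ≤ 1 * B ^ 2 := by rw [← Finset.sum_mul]; gcongr; exact hr1 s'
            _ = _ := one_mul _
      _ ≤ 1 * B ^ 2 := by rw [← Finset.sum_mul]; gcongr; exact hr1 s
      _ = _ := one_mul _

/-- The Laplace transform at rate `κ` of the holding time of a state that is left with probability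
`x` in each round. -/
noncomputable def holdingWeight (κ x : ℝ) : ENNReal := ENNReal.ofReal (max x 0 / (max x 0 + κ))

theorem measurable_holdingWeight (κ : ℝ) : Measurable (holdingWeight κ) := by
  unfold holdingWeight; fun_prop

/-- Bernoulli's inequality `(1 + κ / x) ^ k ≥ k * κ / x`. The bound is linear in `x`, so only the
mean of the leaving probability is needed. -/
theorem holdingWeight_pow_le {κ x : ℝ} (hκ : 0 < κ) {k : ℕ} (hk : k ≠ 0) :
    holdingWeight κ x ^ k ≤ ENNReal.ofReal x * ENNReal.ofReal (1 / (k * κ)) := by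
  have hk' : (0 : ℝ) < k := by positivity
  unfold holdingWeight
  rcases le_or_gt x 0 with hx | hx
  · rw [max_eq_right hx]; simp [hk]
  · rw [max_eq_left hx.le, ← ENNReal.ofReal_pow (by positivity), ← ENNReal.ofReal_mul hx.le]
    refine ENNReal.ofReal_le_ofReal ?_
    have hb : 1 + k * (κ / x) ≤ (1 + κ / x) ^ k :=
      one_add_mul_le_pow (by have : 0 < κ / x := by positivity
                             linarith) k
    have h1 : x / (x + κ) = (1 + κ / x)⁻¹ := by field_simp
    rw [h1, inv_pow]
    calc ((1 + κ / x) ^ k)⁻¹ ≤ (k * (κ / x))⁻¹ := by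
          refine inv_anti₀ (by positivity) (le_trans ?_ hb)
          linarith
      _ = _ := by field_simp

variable [DecidableEq S]

/-- `jumpWeight` for the jump chain of a transition matrix. -/
noncomputable def matrixJumpWeight (κ : ℝ) (m : S → S → ℝ) : ℕ → S → ENNReal :=
  jumpWeight (fun s => holdingWeight κ (1 - m s s))
    fun s s' => ENNReal.ofReal (jumpDirection s (m s) s')

theorem measurable_matrixJumpWeight (κ : ℝ) (k : ℕ) (s : S) :
    Measurable fun m : S → S → ℝ => matrixJumpWeight κ m k s := by
  refine measurable_jumpWeight (q := fun s (m : S → S → ℝ) => holdingWeight κ (1 - m s s))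
    (r := fun s s' (m : S → S → ℝ) => ENNReal.ofReal (jumpDirection s (m s) s'))
    (fun s => (measurable_holdingWeight κ).comp (by fun_prop)) (fun s s' => ?_) k s
  exact ((measurable_pi_apply s').comp ((measurable_jumpDirection s).comp
    (measurable_pi_apply s))).ennreal_ofReal

/-- Under the prior the leaving probabilities and the jump directions form a product, over the rows
as well as within each row. Fixing the directions leaves independent leaving probabilities, to which
the pairing bound applies. -/
theorem lintegral_matrixJumpWeight_le {α : S → S → ℝ} (hα : ∀ s s', 0 < α s s') {κ p : ℝ}
    (hκ : 0 < κ) (hp : ∀ s, 1 - α s s / ∑ s', α s s' ≤ p) {k : ℕ} (hk : k ≠ 0) (s : S) :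
    ∫⁻ m, matrixJumpWeight κ m (2 * k) s ∂Measure.pi (fun s => dirichletMeasure (α s))
      ≤ ENNReal.ofReal (p / (k * κ)) ^ 2 := by
  have hne : Nonempty S := ⟨s⟩
  have := fun s => isProbabilityMeasure_dirichletMeasure (hα s)
  have hmx : ∀ s : S, Measurable fun φ : S → ℝ => 1 - φ s := fun s => by fun_prop
  have hmr := fun s : S => measurable_jumpDirection s
  let νx : S → Measure ℝ := fun s => (dirichletMeasure (α s)).map fun φ => 1 - φ s
  let νr : S → Measure (S → ℝ) := fun s => (dirichletMeasure (α s)).map (jumpDirection s)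
  have hνx : ∀ s, IsProbabilityMeasure (νx s) := fun s =>
    Measure.isProbabilityMeasure_map (hmx s).aemeasurable
  have hνr : ∀ s, IsProbabilityMeasure (νr s) := fun s =>
    Measure.isProbabilityMeasure_map (hmr s).aemeasurable
  have hrow : ∀ s, (dirichletMeasure (α s)).map (fun φ => (1 - φ s, jumpDirection s φ))
      = (νx s).prod (νr s) := fun s =>
    (indepFun_iff_map_prod_eq_prod_map_map (hmx s).aemeasurable (hmr s).aemeasurable).1
      (indepFun_jumpDirection (hα s) s).symm
  have hpi : (Measure.pi fun s => dirichletMeasure (α s)).map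
      (fun m s => (1 - m s s, jumpDirection s (m s)))
      = Measure.pi fun s => (νx s).prod (νr s) := by
    have : ∀ s, IsProbabilityMeasure
        ((dirichletMeasure (α s)).map (fun φ => (1 - φ s, jumpDirection s φ))) := fun s => by
      rw [hrow]; infer_instance
    rw [Measure.pi_map_pi fun s => ((hmx s).prodMk (hmr s)).aemeasurable]
    congr 1; ext1 s; exact hrow s
  have hT : MeasurePreserving
      (fun m : S → S → ℝ => ((fun s => 1 - m s s), fun s => jumpDirection s (m s)))
      (Measure.pi fun s => dirichletMeasure (α s)) ((Measure.pi νx).prod (Measure.pi νr)) := by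
    have h1 : MeasurePreserving (fun (m : S → S → ℝ) s => (1 - m s s, jumpDirection s (m s)))
        (Measure.pi fun s => dirichletMeasure (α s)) (Measure.pi fun s => (νx s).prod (νr s)) :=
      ⟨measurable_pi_lambda _ fun s => ((hmx s).prodMk (hmr s)).comp (measurable_pi_apply s), hpi⟩
    exact (measurePreserving_arrowProdEquivProdArrow ℝ (S → ℝ) S νx νr).comp h1
  have hgood : ∀ᵐ r ∂Measure.pi νr, ∀ s, r s s = 0 ∧ (∀ s', 0 ≤ r s s') ∧ ∑ s', r s s' ≤ 1 := by
    refine Filter.eventually_all.2 fun s => ?_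
    refine (Measure.quasiMeasurePreserving_eval νr s).ae
      (p := fun r => r s = 0 ∧ (∀ s', 0 ≤ r s') ∧ ∑ s', r s' ≤ 1) ?_
    rw [ae_map_iff (hmr s).aemeasurable (by measurability)]
    filter_upwards [ae_mem_simplex_dirichletMeasure (hα s)] with φ hφ
    have hx : 0 ≤ 1 - φ s := by
      rw [← hφ.2, ← Finset.add_sum_erase _ _ (Finset.mem_univ s), add_sub_cancel_left]
      exact Finset.sum_nonneg fun i _ => hφ.1 i
    refine ⟨by simp [jumpDirection], fun s' => ?_, ?_⟩
    · unfold jumpDirection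
      split_ifs
      · exact le_rfl
      · exact div_nonneg (hφ.1 s') hx
    · have h1 : ∑ s', jumpDirection s φ s' = (1 - φ s) / (1 - φ s) := by
        rw [← Finset.add_sum_erase _ _ (Finset.mem_univ s)]
        have h2 : ∀ s' ∈ Finset.univ.erase s, jumpDirection s φ s' = φ s' / (1 - φ s) :=
          fun s' hs' => if_neg (Finset.ne_of_mem_erase hs')
        rw [Finset.sum_congr rfl h2, ← Finset.sum_div]
        simp only [jumpDirection, if_true, zero_add]
        congr 1
        rw [← hφ.2, ← Finset.add_sum_erase _ _ (Finset.mem_univ s), add_sub_cancel_left]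
      -- If `φ s = 1` the direction is identically zero, by the convention for division by zero;
      -- hence a sum at most `1` rather than equal to `1`.
      rw [h1]
      exact div_self_le_one _
  let G : (S → ℝ) × (S → S → ℝ) → ENNReal := fun z =>
    jumpWeight (fun s => holdingWeight κ (z.1 s)) (fun s s' => ENNReal.ofReal (z.2 s s')) (2 * k) s
  have hG : Measurable G :=
    measurable_jumpWeight (q := fun s (z : (S → ℝ) × (S → S → ℝ)) => holdingWeight κ (z.1 s))
      (r := fun s s' (z : (S → ℝ) × (S → S → ℝ)) => ENNReal.ofReal (z.2 s s'))
      (fun s => (measurable_holdingWeight κ).comp (by fun_prop)) (fun s s' => by fun_prop) _ _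
  have hq : ∀ s : S, Measurable fun x : S → ℝ => holdingWeight κ (x s) := fun s =>
    (measurable_holdingWeight κ).comp (measurable_pi_apply s)
  calc _ = ∫⁻ z, G z ∂(Measure.pi νx).prod (Measure.pi νr) := hT.lintegral_comp hG
    _ = ∫⁻ r, ∫⁻ x, G (x, r) ∂Measure.pi νx ∂Measure.pi νr :=
        lintegral_prod_symm _ hG.aemeasurable
    _ ≤ ∫⁻ _, ENNReal.ofReal (p / (k * κ)) ^ 2 ∂Measure.pi νr := by
        refine lintegral_mono_ae ?_
        filter_upwards [hgood] with r hr
        have := lintegral_prod_mul_jumpWeight_le (μ := Measure.pi νx)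
          (q := fun s (x : S → ℝ) => holdingWeight κ (x s)) hq
          (iIndepFun_pi fun s => (measurable_holdingWeight κ).aemeasurable)
          (k := k) (B := ENNReal.ofReal (p / (k * κ))) (fun s => ?_) hk
          (r := fun s s' => ENNReal.ofReal (r s s')) (fun s => by simp [(hr s).1]) (fun s => ?_)
          k [] (by simp) (by simp) s
        · simpa using this
        · calc _ = ∫⁻ x, holdingWeight κ x ^ k ∂νx s :=
                (measurePreserving_eval νx s).lintegral_comp
                  ((measurable_holdingWeight κ).pow_const k)
            _ ≤ ∫⁻ x, ENNReal.ofReal x * ENNReal.ofReal (1 / (k * κ)) ∂νx s :=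
                lintegral_mono fun x => holdingWeight_pow_le hκ hk
            _ = ENNReal.ofReal (1 - α s s / ∑ s', α s s') * ENNReal.ofReal (1 / (k * κ)) := by
                rw [lintegral_mul_const _ ENNReal.measurable_ofReal,
                  lintegral_map ENNReal.measurable_ofReal (hmx s),
                  lintegral_ofReal_one_sub_dirichletMeasure (hα s)]
            _ ≤ ENNReal.ofReal p * ENNReal.ofReal (1 / (k * κ)) := by
                gcongr; exact hp s
            _ = _ := by rw [← ENNReal.ofReal_mul' (by positivity), mul_one_div]
        · rw [← ENNReal.ofReal_sum_of_nonneg fun s' _ => (hr s).2.1 s']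
          exact ENNReal.ofReal_le_one.2 (hr s).2.2
    _ = _ := by simp

theorem holdingWeight_mul {κ x : ℝ} (hκ : 0 < κ) (hx : 0 ≤ x) :
    ENNReal.ofReal (x + κ) * holdingWeight κ x = ENNReal.ofReal x := by
  unfold holdingWeight
  rw [max_eq_left hx, ← ENNReal.ofReal_mul (by positivity)]
  congr 1
  field_simp

/-- With `x` the probability of leaving `s`, staying contributes `(1 - x)` times the weight, and
leaving contributes `(x + κ)` times the weight because `holdingWeight κ x = x / (x + κ)`. So the
weight of the changes still missing is harmonic up to the factor `1 + κ` per round. -/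
theorem matrixJumpWeight_succ {κ : ℝ} (hκ : 0 < κ) {m : S → S → ℝ} (h0 : ∀ s s', 0 ≤ m s s')
    (h1 : ∀ s, ∑ s', m s s' = 1) (k : ℕ) (s : S) :
    ∑ s', ENNReal.ofReal (m s s') * matrixJumpWeight κ m (k + 1 - if s' = s then 0 else 1) s'
      = ENNReal.ofReal (1 + κ) * matrixJumpWeight κ m (k + 1) s := by
  have hx : 1 - m s s = ∑ s' ∈ Finset.univ.erase s, m s s' := by
    rw [← h1 s, ← Finset.add_sum_erase _ _ (Finset.mem_univ s), add_sub_cancel_left]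
  have hx0 : 0 ≤ 1 - m s s := hx ▸ Finset.sum_nonneg fun i _ => h0 s i
  have hjump : ENNReal.ofReal (1 - m s s + κ) * matrixJumpWeight κ m (k + 1) s
      = ∑ s' ∈ Finset.univ.erase s, ENNReal.ofReal (m s s') * matrixJumpWeight κ m k s' := by
    change _ * (holdingWeight κ (1 - m s s) * ∑ s', ENNReal.ofReal (jumpDirection s (m s) s')
      * matrixJumpWeight κ m k s') = _
    rw [← mul_assoc, holdingWeight_mul hκ hx0, ← Finset.add_sum_erase _ _ (Finset.mem_univ s)]
    simp only [jumpDirection, if_true, ENNReal.ofReal_zero, zero_mul, zero_add]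
    rw [Finset.mul_sum]
    refine Finset.sum_congr rfl fun s' hs' => ?_
    rw [if_neg (Finset.ne_of_mem_erase hs'), ← mul_assoc, ← ENNReal.ofReal_mul hx0]
    congr 2
    -- If the state is never left, all off-diagonal entries vanish and the zero in the denominator
    -- is harmless.
    rcases hx0.eq_or_lt with h | h
    · rw [← h, zero_mul]
      have := Finset.single_le_sum (fun i _ => h0 s i) hs'
      rw [← hx, ← h] at this
      exact le_antisymm (h0 s s') this
    · field_simp
  rw [← Finset.add_sum_erase _ _ (Finset.mem_univ s), if_pos rfl,
    Finset.sum_congr rfl (g := fun s' => ENNReal.ofReal (m s s') * matrixJumpWeight κ m k s')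
      fun s' hs' => by rw [if_neg (Finset.ne_of_mem_erase hs'), Nat.add_sub_cancel],
    ← hjump, Nat.sub_zero, ← add_mul, ← ENNReal.ofReal_add (h0 s s) (by positivity)]
  congr 2
  ring

end JumpWeight

theorem ProbabilityTheory.HasCondDistrib.lintegral_eq {Ω A B : Type*} [MeasurableSpace Ω]
    [MeasurableSpace A] [MeasurableSpace B] {P : Measure Ω} [IsProbabilityMeasure P]
    {Y : Ω → B} {Z : Ω → A} {κ : Kernel A B} [IsSFiniteKernel κ]
    (h : HasCondDistrib Y Z κ P) {F : A × B → ENNReal} (hF : Measurable F) :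
    ∫⁻ ω, F (Z ω, Y ω) ∂P = ∫⁻ ω, ∫⁻ y, F (Z ω, y) ∂κ (Z ω) ∂P := by
  have h1 : ∫⁻ ω, F (Z ω, Y ω) ∂P = ∫⁻ z, F z ∂((P.map Z) ⊗ₘ κ) :=
    HasLaw.lintegral_comp h hF.aemeasurable
  rw [h1, Measure.lintegral_compProd hF,
    lintegral_map' (Measurable.lintegral_kernel_prod_right' hF).aemeasurable h.aemeasurable_fst]

/-! ### The expected number of changes of the latent state. -/

section Jumps

section

variable {S : Type*}

theorem measurable_transitionMatrix_entries [Fintype S] :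
    Measurable fun (φ : TransitionMatrix S) s s' => (φ s : S → ℝ) s' :=
  measurable_pi_lambda _ fun s => measurable_subtype_coe.comp (measurable_pi_apply s)

/-- The number of changes in the sequence of states `y`. -/
noncomputable def changeCount {t : ℕ} (y : Fin (t + 1) → S) : ℕ :=
  open Classical in ∑ i : Fin t, if y i.succ = y i.castSucc then 0 else 1

theorem changeCount_succ {t : ℕ} (y : Fin (t + 2) → S) : open Classical in
    changeCount y = changeCount (fun i : Fin (t + 1) => y i.castSucc)
      + if y (Fin.last _) = y (Fin.last t).castSucc then 0 else 1 := by
  unfold changeCount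
  rw [Fin.sum_univ_castSucc]
  simp

theorem changeCount_le {t : ℕ} (y : Fin (t + 1) → S) : changeCount y ≤ t := by
  unfold changeCount
  calc _ ≤ ∑ _i : Fin t, 1 := Finset.sum_le_sum fun i _ => by split_ifs <;> omega
    _ = t := by simp

end

variable {S : Type*} [Fintype S] [MeasurableSpace S] [MeasurableSingletonClass S]

theorem lintegral_transitionKernel (z : TransitionMatrix S × S) (f : S → ENNReal) :
    ∫⁻ s', f s' ∂transitionKernel S z = ∑ s', ENNReal.ofReal ((z.1 z.2 : S → ℝ) s') * f s' := by
  change ∫⁻ s', f s' ∂(∑ s' : S, ENNReal.ofReal ((z.1 z.2 : S → ℝ) s') • Measure.dirac s') = _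
  rw [lintegral_finsetSum_measure]
  simp [lintegral_smul_measure]

variable {K : ℕ} {Θ X Ω : Type*} [MeasurableSpace Θ] [MeasurableSpace X] [MeasurableSpace Ω]
  {M : LatentBandit K S Θ X} {P : Measure Ω} [IsProbabilityMeasure P]
  {T : Trajectory K S Θ X Ω}

-- One step of a supermartingale: the weight of the changes missing to reach `k`, discounted by `1 +
-- κ` per round.
open Classical in
theorem Trajectory.FollowsEnvironment.lintegral_jumpWeight_succ_le
    (hT : T.FollowsEnvironment M P) {κ : ℝ} (hκ : 0 < κ) (k t : ℕ) :
    ∫⁻ ω, matrixJumpWeight κ (fun s s' => (T.φ ω s : S → ℝ) s')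
        (k - changeCount fun i : Fin (t + 1 + 1) => T.state i ω) (T.state (t + 1) ω) ∂P
      ≤ ENNReal.ofReal (1 + κ) *
        ∫⁻ ω, matrixJumpWeight κ (fun s s' => (T.φ ω s : S → ℝ) s')
          (k - changeCount fun i : Fin (t + 1) => T.state i ω) (T.state t ω) ∂P := by
  let G : (S → S → ℝ) × (ℕ × S) → ENNReal := fun z => matrixJumpWeight κ z.1 z.2.1 z.2.2
  have hG : Measurable G := measurable_from_prod_countable_left fun z =>
    measurable_matrixJumpWeight κ z.1 z.2
  let c : (Fin (t + 1) → S) × S → ℕ := fun z =>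
    k - (changeCount z.1 + if z.2 = z.1 (Fin.last t) then 0 else 1)
  have hc : Measurable c := measurable_of_finite c
  let F : (Past K S Θ X t × X × (S × Θ) × Fin K × ℝ) × S → ENNReal := fun z =>
    G ((fun s s' => (z.1.1.1.2 s : S → ℝ) s'), (c (z.1.1.2.1, z.2), z.2))
  have hF : Measurable F :=
    hG.comp ((measurable_transitionMatrix_entries.comp (by fun_prop :
      Measurable fun z : (Past K S Θ X t × X × (S × Θ) × Fin K × ℝ) × S => z.1.1.1.2)).prodMk
      ((hc.comp (by fun_prop : Measurable fun z :
        (Past K S Θ X t × X × (S × Θ) × Fin K × ℝ) × S => (z.1.1.2.1, z.2))).prodMk measurable_snd))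
  have h1 := (hT.state t).lintegral_eq hF
  have h2 : ∀ ω, F ((T.past t ω, T.context t ω, T.belief t ω, T.action t ω, T.reward t ω),
      T.state (t + 1) ω) = matrixJumpWeight κ (fun s s' => (T.φ ω s : S → ℝ) s')
        (k - changeCount fun i : Fin (t + 1 + 1) => T.state i ω) (T.state (t + 1) ω) := by
    intro ω
    rw [changeCount_succ]
    rfl
  simp_rw [h2] at h1
  rw [h1, ← lintegral_const_mul' _ _ ENNReal.ofReal_ne_top]
  refine lintegral_mono fun ω => ?_
  rw [Kernel.comap_apply, lintegral_transitionKernel]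
  change ∑ s', ENNReal.ofReal ((T.φ ω (T.state t ω) : S → ℝ) s') *
    matrixJumpWeight κ (fun s s' => (T.φ ω s : S → ℝ) s')
      (k - ((changeCount fun i : Fin (t + 1) => T.state i ω)
        + if s' = T.state t ω then 0 else 1)) s' ≤ _
  set N := changeCount fun i : Fin (t + 1) => T.state i ω
  have h0 : ∀ s s', 0 ≤ (T.φ ω s : S → ℝ) s' := fun s => (T.φ ω s).2.1
  have hs : ∀ s, ∑ s', (T.φ ω s : S → ℝ) s' = 1 := fun s => (T.φ ω s).2.2
  -- Once `k` changes have occurred the weight stays `1`, and the factor `1 + κ` is pure slack. The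
  -- truncated subtraction keeps the counter at zero.
  rcases Nat.eq_zero_or_pos (k - N) with hk | hk
  · have h3 : ∀ s', k - (N + if s' = T.state t ω then 0 else 1) = 0 := fun s' => by omega
    simp_rw [h3, hk]
    have h4 : ∀ s, matrixJumpWeight κ (fun s s' => (T.φ ω s : S → ℝ) s') 0 s = 1 := fun _ => rfl
    simp_rw [h4, mul_one]
    rw [← ENNReal.ofReal_sum_of_nonneg fun s' _ => h0 _ s', hs]
    exact ENNReal.ofReal_le_ofReal (by linarith)
  · obtain ⟨j, hj⟩ : ∃ j, k - N = j + 1 := ⟨k - N - 1, by omega⟩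
    have h3 : ∀ s', k - (N + if s' = T.state t ω then 0 else 1)
        = j + 1 - if s' = T.state t ω then 0 else 1 := fun s' => by omega
    simp_rw [h3, hj]
    exact (matrixJumpWeight_succ hκ h0 hs j (T.state t ω)).le

/-- On the event, the weight of the missing changes is `1`. Its expectation grows at most by `(1 +
κ) ^ n` from the initial one, which the Dirichlet bound controls. -/
theorem Trajectory.FollowsEnvironment.measure_le_changeCount_le
    (hT : T.FollowsEnvironment M P) {α : S → S → ℝ} (hα : ∀ s s', 0 < α s s')
    (hM : M.HasDirichletPrior α) {p : ℝ} (hp : ∀ s, 1 - α s s / ∑ s', α s s' ≤ p)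
    {n k : ℕ} (hn : n ≠ 0) (hk : k ≠ 0) :
    P {ω | 2 * k ≤ changeCount fun i : Fin (n + 1) => T.state i ω}
      ≤ 3 * ENNReal.ofReal (p * n / k) ^ 2 := by
  classical
  have hn' : (0 : ℝ) < n := by positivity
  -- This rate keeps `(1 + κ) ^ n ≤ e ≤ 3` and turns `p / (k * κ)` into `p * n / k`.
  set κ : ℝ := (n : ℝ)⁻¹ with hκdef
  have hκ : 0 < κ := by positivity
  have hstep : ∀ t : ℕ, ∫⁻ ω, matrixJumpWeight κ (fun s s' => (T.φ ω s : S → ℝ) s')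
        (2 * k - changeCount fun i : Fin (t + 1) => T.state i ω) (T.state t ω) ∂P
      ≤ ENNReal.ofReal (1 + κ) ^ t * ∫⁻ ω, matrixJumpWeight κ (fun s s' => (T.φ ω s : S → ℝ) s')
        (2 * k) (T.state 0 ω) ∂P := by
    intro t
    induction t with
    | zero => simp [changeCount]
    | succ t ih =>
      refine (hT.lintegral_jumpWeight_succ_le hκ (2 * k) t).trans ?_
      rw [pow_succ', mul_assoc]
      gcongr
  have h0 : ∫⁻ ω, matrixJumpWeight κ (fun s s' => (T.φ ω s : S → ℝ) s')
        (2 * k) (T.state 0 ω) ∂P ≤ ENNReal.ofReal (p * n / k) ^ 2 := by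
    let G : (S → S → ℝ) × S → ENNReal := fun z => matrixJumpWeight κ z.1 (2 * k) z.2
    have hG : Measurable G := measurable_from_prod_countable_left fun s =>
      measurable_matrixJumpWeight κ (2 * k) s
    have hG' : Measurable fun z : (Θ × TransitionMatrix S) × S =>
        G ((fun s s' => (z.1.2 s : S → ℝ) s'), z.2) :=
      hG.comp ((measurable_transitionMatrix_entries.comp (by fun_prop :
        Measurable fun z : (Θ × TransitionMatrix S) × S => z.1.2)).prodMk measurable_snd)
    have h1 := hT.initial.lintegral_comp hG'.aemeasurable
    have h2 : ∫⁻ z, G ((fun s s' => (z.1.2 s : S → ℝ) s'), z.2) ∂(M.prior.prod M.initial)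
        = ∫⁻ s, ∫⁻ z, G ((fun s s' => (z.2 s : S → ℝ) s'), s) ∂M.prior ∂M.initial :=
      lintegral_prod_symm _ hG'.aemeasurable
    refine (h1.trans h2).le.trans ?_
    calc _ ≤ ∫⁻ _, ENNReal.ofReal (p * n / k) ^ 2 ∂M.initial := by
          refine lintegral_mono fun s => ?_
          have h3 := HasLaw.lintegral_comp hM (measurable_matrixJumpWeight κ (2 * k) s).aemeasurable
          refine h3.le.trans ((lintegral_matrixJumpWeight_le hα hκ hp hk s).trans_eq ?_)
          congr 2
          rw [hκdef]; field_simp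
      _ = _ := by simp
  have hstate : AEMeasurable (fun ω => fun i : Fin (n + 1) => T.state i ω) P :=
    ((hT.state n).aemeasurable_fst.fst.snd.fst)
  have hmeas : NullMeasurableSet {ω | 2 * k ≤ changeCount fun i : Fin (n + 1) => T.state i ω} P :=
    hstate.nullMeasurableSet_preimage
      (s := {y : Fin (n + 1) → S | 2 * k ≤ changeCount y}) (Set.toFinite _).measurableSet
  calc _ = ∫⁻ ω, Set.indicator {ω | 2 * k ≤ changeCount fun i : Fin (n + 1) => T.state i ω} 1 ω ∂P :=
        (lintegral_indicator_one₀ hmeas).symm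
    _ ≤ ∫⁻ ω, matrixJumpWeight κ (fun s s' => (T.φ ω s : S → ℝ) s')
        (2 * k - changeCount fun i : Fin (n + 1) => T.state i ω) (T.state n ω) ∂P := by
        refine lintegral_mono fun ω => ?_
        by_cases hω : 2 * k ≤ changeCount fun i : Fin (n + 1) => T.state i ω
        · rw [Nat.sub_eq_zero_of_le hω]
          exact Set.indicator_le_self' (fun _ _ => zero_le) ω
        · rw [Set.indicator_of_notMem (by exact hω)]
          exact zero_le
    _ ≤ _ := hstep n
    _ ≤ 3 * ENNReal.ofReal (p * n / k) ^ 2 := by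
        gcongr
        rw [← ENNReal.ofReal_pow (by positivity)]
        refine ENNReal.ofReal_le_of_le_toReal ?_
        have h1 : (1 + κ) ^ n ≤ Real.exp 1 := by
          calc (1 + κ) ^ n ≤ Real.exp κ ^ n := by
                gcongr; rw [add_comm]; exact Real.add_one_le_exp κ
            _ = _ := by rw [← Real.exp_nat_mul, hκdef, mul_inv_cancel₀ hn'.ne']
        exact h1.trans (Real.exp_one_lt_d9.le.trans (by norm_num))

/-- The quadratic tail is summable: the probabilities are bounded by `1` up to about `1 + p * n` and
by the tail beyond. -/
theorem Trajectory.FollowsEnvironment.integral_changeCount_le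
    (hT : T.FollowsEnvironment M P) {α : S → S → ℝ} (hα : ∀ s s', 0 < α s s')
    (hM : M.HasDirichletPrior α) {p : ℝ} (hp0 : 0 ≤ p) (hp : ∀ s, 1 - α s s / ∑ s', α s s' ≤ p)
    {n : ℕ} (hn : n ≠ 0) :
    ∫ ω, ((changeCount fun i : Fin (n + 1) => T.state i ω : ℕ) : ℝ) ∂P ≤ 26 * (1 + p * n) := by
  set N : Ω → ℕ := fun ω => changeCount fun i : Fin (n + 1) => T.state i ω
  have hstate : AEMeasurable (fun ω => fun i : Fin (n + 1) => T.state i ω) P :=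
    ((hT.state n).aemeasurable_fst.fst.snd.fst)
  have hmeas : ∀ j, NullMeasurableSet {ω | j < N ω} P := fun j =>
    hstate.nullMeasurableSet_preimage
      (s := {y : Fin (n + 1) → S | j < changeCount y}) (Set.toFinite _).measurableSet
  have hsum : ∀ ω, (N ω : ℝ) = ∑ j ∈ Finset.range n, {ω | j < N ω}.indicator (fun _ => (1 : ℝ)) ω := by
    intro ω
    have h1 : ∀ j, {ω | j < N ω}.indicator (fun _ => (1 : ℝ)) ω = if j < N ω then 1 else 0 := fun j => by
      simp [Set.indicator]
    simp_rw [h1]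
    rw [Finset.sum_boole]
    congr 1
    have : (Finset.range n).filter (fun j => j < N ω) = Finset.range (N ω) := by
      ext j
      have := changeCount_le fun i : Fin (n + 1) => T.state i ω
      simp only [Finset.mem_filter, Finset.mem_range]
      constructor
      · exact fun h => h.2
      · exact fun h => ⟨lt_of_lt_of_le h this, h⟩
    rw [this, Finset.card_range]
  have hint : ∀ j, ∫ ω, {ω | j < N ω}.indicator (fun _ => (1 : ℝ)) ω ∂P = P.real {ω | j < N ω} := by
    intro j
    rw [integral_indicator₀ (hmeas j)]
    simp
  change ∫ ω, (N ω : ℝ) ∂P ≤ _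
  rw [integral_congr_ae (ae_of_all _ hsum), integral_finsetSum _ fun j _ => (integrable_const (1 : ℝ)).indicator₀ (hmeas j)]
  rw [Finset.sum_congr rfl fun j _ => hint j]
  set L : ℝ := 1 + p * n with hL
  have hpn : 0 ≤ p * n := by positivity
  -- The tail bound is used with `k = ⌊(j + 1) / 2⌋ ≥ j / 2`, which turns the factor `3` into `12`.
  have htail : ∀ j : ℕ, 1 ≤ j → P.real {ω | j < N ω} ≤ 12 * (p * n) ^ 2 * ((j : ℝ) ^ 2)⁻¹ := by
    intro j hj
    have hk : (j + 1) / 2 ≠ 0 := by omega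
    have h1 := hT.measure_le_changeCount_le hα hM hp hn hk
    have h2 : P {ω | j < N ω} ≤ 3 * ENNReal.ofReal (p * n / ((j + 1) / 2 : ℕ)) ^ 2 := by
      refine (measure_mono fun ω hω => ?_).trans h1
      change 2 * ((j + 1) / 2) ≤ N ω
      have : j < N ω := hω
      omega
    have hj2 : (j : ℝ) / 2 ≤ ((j + 1) / 2 : ℕ) := by
      have : j ≤ 2 * ((j + 1) / 2) := by omega
      have : (j : ℝ) ≤ 2 * ((j + 1) / 2 : ℕ) := by exact_mod_cast this
      linarith
    have hj0 : (0 : ℝ) < j := by exact_mod_cast hj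
    rw [measureReal_def]
    refine ENNReal.toReal_le_of_le_ofReal (by positivity) (h2.trans ?_)
    rw [← ENNReal.ofReal_pow (by positivity), show (3 : ENNReal) = ENNReal.ofReal 3 by simp,
      ← ENNReal.ofReal_mul (by norm_num)]
    refine ENNReal.ofReal_le_ofReal ?_
    calc 3 * (p * n / ((j + 1) / 2 : ℕ)) ^ 2 ≤ 3 * (p * n / (j / 2)) ^ 2 := by gcongr
      _ = _ := by field_simp; ring
  -- Cutting at `L` gives `2 * L` from the head and `24 * L` from the tail.
  set K0 := ⌊L⌋₊
  have hK1 : L ≤ K0 + 1 := (Nat.lt_floor_add_one L).le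
  have hK2 : (K0 : ℝ) ≤ L := Nat.floor_le (by positivity)
  have hsub : Finset.range n ⊆ Finset.range (K0 + 1) ∪ Finset.Ioo K0 n := by
    intro j hj
    simp only [Finset.mem_union, Finset.mem_range, Finset.mem_Ioo] at hj ⊢
    omega
  calc ∑ j ∈ Finset.range n, P.real {ω | j < N ω}
      ≤ ∑ j ∈ Finset.range (K0 + 1) ∪ Finset.Ioo K0 n, P.real {ω | j < N ω} :=
        Finset.sum_le_sum_of_subset_of_nonneg hsub fun _ _ _ => measureReal_nonneg
    _ ≤ ∑ j ∈ Finset.range (K0 + 1), P.real {ω | j < N ω}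
        + ∑ j ∈ Finset.Ioo K0 n, P.real {ω | j < N ω} := by
        rw [← Finset.sum_union_inter]
        exact le_add_of_nonneg_right (Finset.sum_nonneg fun _ _ => measureReal_nonneg)
    _ ≤ ∑ j ∈ Finset.range (K0 + 1), 1
        + ∑ j ∈ Finset.Ioo K0 n, 12 * (p * n) ^ 2 * ((j : ℝ) ^ 2)⁻¹ := by
        gcongr with j _ j hj
        · exact measureReal_le_one
        · exact htail j (by have := (Finset.mem_Ioo.1 hj).1; omega)
    _ ≤ (K0 + 1) + 12 * (p * n) ^ 2 * (2 / (K0 + 1)) := by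
        rw [← Finset.mul_sum]
        refine add_le_add (by simp) ?_
        gcongr
        exact sum_Ioo_inv_sq_le K0 n
    _ ≤ (L + L) + 12 * L ^ 2 * (2 / L) := by
        have : 0 < L := by positivity
        gcongr
        · linarith
        · linarith
    _ = 26 * L := by
        have : L ≠ 0 := by positivity
        field_simp; ring

end Jumps

/-! ### Second moments and exponential moments of the scores. -/

section SubGaussian

theorem sq_div_four_le_exp_sub {z : ℝ} (hz : -1 ≤ z) : z ^ 2 / 4 ≤ Real.exp z - 1 - z := by
  rcases le_or_gt 0 z with h | h
  · have := Real.quadratic_le_exp_of_nonneg h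
    nlinarith [sq_nonneg z]
  · have h1 := Real.exp_bound (x := z) (by rw [abs_le]; constructor <;> linarith) (n := 3)
      (by norm_num)
    norm_num [Finset.sum_range_succ, Nat.factorial] at h1
    have h2 : |z| ^ 3 ≤ z ^ 2 := by
      rw [← sq_abs z]
      have : |z| ≤ 1 := by rw [abs_le]; constructor <;> linarith
      nlinarith [abs_nonneg z, sq_nonneg |z|]
    have := (abs_le.1 h1).1
    nlinarith

/-- The exponential moments are one-sided, so the lower tail has to be controlled by the centring:
the linear term of `exp z - 1 - z` integrates to zero. The inequality `z ^ 2 / 4 ≤ exp z - 1 - z`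
holds for `z ≥ -1`, and with `z = l * (r - m)` and `l → 0` this range exhausts the line. -/
theorem integrable_sq_of_upper_subgaussian {ν : Measure ℝ} [IsProbabilityMeasure ν] {σ m : ℝ}
    (hint : Integrable (fun r : ℝ => r) ν) (hm : ∫ r, r ∂ν = m)
    (hexp : ∀ l : ℝ, 0 < l → Integrable (fun r : ℝ => Real.exp (l * (r - m))) ν ∧
      ∫ r, Real.exp (l * (r - m)) ∂ν ≤ Real.exp (σ ^ 2 * l ^ 2 / 2)) :
    Integrable (fun r => (r - m) ^ 2) ν ∧ ∫ r, (r - m) ^ 2 ∂ν ≤ 4 * σ ^ 2 := by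
  have hmain : ∫⁻ r, ENNReal.ofReal ((r - m) ^ 2) ∂ν ≤ ENNReal.ofReal (4 * σ ^ 2) := by
    -- Truncation to `l * (r - m) ≥ -1` for `l = 1 / (k + 1)`; Fatou's lemma removes it.
    let f : ℕ → ℝ → ENNReal := fun k =>
      (Set.Ici (m - (k + 1))).indicator fun r => ENNReal.ofReal ((r - m) ^ 2)
    have hf : ∀ k, Measurable (f k) := fun k =>
      (by fun_prop : Measurable fun r : ℝ => ENNReal.ofReal ((r - m) ^ 2)).indicator
        measurableSet_Ici
    have hlim : ∀ r, Filter.liminf (fun k => f k r) Filter.atTop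
        = ENNReal.ofReal ((r - m) ^ 2) := by
      intro r
      refine Filter.Tendsto.liminf_eq (tendsto_const_nhds.congr' ?_)
      obtain ⟨k0, hk0⟩ := exists_nat_ge (m - r)
      filter_upwards [Filter.eventually_ge_atTop k0] with k hk
      have : (k0 : ℝ) ≤ k := by exact_mod_cast hk
      have hr : r ∈ Set.Ici (m - ((k : ℝ) + 1)) := by
        rw [Set.mem_Ici]; linarith
      exact (Set.indicator_of_mem hr fun r => ENNReal.ofReal ((r - m) ^ 2)).symm
    have hle : ∀ᶠ k in Filter.atTop, ∫⁻ r, f k r ∂ν ≤ ENNReal.ofReal (4 * σ ^ 2) := by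
      obtain ⟨k0, hk0⟩ := exists_nat_ge (σ ^ 2)
      filter_upwards [Filter.eventually_ge_atTop k0] with k hk
      have hk' : σ ^ 2 ≤ k + 1 := by
        have : (k0 : ℝ) ≤ k := by exact_mod_cast hk
        linarith
      set l : ℝ := ((k : ℝ) + 1)⁻¹ with hl
      have hl0 : 0 < l := by positivity
      have hl1 : ((k : ℝ) + 1) * l = 1 := by rw [hl]; field_simp
      obtain ⟨hi, hb⟩ := hexp l hl0
      have hlin : Integrable (fun r : ℝ => l * (r - m)) ν :=
        (hint.sub (integrable_const m)).const_mul l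
      have hi1 : Integrable (fun r : ℝ => Real.exp (l * (r - m)) - 1) ν :=
        hi.sub (integrable_const 1)
      have hpt : ∀ r, f k r
          ≤ ENNReal.ofReal (4 / l ^ 2 * (Real.exp (l * (r - m)) - 1 - l * (r - m))) := by
        intro r
        by_cases hr : r ∈ Set.Ici (m - ((k : ℝ) + 1))
        swap
        · exact (Set.indicator_of_notMem hr _).trans_le zero_le
        refine (Set.indicator_of_mem hr _).trans_le ?_
        refine ENNReal.ofReal_le_ofReal ?_
        have hz : -1 ≤ l * (r - m) := by
          simp only [Set.mem_Ici] at hr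
          nlinarith
        have := sq_div_four_le_exp_sub hz
        rw [div_mul_eq_mul_div, le_div_iff₀ (by positivity)]
        nlinarith
      calc ∫⁻ r, f k r ∂ν
          ≤ ∫⁻ r, ENNReal.ofReal (4 / l ^ 2 * (Real.exp (l * (r - m)) - 1 - l * (r - m))) ∂ν :=
            lintegral_mono hpt
        _ = ENNReal.ofReal (∫ r, 4 / l ^ 2 * (Real.exp (l * (r - m)) - 1 - l * (r - m)) ∂ν) := by
            refine (ofReal_integral_eq_lintegral_ofReal
              ((hi1.sub hlin).const_mul _) (ae_of_all _ fun r => ?_)).symm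
            have := Real.add_one_le_exp (l * (r - m))
            have h2 : 0 ≤ Real.exp (l * (r - m)) - 1 - l * (r - m) := by linarith
            positivity
        _ ≤ _ := by
            refine ENNReal.ofReal_le_ofReal ?_
            rw [integral_const_mul, integral_sub hi1 hlin,
              integral_sub hi (integrable_const 1), integral_const_mul,
              integral_sub hint (integrable_const m), hm]
            simp only [integral_const, probReal_univ, one_smul, sub_self, mul_zero, sub_zero]
            -- For `k + 1 ≥ σ ^ 2` the exponent is at most `1 / 2`, where `exp u ≤ 1 + 2 * u`; this
            -- gives the constant `4`.
            have hu : σ ^ 2 * l ^ 2 / 2 ≤ 1 / 2 := by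
              have h1 : σ ^ 2 * l ≤ 1 := by nlinarith
              have h2 : l ≤ 1 := by rw [hl]; exact inv_le_one_of_one_le₀ (by linarith)
              nlinarith [sq_nonneg σ]
            have he : Real.exp (σ ^ 2 * l ^ 2 / 2) ≤ 1 + 2 * (σ ^ 2 * l ^ 2 / 2) := by
              have h0 : 0 ≤ σ ^ 2 * l ^ 2 / 2 := by positivity
              have h1 := Real.exp_bound_div_one_sub_of_interval h0 (by linarith)
              refine h1.trans ?_
              rw [div_le_iff₀ (by linarith)]
              nlinarith
            rw [div_mul_eq_mul_div, div_le_iff₀ (by positivity)]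
            nlinarith
    calc ∫⁻ r, ENNReal.ofReal ((r - m) ^ 2) ∂ν
        = ∫⁻ r, Filter.liminf (fun k => f k r) Filter.atTop ∂ν := by simp_rw [hlim]
      _ ≤ Filter.liminf (fun k => ∫⁻ r, f k r ∂ν) Filter.atTop := lintegral_liminf_le hf
      _ ≤ _ := by
        refine Filter.liminf_le_of_le (by isBoundedDefault) fun b hb => ?_
        obtain ⟨k, h1, h2⟩ := (hb.and hle).exists
        exact h1.trans h2
  have hmeas : AEStronglyMeasurable (fun r : ℝ => (r - m) ^ 2) ν := by fun_prop
  refine ⟨⟨hmeas, ?_⟩, ?_⟩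
  · rw [hasFiniteIntegral_iff_ofReal (ae_of_all _ fun r => sq_nonneg _)]
    exact hmain.trans_lt ENNReal.ofReal_lt_top
  · rw [integral_eq_lintegral_of_nonneg_ae (ae_of_all _ fun r => sq_nonneg _) hmeas]
    exact ENNReal.toReal_le_of_le_ofReal (by positivity) hmain

/-- Subtracting the square makes the exponential of a variable controllable by two moments. This is
needed since scores involve `c - R`, whose upper tail is the lower tail of the reward and need not
have exponential moments. The proof inverts `1 + y ≤ exp y` at `y = -(z - z ^ 2)`. -/
theorem exp_sub_sq_le (z : ℝ) : Real.exp (z - z ^ 2) ≤ 1 + z + z ^ 2 := by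
  have h1 : 0 < 1 - z + z ^ 2 := by nlinarith [sq_nonneg (z - 1 / 2)]
  have h2 : 1 - z + z ^ 2 ≤ Real.exp (-(z - z ^ 2)) := by
    have := Real.add_one_le_exp (-(z - z ^ 2)); linarith
  rw [Real.exp_neg] at h2
  have h3 := (le_inv_comm₀ h1 (Real.exp_pos _)).1 h2
  refine h3.trans ?_
  rw [inv_le_iff_one_le_mul₀ h1]
  nlinarith [sq_nonneg z, sq_nonneg (z ^ 2)]

/-- The bound for the second moment of `c - R`, for a reward `R` and `c ∈ [0, 1]`. -/
noncomputable def secondMomentBound (σ : ℝ) : ℝ := 4 * σ ^ 2 + 1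

theorem secondMomentBound_pos (σ : ℝ) : 0 < secondMomentBound σ := by
  unfold secondMomentBound; positivity

variable {K : ℕ} {S Θ X : Type*} [Fintype S] [MeasurableSpace S]
  [MeasurableSpace Θ] [MeasurableSpace X] {M : LatentBandit K S Θ X} {σ : ℝ}

theorem LatentBandit.IsSubGaussian.integral_sq_le (hM : M.IsSubGaussian σ)
    {a : Fin K} {x : X} {s : S} {θ : Θ} (hmean : M.mean a x s θ ∈ Set.Icc (0 : ℝ) 1)
    {c : ℝ} (hc : c ∈ Set.Icc (0 : ℝ) 1) :
    Integrable (fun r => (c - r) ^ 2) (M.rewardLaw (a, x, s, θ)) ∧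
      ∫ r, (c - r) ^ 2 ∂M.rewardLaw (a, x, s, θ) ≤ secondMomentBound σ := by
  obtain ⟨hint, hexp⟩ := hM a x s θ
  obtain ⟨h1, h2⟩ := integrable_sq_of_upper_subgaussian (m := M.mean a x s θ) hint rfl hexp
  set m := M.mean a x s θ
  have hm : ∫ r, r ∂M.rewardLaw (a, x, s, θ) = m := rfl
  have heq : (fun r => (c - r) ^ 2) = fun r => (r - m) ^ 2 - 2 * (c - m) * (r - m) + (c - m) ^ 2 := by
    ext r; ring
  have hlin : Integrable (fun r : ℝ => 2 * (c - m) * (r - m)) (M.rewardLaw (a, x, s, θ)) :=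
    (hint.sub (integrable_const m)).const_mul _
  have h3 : Integrable (fun r : ℝ => (r - m) ^ 2 - 2 * (c - m) * (r - m))
      (M.rewardLaw (a, x, s, θ)) := h1.sub hlin
  rw [heq]
  refine ⟨h3.add (integrable_const _), ?_⟩
  rw [integral_add h3 (integrable_const _), integral_sub h1 hlin, integral_const_mul,
    integral_sub hint (integrable_const m), hm]
  simp only [integral_const, probReal_univ, one_smul, sub_self, mul_zero, sub_zero]
  have : (c - m) ^ 2 ≤ 1 := by
    rw [sq_le_one_iff_abs_le_one, abs_le]
    constructor <;> linarith [hc.1, hc.2, hmean.1, hmean.2]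
  unfold secondMomentBound
  linarith

theorem LatentBandit.IsSubGaussian.integrable_gap (hM : M.IsSubGaussian σ)
    (a : Fin K) (x : X) (s : S) (θ : Θ) (l c : ℝ) :
    Integrable (fun r => l * (c - r)) (M.rewardLaw (a, x, s, θ)) ∧
      ∫ r, l * (c - r) ∂M.rewardLaw (a, x, s, θ) = l * (c - M.mean a x s θ) := by
  have hint := (hM a x s θ).1
  refine ⟨((integrable_const c).sub hint).const_mul l, ?_⟩
  rw [integral_const_mul, integral_sub (integrable_const c) hint]
  simp [LatentBandit.mean]

/-- The price of the squared correction: the expected score still retains the gap, up to `l ^ 2 *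
secondMomentBound σ` and the drift. -/
theorem LatentBandit.IsSubGaussian.le_integral_score (hM : M.IsSubGaussian σ)
    {a : Fin K} {x : X} {s : S} {θ : Θ} (hmean : M.mean a x s θ ∈ Set.Icc (0 : ℝ) 1)
    {c : ℝ} (hc : c ∈ Set.Icc (0 : ℝ) 1) (l w : ℝ) :
    Integrable (fun r => l * (c - r) - (l * (c - r)) ^ 2 - w) (M.rewardLaw (a, x, s, θ)) ∧
      l * (c - M.mean a x s θ) - l ^ 2 * secondMomentBound σ - w
        ≤ ∫ r, (l * (c - r) - (l * (c - r)) ^ 2 - w) ∂M.rewardLaw (a, x, s, θ) := by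
  obtain ⟨h1, h2⟩ := hM.integral_sq_le hmean hc
  obtain ⟨h3, h4⟩ := hM.integrable_gap a x s θ l c
  have h5 : Integrable (fun r => (l * (c - r)) ^ 2) (M.rewardLaw (a, x, s, θ)) := by
    simp_rw [mul_pow]; exact h1.const_mul _
  have h6 : Integrable (fun r => l * (c - r) - (l * (c - r)) ^ 2) (M.rewardLaw (a, x, s, θ)) :=
    h3.sub h5
  refine ⟨h6.sub (integrable_const w), ?_⟩
  rw [integral_sub h6 (integrable_const w), integral_sub h3 h5, h4]
  simp_rw [mul_pow]
  rw [integral_const_mul]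
  simp only [integral_const, probReal_univ, one_smul]
  nlinarith [sq_nonneg l]

/-- The drift `w` pays for the bias `ε` and for the second moment, so the two-moment expansion is at
most `1 + W * w ≤ exp (W * w)`. -/
theorem LatentBandit.IsSubGaussian.lintegral_exp_score_le (hM : M.IsSubGaussian σ)
    {a : Fin K} {x : X} {s : S} {θ : Θ} (hmean : M.mean a x s θ ∈ Set.Icc (0 : ℝ) 1)
    {c : ℝ} (hc : c ∈ Set.Icc (0 : ℝ) 1) {l w W ε : ℝ} (hl : 0 ≤ l)
    (hW : W ∈ Set.Icc (0 : ℝ) 1) (hε : c - M.mean a x s θ ≤ ε)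
    (hw : l * ε + l ^ 2 * secondMomentBound σ ≤ w) :
    ∫⁻ r, ENNReal.ofReal (Real.exp (W * (l * (c - r) - (l * (c - r)) ^ 2 - w)))
      ∂M.rewardLaw (a, x, s, θ) ≤ 1 := by
  obtain ⟨h1, h2⟩ := hM.integral_sq_le hmean hc
  obtain ⟨h3, h4⟩ := hM.integrable_gap a x s θ (W * l) c
  have h5 : Integrable (fun r => (W * l) ^ 2 * (c - r) ^ 2) (M.rewardLaw (a, x, s, θ)) :=
    h1.const_mul _
  have h6 : Integrable (fun r => 1 + W * l * (c - r)) (M.rewardLaw (a, x, s, θ)) :=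
    (integrable_const 1).add h3
  have hi : Integrable (fun r => Real.exp (-(W * w)) * (1 + W * l * (c - r)
      + (W * l) ^ 2 * (c - r) ^ 2)) (M.rewardLaw (a, x, s, θ)) :=
    (h6.add h5).const_mul _
  have hpt : ∀ r, Real.exp (W * (l * (c - r) - (l * (c - r)) ^ 2 - w))
      ≤ Real.exp (-(W * w)) * (1 + W * l * (c - r) + (W * l) ^ 2 * (c - r) ^ 2) := by
    intro r
    -- Since `W ^ 2 ≤ W` on `[0, 1]`, a weighted score is at most the score of the weighted
    -- variable.
    have h7 : W * (l * (c - r) - (l * (c - r)) ^ 2 - w)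
        ≤ -(W * w) + (W * l * (c - r) - (W * l * (c - r)) ^ 2) := by
      have : (W * l * (c - r)) ^ 2 ≤ W * (l * (c - r)) ^ 2 := by
        have h7 : W ^ 2 ≤ W := by nlinarith [hW.1, hW.2]
        calc _ = W ^ 2 * (l * (c - r)) ^ 2 := by ring
          _ ≤ _ := by gcongr
      linarith
    calc _ ≤ _ := Real.exp_le_exp.2 h7
      _ = Real.exp (-(W * w)) * Real.exp (W * l * (c - r) - (W * l * (c - r)) ^ 2) :=
          Real.exp_add _ _
      _ ≤ Real.exp (-(W * w)) * (1 + W * l * (c - r) + (W * l * (c - r)) ^ 2) := by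
          gcongr; exact exp_sub_sq_le _
      _ = _ := by ring
  calc _ ≤ ∫⁻ r, ENNReal.ofReal (Real.exp (-(W * w)) * (1 + W * l * (c - r)
        + (W * l) ^ 2 * (c - r) ^ 2)) ∂M.rewardLaw (a, x, s, θ) :=
        lintegral_mono fun r => ENNReal.ofReal_le_ofReal (hpt r)
    _ = ENNReal.ofReal (∫ r, Real.exp (-(W * w)) * (1 + W * l * (c - r)
        + (W * l) ^ 2 * (c - r) ^ 2) ∂M.rewardLaw (a, x, s, θ)) :=
        (ofReal_integral_eq_lintegral_ofReal hi (ae_of_all _ fun r =>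
          (Real.exp_pos _).le.trans (hpt r))).symm
    _ ≤ 1 := by
        rw [ENNReal.ofReal_le_one, integral_const_mul,
          integral_add h6 h5, integral_add (integrable_const 1) h3, h4,
          integral_const_mul]
        simp only [integral_const, probReal_univ, one_smul]
        have h8 : 1 + W * l * (c - M.mean a x s θ)
            + (W * l) ^ 2 * ∫ r, (c - r) ^ 2 ∂M.rewardLaw (a, x, s, θ) ≤ 1 + W * w := by
          have h9 : (W * l) ^ 2 * ∫ r, (c - r) ^ 2 ∂M.rewardLaw (a, x, s, θ)
              ≤ W * (l ^ 2 * secondMomentBound σ) := by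
            have h7 : W ^ 2 ≤ W := by nlinarith [hW.1, hW.2]
            calc _ = W ^ 2 * (l ^ 2 * ∫ r, (c - r) ^ 2 ∂M.rewardLaw (a, x, s, θ)) := by ring
              _ ≤ W * (l ^ 2 * secondMomentBound σ) := by
                  have : 0 ≤ ∫ r, (c - r) ^ 2 ∂M.rewardLaw (a, x, s, θ) :=
                    integral_nonneg fun r => sq_nonneg _
                  have := hW.1
                  gcongr
          have h10 : W * l * (c - M.mean a x s θ) ≤ W * (l * ε) := by
            rw [mul_assoc]
            have := hW.1
            gcongr
          nlinarith [mul_le_mul_of_nonneg_left hw hW.1]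
        have h11 : 1 + W * w ≤ Real.exp (W * w) := by
          rw [add_comm]; exact Real.add_one_le_exp _
        rw [Real.exp_neg, inv_mul_le_iff₀ (Real.exp_pos _), mul_one]
        exact h8.trans h11

end SubGaussian

/-! ### Real-valued integration against conditional laws. -/

section CondDistrib

variable {Ω A B : Type*} [MeasurableSpace Ω] [MeasurableSpace A] [MeasurableSpace B]
  {P : Measure Ω} [IsProbabilityMeasure P] {Y : Ω → B} {Z : Ω → A} {κ : Kernel A B}
  [IsSFiniteKernel κ]

theorem ProbabilityTheory.HasCondDistrib.integrable_of_le (h : HasCondDistrib Y Z κ P)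
    {f : A × B → ℝ} (hf : Measurable f) {C : ENNReal} (hC : C ≠ ⊤)
    (hle : ∀ z, ∫⁻ y, ‖f (z, y)‖ₑ ∂κ z ≤ C) : Integrable (fun ω => f (Z ω, Y ω)) P := by
  refine ⟨(hf.comp_aemeasurable h.aemeasurable).aestronglyMeasurable, ?_⟩
  rw [HasFiniteIntegral, h.lintegral_eq (F := fun z => ‖f z‖ₑ) hf.enorm]
  calc _ ≤ ∫⁻ _, C ∂P := lintegral_mono fun ω => hle _
    _ < ⊤ := by simpa using hC.lt_top

theorem ProbabilityTheory.HasCondDistrib.integral_eq (h : HasCondDistrib Y Z κ P)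
    {f : A × B → ℝ} (hf : Measurable f) (hint : Integrable (fun ω => f (Z ω, Y ω)) P) :
    ∫ ω, f (Z ω, Y ω) ∂P = ∫ ω, ∫ y, f (Z ω, y) ∂κ (Z ω) ∂P := by
  have h1 : ∫ ω, f (Z ω, Y ω) ∂P = ∫ z, f z ∂((P.map Z) ⊗ₘ κ) :=
    HasLaw.integral_comp h hf.aestronglyMeasurable
  have h2 : Integrable f ((P.map Z) ⊗ₘ κ) := by
    rw [← HasLaw.map_eq h]
    exact (integrable_map_measure hf.aestronglyMeasurable h.aemeasurable).2 hint
  rw [h1, Measure.integral_compProd h2, integral_map h.aemeasurable_fst]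
  exact (hf.stronglyMeasurable.integral_kernel_prod_right').aestronglyMeasurable

theorem ProbabilityTheory.HasCondDistrib.integrable_integral (h : HasCondDistrib Y Z κ P)
    {f : A × B → ℝ} (hf : Measurable f) (hint : Integrable (fun ω => f (Z ω, Y ω)) P) :
    Integrable (fun ω => ∫ y, f (Z ω, y) ∂κ (Z ω)) P := by
  have h2 : Integrable f ((P.map Z) ⊗ₘ κ) := by
    rw [← HasLaw.map_eq h]
    exact (integrable_map_measure hf.aestronglyMeasurable h.aemeasurable).2 hint
  exact (integrable_map_measure
    hf.stronglyMeasurable.integral_kernel_prod_right'.aestronglyMeasurable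
    h.aemeasurable_fst).1 (Integrable.integral_compProd
      (κ := Kernel.const Unit (P.map Z)) (η := Kernel.prodMkLeft Unit κ) (a := ()) h2)

end CondDistrib

/-! ### Belief weights and the confidence statistic. -/

section Statistic

variable {K : ℕ} {S Θ X : Type*} [Fintype S] [MeasurableSpace S]
  [MeasurableSpace Θ] [MeasurableSpace X]

namespace LatentBandit

theorem measurable_mean (M : LatentBandit K S Θ X) :
    Measurable fun z : Fin K × X × S × Θ => M.mean z.1 z.2.1 z.2.2.1 z.2.2.2 :=
  (StronglyMeasurable.integral_kernel_prod_right' (κ := M.rewardLaw)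
    (f := fun z : (Fin K × X × S × Θ) × ℝ => z.2) measurable_snd.stronglyMeasurable).measurable

theorem measurable_priorMean (M : LatentBandit K S Θ X) :
    Measurable fun z : Fin K × X × S => M.priorMean z.1 z.2.1 z.2.2 := by
  have h : StronglyMeasurable fun z : (Fin K × X × S) × Θ => M.mean z.1.1 z.1.2.1 z.1.2.2 z.2 :=
    (M.measurable_mean.comp (g := fun z : Fin K × X × S × Θ => M.mean z.1 z.2.1 z.2.2.1 z.2.2.2)
      (f := fun z : (Fin K × X × S) × Θ => (z.1.1, z.1.2.1, z.1.2.2, z.2))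
      (by fun_prop)).stronglyMeasurable
  exact h.integral_prod_right'.measurable

theorem priorMean_mem_Icc {M : LatentBandit K S Θ X}
    (hM : ∀ a x s θ, M.mean a x s θ ∈ Set.Icc (0 : ℝ) 1) (a : Fin K) (x : X) (s : S) :
    M.priorMean a x s ∈ Set.Icc (0 : ℝ) 1 := by
  refine ⟨integral_nonneg fun θ => (hM a x s θ).1, ?_⟩
  have hm : Measurable fun θ => M.mean a x s θ :=
    M.measurable_mean.comp (g := fun z : Fin K × X × S × Θ => M.mean z.1 z.2.1 z.2.2.1 z.2.2.2)
      (f := fun θ => (a, x, s, θ)) (by fun_prop)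
  have hi : Integrable (fun θ => M.mean a x s θ) M.prior.fst :=
    Integrable.of_bound hm.aestronglyMeasurable 1 (ae_of_all _ fun θ => by
      rw [Real.norm_eq_abs, abs_of_nonneg (hM a x s θ).1]; exact (hM a x s θ).2)
  calc M.priorMean a x s ≤ ∫ _, (1 : ℝ) ∂M.prior.fst :=
        integral_mono hi (integrable_const 1) fun θ => (hM a x s θ).2
    _ = 1 := by simp

end LatentBandit

section BeliefWeight

variable {H : Type*} [MeasurableSpace H]

/-- The probability that the belief is the latent state `s` and the best action is `a`. -/
noncomputable def jointProb (best : X × S × Θ → Fin K) (κ : Kernel H (S × Θ)) (h : H) (x : X)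
    (s : S) (a : Fin K) : ℝ :=
  (κ h).real {b | b.1 = s ∧ best (x, b) = a}

/-- The conditional probability that the belief is the latent state `s`, given the action. -/
noncomputable def beliefWeight (best : X × S × Θ → Fin K) (κ : Kernel H (S × Θ)) (h : H) (x : X)
    (s : S) (a : Fin K) : ℝ :=
  jointProb best κ h x s a / ∑ s', jointProb best κ h x s' a

theorem jointProb_le_sum (best : X × S × Θ → Fin K) (κ : Kernel H (S × Θ)) (h : H) (x : X)
    (s : S) (a : Fin K) : jointProb best κ h x s a ≤ ∑ s', jointProb best κ h x s' a :=
  Finset.single_le_sum (f := fun s' => jointProb best κ h x s' a)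
    (fun _ _ => measureReal_nonneg) (Finset.mem_univ s)

theorem beliefWeight_mem_Icc (best : X × S × Θ → Fin K) (κ : Kernel H (S × Θ)) (h : H) (x : X)
    (s : S) (a : Fin K) : beliefWeight best κ h x s a ∈ Set.Icc (0 : ℝ) 1 :=
  ⟨div_nonneg measureReal_nonneg (Finset.sum_nonneg fun _ _ => measureReal_nonneg),
    div_le_one_of_le₀ (jointProb_le_sum best κ h x s a)
      (Finset.sum_nonneg fun _ _ => measureReal_nonneg)⟩

theorem beliefWeight_mul_sum (best : X × S × Θ → Fin K) (κ : Kernel H (S × Θ)) (h : H) (x : X)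
    (s : S) (a : Fin K) :
    beliefWeight best κ h x s a * ∑ s', jointProb best κ h x s' a = jointProb best κ h x s a := by
  -- For an action of probability zero the weight is `0 / 0 = 0`, consistently with the vanishing
  -- joint probability.
  by_cases h0 : ∑ s', jointProb best κ h x s' a = 0
  · rw [h0, mul_zero]
    exact le_antisymm measureReal_nonneg (h0 ▸ jointProb_le_sum best κ h x s a)
  · exact div_mul_cancel₀ _ h0

theorem measurable_beliefWeight [MeasurableSingletonClass S] {best : X × S × Θ → Fin K}
    (hbest : Measurable best) (κ : Kernel H (S × Θ)) [IsSFiniteKernel κ] (s : S) :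
    Measurable fun z : (H × X) × Fin K => beliefWeight best κ z.1.1 z.1.2 s z.2 := by
  refine measurable_from_prod_countable_left fun a => ?_
  have hp : ∀ s, Measurable fun z : H × X => jointProb best κ z.1 z.2 s a := by
    intro s
    have ht : MeasurableSet {z : (H × X) × S × Θ | z.2.1 = s ∧ best (z.1.2, z.2) = a} := by
      have h1 : Measurable fun z : (H × X) × S × Θ => z.2.1 := by fun_prop
      have h2 : Measurable fun z : (H × X) × S × Θ => best (z.1.2, z.2) :=
        hbest.comp (by fun_prop)
      exact (h1 (measurableSet_singleton s)).inter (h2 (measurableSet_singleton a))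
    exact (Kernel.measurable_kernel_prodMk_left (κ := κ.comap Prod.fst measurable_fst)
      ht).ennreal_toReal
  exact (hp s).div (Finset.measurable_sum _ fun s' _ => hp s')

theorem integral_belief [MeasurableSingletonClass S] {best : X × S × Θ → Fin K}
    (hbest : Measurable best) (κ : Kernel H (S × Θ)) [IsMarkovKernel κ] (h : H) (x : X)
    (φ : S → Fin K → ℝ) :
    ∫ b, φ b.1 (best (x, b)) ∂κ h = ∑ a, ∑ s, jointProb best κ h x s a * φ s a := by
  have hg : Measurable fun b : S × Θ => (best (x, b), b.1) :=
    (hbest.comp (by fun_prop)).prodMk measurable_fst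
  have : IsProbabilityMeasure ((κ h).map fun b : S × Θ => (best (x, b), b.1)) :=
    Measure.isProbabilityMeasure_map hg.aemeasurable
  have hφ : Measurable fun z : Fin K × S => φ z.2 z.1 := measurable_of_finite _
  have h1 := integral_map (μ := κ h) hg.aemeasurable (f := fun z : Fin K × S => φ z.2 z.1)
    hφ.aestronglyMeasurable
  rw [← h1, integral_fintype Integrable.of_finite, Fintype.sum_prod_type]
  refine Finset.sum_congr rfl fun a _ => Finset.sum_congr rfl fun s _ => ?_
  rw [smul_eq_mul, map_measureReal_apply hg (measurableSet_singleton _)]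
  congr 2
  ext b
  simp [and_comm]

/-- The tower property: the believed state is averaged over its conditional law given the action. -/
theorem integral_belief_eq [MeasurableSingletonClass S] {best : X × S × Θ → Fin K}
    (hbest : Measurable best) (κ : Kernel H (S × Θ)) [IsMarkovKernel κ] (h : H) (x : X)
    (φ : S → Fin K → ℝ) :
    ∫ b, φ b.1 (best (x, b)) ∂κ h
      = ∫ b, ∑ s, beliefWeight best κ h x s (best (x, b)) * φ s (best (x, b)) ∂κ h := by
  rw [integral_belief hbest κ h x φ, integral_belief hbest κ h x
    fun _ a => ∑ s, beliefWeight best κ h x s a * φ s a]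
  refine Finset.sum_congr rfl fun a _ => ?_
  rw [← Finset.sum_mul, Finset.mul_sum]
  refine Finset.sum_congr rfl fun s _ => ?_
  rw [← mul_assoc, mul_comm (∑ s, _), beliefWeight_mul_sum]

end BeliefWeight

/-- The parameters of the confidence statistic: the scale `l` of the rewards, the drift `w`, the
threshold `level` and the length `period` of the blocks. -/
structure StatParams where
  l : ℝ
  w : ℝ
  level : ℝ
  period : ℕ

/-- The increment of the confidence statistic whose value is `g`. -/
noncomputable def StatParams.incr (q : StatParams) (g W c r : ℝ) : ℝ :=
  if g ≤ q.level then W * (q.l * (c - r) - (q.l * (c - r)) ^ 2 - q.w) else 0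

theorem StatParams.incr_le_one {q : StatParams} (hw : 0 ≤ q.w) {W : ℝ}
    (hW : W ∈ Set.Icc (0 : ℝ) 1) (g c r : ℝ) : q.incr g W c r ≤ 1 := by
  unfold StatParams.incr
  split_ifs
  · have : q.l * (c - r) - (q.l * (c - r)) ^ 2 - q.w ≤ 1 := by
      nlinarith [sq_nonneg (q.l * (c - r) - 1 / 2)]
    nlinarith [hW.1, hW.2]
  · exact zero_le_one

theorem StatParams.measurable_incr (q : StatParams) :
    Measurable fun z : ℝ × ℝ × ℝ × ℝ => q.incr z.1 z.2.1 z.2.2.1 z.2.2.2 := by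
  unfold StatParams.incr
  exact Measurable.ite (measurableSet_le measurable_fst measurable_const) (by fun_prop)
    measurable_const

/-- The confidence statistic: the score of the latent state `s`, as a function of the history. It is
reset every `period` rounds, and frozen once it exceeds `level`. -/
noncomputable def confStat (M : LatentBandit K S Θ X) (best : X × S × Θ → Fin K)
    (posterior : ∀ t, Kernel (History K X t) (S × Θ)) (q : StatParams) :
    ∀ t, History K X t → S → ℝ
  | 0, _, _ => 0
  | t + 1, h, s => if q.period ∣ t + 1 then 0 else
      confStat M best posterior q t (fun i => h i.castSucc) s
        + q.incr (confStat M best posterior q t (fun i => h i.castSucc) s)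
          (beliefWeight best (posterior t) (fun i => h i.castSucc) (h (Fin.last t)).1 s
            (h (Fin.last t)).2.1)
          (M.priorMean (h (Fin.last t)).2.1 (h (Fin.last t)).1 s) (h (Fin.last t)).2.2

variable (M : LatentBandit K S Θ X) (best : X × S × Θ → Fin K)
  (posterior : ∀ t, Kernel (History K X t) (S × Θ)) (q : StatParams)

/-- The increment of the confidence statistic of `s` in a round with context `x`, action `a` and
reward `r`. -/
noncomputable def confIncr (t : ℕ) (h : History K X t) (x : X) (a : Fin K) (r : ℝ) (s : S) : ℝ :=
  q.incr (confStat M best posterior q t h s) (beliefWeight best (posterior t) h x s a)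
    (M.priorMean a x s) r

theorem confStat_succ (t : ℕ) (h : History K X (t + 1)) (s : S) :
    confStat M best posterior q (t + 1) h s = if q.period ∣ t + 1 then 0 else
      confStat M best posterior q t (fun i => h i.castSucc) s
        + confIncr M best posterior q t (fun i => h i.castSucc) (h (Fin.last t)).1
          (h (Fin.last t)).2.1 (h (Fin.last t)).2.2 s := rfl

variable {M best posterior q}

theorem confIncr_le_one (hw : 0 ≤ q.w) (t : ℕ) (h : History K X t) (x : X) (a : Fin K) (r : ℝ)
    (s : S) : confIncr M best posterior q t h x a r s ≤ 1 :=
  StatParams.incr_le_one hw (beliefWeight_mem_Icc _ _ _ _ _ _) _ _ _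

/-- Increments are added only up to `level` and are at most `1`, so the overshoot is at most one
increment. -/
theorem confStat_add_confIncr_le (hw : 0 ≤ q.w) (t : ℕ)
    (h : History K X t) (x : X) (a : Fin K) (r : ℝ) (s : S)
    (hle : confStat M best posterior q t h s ≤ q.level + 1) :
    confStat M best posterior q t h s + confIncr M best posterior q t h x a r s
      ≤ q.level + 1 := by
  by_cases hg : confStat M best posterior q t h s ≤ q.level
  · have := confIncr_le_one (M := M) (best := best) (posterior := posterior) hw t h x a r s
    linarith
  · rw [confIncr, StatParams.incr, if_neg hg, add_zero]
    exact hle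

theorem confStat_le (hw : 0 ≤ q.w) (hlevel : 0 ≤ q.level) (t : ℕ) (h : History K X t) (s : S) :
    confStat M best posterior q t h s ≤ q.level + 1 := by
  induction t with
  | zero => simp only [confStat]; linarith
  | succ t ih =>
    rw [confStat_succ]
    split_ifs
    · linarith
    · exact confStat_add_confIncr_le hw t _ _ _ _ s (ih _)

variable [MeasurableSingletonClass S]

/-- The increment depends on the current score; measurability of the latter is assumed so that it
can be proved by induction on the round. -/
theorem measurable_confIncr_of (hbest : Measurable best)
    (hpost : ∀ t, IsMarkovKernel (posterior t)) (t : ℕ) (s : S)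
    (hg : Measurable fun h : History K X t => confStat M best posterior q t h s) :
    Measurable fun z : (History K X t × X) × Fin K × ℝ =>
      confIncr M best posterior q t z.1.1 z.1.2 z.2.1 z.2.2 s := by
  refine q.measurable_incr.comp (f := fun z : (History K X t × X) × Fin K × ℝ =>
    (confStat M best posterior q t z.1.1 s, beliefWeight best (posterior t) z.1.1 z.1.2 s z.2.1,
      M.priorMean z.2.1 z.1.2 s, z.2.2)) ?_
  refine (hg.comp (by fun_prop)).prodMk (Measurable.prodMk ?_ (Measurable.prodMk ?_ (by fun_prop)))
  · exact (measurable_beliefWeight hbest (posterior t) s).comp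
      (f := fun z : (History K X t × X) × Fin K × ℝ => (z.1, z.2.1)) (by fun_prop)
  · exact M.measurable_priorMean.comp
      (f := fun z : (History K X t × X) × Fin K × ℝ => (z.2.1, z.1.2, s)) (by fun_prop)

theorem measurable_confStat_apply (hbest : Measurable best)
    (hpost : ∀ t, IsMarkovKernel (posterior t)) (t : ℕ) (s : S) :
    Measurable fun h : History K X t => confStat M best posterior q t h s := by
  induction t with
  | zero => exact measurable_const
  | succ t ih =>
    simp_rw [confStat_succ]
    split_ifs
    · exact measurable_const
    · refine (ih.comp (f := fun (h : History K X (t + 1)) i => h i.castSucc) (by fun_prop)).add ?_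
      exact (measurable_confIncr_of hbest hpost t s ih).comp
        (f := fun h : History K X (t + 1) => (((fun i => h i.castSucc), (h (Fin.last t)).1),
          (h (Fin.last t)).2)) (by fun_prop)

theorem measurable_confStat (hbest : Measurable best)
    (hpost : ∀ t, IsMarkovKernel (posterior t)) (t : ℕ) :
    Measurable fun z : History K X t × S => confStat M best posterior q t z.1 z.2 :=
  measurable_from_prod_countable_left fun s => measurable_confStat_apply hbest hpost t s

theorem measurable_confIncr (hbest : Measurable best)
    (hpost : ∀ t, IsMarkovKernel (posterior t)) (t : ℕ) :
    Measurable fun z : ((History K X t × X) × Fin K × ℝ) × S =>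
      confIncr M best posterior q t z.1.1.1 z.1.1.2 z.1.2.1 z.1.2.2 z.2 :=
  measurable_from_prod_countable_left fun s =>
    measurable_confIncr_of hbest hpost t s (measurable_confStat_apply hbest hpost t s)

end Statistic

/-! ### Posterior matching and the exponential supermartingale. -/

section TrajectoryLemmas

section

variable {S : Type*}

/-- No latent state changes between the start of the block of round `t` and round `t`. -/
def Unchanged (period : ℕ) {t : ℕ} (y : Fin (t + 1) → S) : Prop :=
  ∀ i : Fin t, t - t % period ≤ i → y i.succ = y i.castSucc

/-- If no block starts at round `t + 1`, the rounds `t` and `t + 1` share the same block start. -/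
theorem Unchanged.of_succ {period t : ℕ} {y : Fin (t + 2) → S} (hy : Unchanged period y)
    (hp : ¬ period ∣ t + 1) : Unchanged period (fun i : Fin (t + 1) => y i.castSucc) ∧
      y (Fin.last (t + 1)) = y (Fin.last t).castSucc := by
  have hmod : (t + 1) % period = t % period + 1 := by
    have h1 := Nat.succ_div_of_not_dvd hp
    have h2 := Nat.div_add_mod (t + 1) period
    have h3 := Nat.div_add_mod t period
    rw [h1] at h2
    omega
  constructor
  · intro i hi
    have := hy i.castSucc (by rw [hmod]; simp; omega)
    simpa using this
  · have := hy (Fin.last t) (by rw [hmod]; simp)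
    simpa using this

end

variable {K : ℕ} {S Θ X Ω : Type*} [Fintype S] [MeasurableSpace S] [MeasurableSingletonClass S]
  [MeasurableSpace Θ] [MeasurableSpace X] [MeasurableSpace Ω]
  {M : LatentBandit K S Θ X} {best : X × S × Θ → Fin K} {P : Measure Ω} [IsProbabilityMeasure P]
  {T : Trajectory K S Θ X Ω} {posterior : ∀ t, Kernel (History K X t) (S × Θ)}
  {q : StatParams} {σ : ℝ}

/-- The context depends on the past only through the history, so revealing it does not alter the
posterior, from which the belief is drawn. -/
theorem lintegral_posterior_match (hE : T.FollowsEnvironment M P)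
    (hU : T.IsUmTS best posterior P) (t : ℕ) {F : (History K X t × X) × S × Θ → ENNReal}
    (hF : Measurable F) :
    ∫⁻ ω, F ((T.history t ω, T.context t ω), T.state t ω, T.θ ω) ∂P
      = ∫⁻ ω, F ((T.history t ω, T.context t ω), T.belief t ω) ∂P := by
  have := hU.markov t
  have h1 := (hE.context t).lintegral_eq
    (F := fun z : Past K S Θ X t × X => F ((z.1.2.2.2, z.2), z.1.2.1 (Fin.last t), z.1.1.1))
    (hF.comp (by fun_prop))
  have hF2 : Measurable fun z : History K X t × S × Θ =>
      ∫⁻ x, F ((z.1, x), z.2) ∂M.contextLaw t z.1 :=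
    Measurable.lintegral_kernel_prod_right' (κ := (M.contextLaw t).comap
        (fun z : History K X t × S × Θ => z.1) measurable_fst)
      (f := fun z : (History K X t × S × Θ) × X => F ((z.1.1, z.2), z.1.2)) (hF.comp (by fun_prop))
  have h2 := (hU.isPosterior t).lintegral_eq hF2
  have h3 := (hU.sampling t).lintegral_eq
    (F := fun z : (Past K S Θ X t × X) × S × Θ => F ((z.1.1.2.2.2, z.1.2), z.2))
    (hF.comp (by fun_prop))
  have hF4 : Measurable fun z : Past K S Θ X t × X =>
      ∫⁻ b, F ((z.1.2.2.2, z.2), b) ∂posterior t z.1.2.2.2 :=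
    Measurable.lintegral_kernel_prod_right' (κ := (posterior t).comap
        (fun z : Past K S Θ X t × X => z.1.2.2.2) (by fun_prop))
      (f := fun z : (Past K S Θ X t × X) × S × Θ => F ((z.1.1.2.2.2, z.1.2), z.2))
      (hF.comp (by fun_prop))
  have h4 := (hE.context t).lintegral_eq hF4
  calc _ = ∫⁻ ω, ∫⁻ x, F ((T.history t ω, x), T.state t ω, T.θ ω)
        ∂M.contextLaw t (T.history t ω) ∂P := h1
    _ = ∫⁻ ω, ∫⁻ b, ∫⁻ x, F ((T.history t ω, x), b) ∂M.contextLaw t (T.history t ω)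
        ∂posterior t (T.history t ω) ∂P := h2
    _ = ∫⁻ ω, ∫⁻ x, ∫⁻ b, F ((T.history t ω, x), b) ∂posterior t (T.history t ω)
        ∂M.contextLaw t (T.history t ω) ∂P := by
        refine lintegral_congr fun ω => ?_
        refine lintegral_lintegral_swap (Measurable.aemeasurable ?_)
        exact hF.comp (f := fun z : (S × Θ) × X => ((T.history t ω, z.2), z.1)) (by fun_prop)
    _ = ∫⁻ ω, ∫⁻ b, F ((T.history t ω, T.context t ω), b) ∂posterior t (T.history t ω) ∂P :=
        h4.symm
    _ = _ := h3.symm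

/-- `F` may involve the true state and parameters: the belief is drawn from the posterior with fresh
randomness, so its conditional law given the action is `beliefWeight` even when the whole past is
known. -/
theorem integral_belief_weight (hbest : Measurable best) (hU : T.IsUmTS best posterior P) (t : ℕ)
    {F : ((Past K S Θ X t × X) × Fin K) × S → ℝ} (hF : Measurable F) {C : ℝ}
    (hC : ∀ z, |F z| ≤ C) :
    ∫ ω, F (((T.past t ω, T.context t ω), T.action t ω), (T.belief t ω).1) ∂P
      = ∫ ω, ∑ s, beliefWeight best (posterior t) (T.history t ω) (T.context t ω) s (T.action t ω)
          * F (((T.past t ω, T.context t ω), T.action t ω), s) ∂P := by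
  have := hU.markov t
  have hb : Measurable fun z : (Past K S Θ X t × X) × S × Θ => best (z.1.2, z.2) :=
    hbest.comp (by fun_prop)
  let f1 : (Past K S Θ X t × X) × S × Θ → ℝ := fun z => F ((z.1, best (z.1.2, z.2)), z.2.1)
  let f2 : (Past K S Θ X t × X) × S × Θ → ℝ := fun z =>
    ∑ s, beliefWeight best (posterior t) z.1.1.2.2.2 z.1.2 s (best (z.1.2, z.2))
      * F ((z.1, best (z.1.2, z.2)), s)
  have hf1 : Measurable f1 := hF.comp (by fun_prop)
  have hf2 : Measurable f2 := by
    refine Finset.measurable_sum _ fun s _ => ?_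
    refine ((measurable_beliefWeight hbest (posterior t) s).comp
      (f := fun z : (Past K S Θ X t × X) × S × Θ =>
        ((z.1.1.2.2.2, z.1.2), best (z.1.2, z.2))) (by fun_prop)).mul ?_
    exact hF.comp (f := fun z : (Past K S Θ X t × X) × S × Θ => ((z.1, best (z.1.2, z.2)), s))
      (by fun_prop)
  have hB1 : ∀ z, ‖f1 z‖ ≤ C := fun z => hC _
  have hB2 : ∀ z, ‖f2 z‖ ≤ ∑ _s : S, C := fun z => by
    refine norm_sum_le_of_le _ fun s _ => ?_
    have hW := beliefWeight_mem_Icc best (posterior t) z.1.1.2.2.2 z.1.2 s (best (z.1.2, z.2))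
    rw [Real.norm_eq_abs, abs_mul, abs_of_nonneg hW.1]
    have h1 := hC ((z.1, best (z.1.2, z.2)), s)
    have h2 := abs_nonneg (F ((z.1, best (z.1.2, z.2)), s))
    nlinarith [hW.2, hW.1]
  have hS := hU.sampling t
  have hi1 : Integrable (fun ω => f1 ((T.past t ω, T.context t ω), T.belief t ω)) P :=
    Integrable.of_bound (hf1.comp_aemeasurable hS.aemeasurable).aestronglyMeasurable C
      (ae_of_all _ fun ω => hB1 _)
  have hi2 : Integrable (fun ω => f2 ((T.past t ω, T.context t ω), T.belief t ω)) P :=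
    Integrable.of_bound (hf2.comp_aemeasurable hS.aemeasurable).aestronglyMeasurable _
      (ae_of_all _ fun ω => hB2 _)
  have h1 := hS.integral_eq hf1 hi1
  have h2 := hS.integral_eq hf2 hi2
  simp_rw [hU.action_eq]
  refine h1.trans (Eq.trans ?_ h2.symm)
  refine integral_congr_ae (ae_of_all _ fun ω => ?_)
  exact integral_belief_eq hbest (posterior t) (T.history t ω) (T.context t ω)
    fun s a => F (((T.past t ω, T.context t ω), a), s)

-- Within a block the true state is constant and its score grows by increments of conditional
-- exponential moment at most `1`. The conditions on `θ` and on the states up to round `t` are fixed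
-- before the reward is drawn, so they pass through the conditioning.
open Classical in
theorem lintegral_exp_confStat_le (hM : M.IsSubGaussian σ)
    (hmean : ∀ a x s θ, M.mean a x s θ ∈ Set.Icc (0 : ℝ) 1) (hbest : Measurable best)
    (hE : T.FollowsEnvironment M P) (hU : T.IsUmTS best posterior P) {G : Set Θ}
    (hG : MeasurableSet G) {ε : ℝ} (hGε : ∀ θ ∈ G, ∀ a x s, |M.priorMean a x s - M.mean a x s θ| ≤ ε)
    (hl : 0 ≤ q.l) (hw : q.l * ε + q.l ^ 2 * secondMomentBound σ ≤ q.w) (t : ℕ) :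
    ∫⁻ ω, (if T.θ ω ∈ G ∧ Unchanged q.period (fun i : Fin (t + 1) => T.state i ω) then
      ENNReal.ofReal (Real.exp (confStat M best posterior q t (T.history t ω) (T.state t ω)))
      else 0) ∂P ≤ 1 := by
  have hpost := hU.markov
  induction t with
  | zero =>
    calc _ ≤ ∫⁻ _, 1 ∂P := lintegral_mono fun ω => by
          dsimp only
          split_ifs
          · simp [confStat]
          · exact zero_le
      _ = 1 := by simp
  | succ t ih =>
    -- At a block boundary the score is reset to `0`, whatever happened before.
    by_cases hp : q.period ∣ t + 1
    · calc _ ≤ ∫⁻ _, 1 ∂P := lintegral_mono fun ω => by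
            dsimp only
            split_ifs
            · simp [confStat_succ, hp]
            · exact zero_le
        _ = 1 := by simp
    let F : (Past K S Θ X t × X × (S × Θ) × Fin K) × ℝ → ENNReal := fun z =>
      if z.1.1.1.1 ∈ G ∧ Unchanged q.period z.1.1.2.1 then
        ENNReal.ofReal (Real.exp (confStat M best posterior q t z.1.1.2.2.2 (z.1.1.2.1 (Fin.last t))
          + confIncr M best posterior q t z.1.1.2.2.2 z.1.2.1 z.1.2.2.2 z.2
            (z.1.1.2.1 (Fin.last t)))) else 0
    have hF : Measurable F := by
      refine Measurable.ite ?_ ?_ measurable_const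
      · have h1 : Measurable fun z : (Past K S Θ X t × X × (S × Θ) × Fin K) × ℝ => z.1.1.1.1 := by
          fun_prop
        have h2 : Measurable fun z : (Past K S Θ X t × X × (S × Θ) × Fin K) × ℝ => z.1.1.2.1 := by
          fun_prop
        exact (h1 hG).inter (h2 (Set.toFinite {y | Unchanged q.period y}).measurableSet)
      · refine (Real.measurable_exp.comp (Measurable.add ?_ ?_)).ennreal_ofReal
        · exact (measurable_confStat hbest hpost t).comp
            (f := fun z : (Past K S Θ X t × X × (S × Θ) × Fin K) × ℝ =>
              (z.1.1.2.2.2, z.1.1.2.1 (Fin.last t))) (by fun_prop)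
        · exact (measurable_confIncr hbest hpost t).comp
            (f := fun z : (Past K S Θ X t × X × (S × Θ) × Fin K) × ℝ =>
              (((z.1.1.2.2.2, z.1.2.1), z.1.2.2.2, z.2), z.1.1.2.1 (Fin.last t))) (by fun_prop)
    have h1 := (hE.reward t).lintegral_eq hF
    calc _ ≤ ∫⁻ ω, F ((T.past t ω, T.context t ω, T.belief t ω, T.action t ω), T.reward t ω) ∂P := by
          refine lintegral_mono fun ω => ?_
          dsimp only
          split_ifs with hcond
          -- The state is the same in rounds `t` and `t + 1`, so the increment scored for the old
          -- state belongs to the new one.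
          · obtain ⟨hu, hs⟩ := hcond.2.of_succ hp
            have hs' : T.state (t + 1) ω = T.state t ω := hs
            have hF' : F ((T.past t ω, T.context t ω, T.belief t ω, T.action t ω), T.reward t ω)
                = _ := if_pos ⟨hcond.1, hu⟩
            rw [hF', confStat_succ, if_neg hp, hs']
            exact le_rfl
          · exact zero_le
      _ = _ := h1
      _ ≤ ∫⁻ ω, (if T.θ ω ∈ G ∧ Unchanged q.period (fun i : Fin (t + 1) => T.state i ω) then
            ENNReal.ofReal (Real.exp (confStat M best posterior q t (T.history t ω) (T.state t ω)))
            else 0) ∂P := by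
          refine lintegral_mono fun ω => ?_
          dsimp only
          split_ifs with hcond
          · have hF' : ∀ r, F ((T.past t ω, T.context t ω, T.belief t ω, T.action t ω), r)
                = ENNReal.ofReal (Real.exp
                    (confStat M best posterior q t (T.history t ω) (T.state t ω)))
                  * ENNReal.ofReal (Real.exp (confIncr M best posterior q t (T.history t ω)
                    (T.context t ω) (T.action t ω) r (T.state t ω))) := fun r => by
              rw [← ENNReal.ofReal_mul (Real.exp_pos _).le, ← Real.exp_add]
              exact if_pos hcond
            simp_rw [hF']
            rw [lintegral_const_mul' _ _ ENNReal.ofReal_ne_top]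
            refine mul_le_of_le_one_right' ?_
            unfold confIncr StatParams.incr
            split_ifs
            · exact hM.lintegral_exp_score_le (hmean _ _ _ _)
                (LatentBandit.priorMean_mem_Icc hmean _ _ _) hl (beliefWeight_mem_Icc _ _ _ _ _ _)
                ((le_abs_self _).trans (hGε _ hcond.1 _ _ _)) hw
            · simp
          · have hF' : ∀ r, F ((T.past t ω, T.context t ω, T.belief t ω, T.action t ω), r)
                = 0 := fun r => if_neg hcond
            simp [hF']
      _ ≤ 1 := ih

end TrajectoryLemmas

/-! ### Spoiled rounds, ruled-out beliefs and the sum of the increments. -/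

section RegretBound

-- A change after round `i` can only spoil the rounds `i + 1, …, i + period`, as no block is longer
-- than `period`.
open Classical in
theorem sum_not_unchanged_le {S : Type*} (y : ℕ → S) {period : ℕ} (hp : 0 < period) (n : ℕ) :
    ∑ t ∈ Finset.range n, (if Unchanged period (fun i : Fin (t + 1) => y i) then (0 : ℝ) else 1)
      ≤ period * ((changeCount fun i : Fin (n + 1) => y i : ℕ) : ℝ) := by
  let Z : ℕ → ℝ := fun i => if y (i + 1) = y i then 0 else 1
  have hZ : ∀ i, 0 ≤ Z i := fun i => by simp only [Z]; split_ifs <;> norm_num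
  have hcount : ((changeCount fun i : Fin (n + 1) => y i : ℕ) : ℝ) = ∑ i ∈ Finset.range n, Z i := by
    rw [← Fin.sum_univ_eq_sum_range]
    unfold changeCount
    push_cast
    rfl
  have hle : ∀ t ∈ Finset.range n,
      (if Unchanged period (fun i : Fin (t + 1) => y i) then (0 : ℝ) else 1)
        ≤ ∑ i ∈ Finset.range n, if t ∈ Finset.Ioc i (i + period) then Z i else 0 := by
    intro t ht
    have hnn : ∀ i ∈ Finset.range n, 0 ≤ if t ∈ Finset.Ioc i (i + period) then Z i else 0 :=
      fun i _ => by split_ifs; exacts [hZ i, le_rfl]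
    split_ifs with hu
    · exact Finset.sum_nonneg hnn
    · unfold Unchanged at hu
      push Not at hu
      obtain ⟨i, hi, hne⟩ := hu
      have hit := i.2
      have hmod := Nat.mod_lt t hp
      have hmem : t ∈ Finset.Ioc (i : ℕ) (i + period) := by
        rw [Finset.mem_Ioc]; omega
      refine le_trans ?_ (Finset.single_le_sum hnn (a := (i : ℕ))
        (Finset.mem_range.2 (hit.trans (Finset.mem_range.1 ht))))
      rw [if_pos hmem]
      have hne' : ¬ y (i + 1) = y i := by simpa using hne
      simp only [Z, if_neg hne']
      exact le_rfl
  calc _ ≤ ∑ t ∈ Finset.range n, ∑ i ∈ Finset.range n,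
        (if t ∈ Finset.Ioc i (i + period) then Z i else 0) := Finset.sum_le_sum hle
    _ = ∑ i ∈ Finset.range n, ∑ t ∈ Finset.range n,
        (if t ∈ Finset.Ioc i (i + period) then Z i else 0) := Finset.sum_comm
    _ ≤ ∑ i ∈ Finset.range n, period * Z i := by
        refine Finset.sum_le_sum fun i _ => ?_
        rw [← Finset.sum_filter, Finset.sum_const, nsmul_eq_mul]
        have hcard : ((Finset.range n).filter fun t => t ∈ Finset.Ioc i (i + period)).card
            ≤ period := by
          calc _ ≤ (Finset.Ioc i (i + period)).card :=
                Finset.card_le_card fun t ht => (Finset.mem_filter.1 ht).2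
            _ = period := by simp
        have := hZ i
        gcongr
    _ = _ := by rw [hcount, Finset.mul_sum]

variable {K : ℕ} {S Θ X Ω : Type*} [Fintype S] [MeasurableSpace S] [MeasurableSingletonClass S]
  [MeasurableSpace Θ] [MeasurableSpace X] [MeasurableSpace Ω]
  {M : LatentBandit K S Θ X} {best : X × S × Θ → Fin K} {P : Measure Ω} [IsProbabilityMeasure P]
  {T : Trajectory K S Θ X Ω} {posterior : ∀ t, Kernel (History K X t) (S × Θ)}
  {q : StatParams} {σ : ℝ}

/-- The increments of a block telescope to a score of at most `level + 1`, including the last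
increment of the block, which the reset discards. The `+ 1` beside `n / period` counts the
unfinished block. -/
theorem sum_confIncr_le (hw : 0 ≤ q.w) (hlevel : 0 ≤ q.level) (ω : Ω) (s : S) (n : ℕ) :
    ∑ t ∈ Finset.range n, confIncr M best posterior q t (T.history t ω) (T.context t ω)
        (T.action t ω) (T.reward t ω) s
      ≤ ((n / q.period : ℕ) + 1) * (q.level + 1) := by
  suffices h : ∑ t ∈ Finset.range n, confIncr M best posterior q t (T.history t ω) (T.context t ω)
        (T.action t ω) (T.reward t ω) s
      ≤ (n / q.period : ℕ) * (q.level + 1)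
        + confStat M best posterior q n (T.history n ω) s by
    have := confStat_le (M := M) (best := best) (posterior := posterior) hw hlevel n
      (T.history n ω) s
    linarith
  induction n with
  | zero => simp [confStat]
  | succ n ih =>
    have hstep := confStat_add_confIncr_le (M := M) (best := best) (posterior := posterior) hw n
      (T.history n ω) (T.context n ω) (T.action n ω) (T.reward n ω) s (confStat_le hw hlevel n _ s)
    rw [Finset.sum_range_succ, confStat_succ]
    by_cases hp : q.period ∣ n + 1
    · rw [if_pos hp, Nat.succ_div_of_dvd hp]
      push_cast
      linarith
    · rw [if_neg hp, Nat.succ_div_of_not_dvd hp]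
      change _ ≤ _ + (confStat M best posterior q n (T.history n ω) s
        + confIncr M best posterior q n (T.history n ω) (T.context n ω) (T.action n ω)
          (T.reward n ω) s)
      linarith

theorem aemeasurable_round (hE : T.FollowsEnvironment M P) (t : ℕ) :
    AEMeasurable (fun ω => ((T.past t ω, T.context t ω, T.belief t ω, T.action t ω),
      T.reward t ω)) P :=
  (hE.reward t).aemeasurable

/-- Posterior matching exchanges the believed state for the true one, since the score is a function
of the history; Markov's inequality for `exp` of the score then gives the last term. -/
theorem measure_level_lt_confStat_le (hM : M.IsSubGaussian σ)
    (hmean : ∀ a x s θ, M.mean a x s θ ∈ Set.Icc (0 : ℝ) 1) (hbest : Measurable best)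
    (hE : T.FollowsEnvironment M P) (hU : T.IsUmTS best posterior P) {G : Set Θ}
    (hG : MeasurableSet G) {ε : ℝ} (hGε : ∀ θ ∈ G, ∀ a x s, |M.priorMean a x s - M.mean a x s θ| ≤ ε)
    (hl : 0 ≤ q.l) (hw : q.l * ε + q.l ^ 2 * secondMomentBound σ ≤ q.w) (t : ℕ) :
    P.real {ω | q.level < confStat M best posterior q t (T.history t ω) (T.belief t ω).1}
      ≤ P.real {ω | T.θ ω ∉ G}
        + P.real {ω | ¬ Unchanged q.period fun i : Fin (t + 1) => T.state i ω}
        + Real.exp (-q.level) := by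
  classical
  have hpost := hU.markov
  have hround := aemeasurable_round hE t
  have hg := measurable_confStat (M := M) (q := q) hbest hpost t
  have hset : MeasurableSet {z : (History K X t × X) × S × Θ |
      q.level < confStat M best posterior q t z.1.1 z.2.1} :=
    measurableSet_lt measurable_const (hg.comp
      (f := fun z : (History K X t × X) × S × Θ => (z.1.1, z.2.1)) (by fun_prop))
  have hmatch := lintegral_posterior_match hE hU t (F := Set.indicator
    {z | q.level < confStat M best posterior q t z.1.1 z.2.1} 1) (measurable_one.indicator hset)
  have hbelief : AEMeasurable (fun ω => ((T.history t ω, T.context t ω), T.belief t ω)) P :=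
    (by fun_prop : Measurable fun z : (Past K S Θ X t × X × (S × Θ) × Fin K) × ℝ =>
      ((z.1.1.2.2.2, z.1.2.1), z.1.2.2.1)).comp_aemeasurable hround
  have hstate : AEMeasurable (fun ω => ((T.history t ω, T.context t ω), T.state t ω, T.θ ω)) P :=
    (by fun_prop : Measurable fun z : (Past K S Θ X t × X × (S × Θ) × Fin K) × ℝ =>
      ((z.1.1.2.2.2, z.1.2.1), z.1.1.2.1 (Fin.last t), z.1.1.1.1)).comp_aemeasurable hround
  have hm1 : P {ω | q.level < confStat M best posterior q t (T.history t ω) (T.belief t ω).1}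
      = P {ω | q.level < confStat M best posterior q t (T.history t ω) (T.state t ω)} := by
    have e1 := lintegral_indicator_one₀ (hbelief.nullMeasurableSet_preimage hset)
    have e2 := lintegral_indicator_one₀ (hstate.nullMeasurableSet_preimage hset)
    exact e1.symm.trans (hmatch.symm.trans e2)
  let f : Ω → ENNReal := fun ω =>
    if T.θ ω ∈ G ∧ Unchanged q.period (fun i : Fin (t + 1) => T.state i ω) then
      ENNReal.ofReal (Real.exp (confStat M best posterior q t (T.history t ω) (T.state t ω))) else 0
  have hf : AEMeasurable f P := by
    have hF : Measurable fun z : Θ × (Fin (t + 1) → S) × History K X t =>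
        if z.1 ∈ G ∧ Unchanged q.period z.2.1 then
          ENNReal.ofReal (Real.exp (confStat M best posterior q t z.2.2 (z.2.1 (Fin.last t))))
        else 0 := by
      refine Measurable.ite ?_ ?_ measurable_const
      · exact (measurable_fst hG).inter ((by fun_prop : Measurable fun z :
          Θ × (Fin (t + 1) → S) × History K X t => z.2.1)
          (Set.toFinite {y | Unchanged q.period y}).measurableSet)
      · exact (Real.measurable_exp.comp (hg.comp
          (f := fun z : Θ × (Fin (t + 1) → S) × History K X t => (z.2.2, z.2.1 (Fin.last t)))
          (by fun_prop))).ennreal_ofReal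
    exact hF.comp_aemeasurable ((by fun_prop : Measurable fun z :
      (Past K S Θ X t × X × (S × Θ) × Fin K) × ℝ =>
        (z.1.1.1.1, z.1.1.2.1, z.1.1.2.2.2)).comp_aemeasurable hround)
  have hmarkov : P.real {ω | ENNReal.ofReal (Real.exp q.level) ≤ f ω} ≤ Real.exp (-q.level) := by
    have h1 := (mul_meas_ge_le_lintegral₀ hf (ENNReal.ofReal (Real.exp q.level))).trans
      (lintegral_exp_confStat_le hM hmean hbest hE hU hG hGε hl hw t)
    have h2 := ENNReal.toReal_mono ENNReal.one_ne_top h1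
    rw [ENNReal.toReal_mul, ENNReal.toReal_ofReal (Real.exp_pos _).le, ENNReal.toReal_one] at h2
    rw [Real.exp_neg, ← one_div, le_div_iff₀ (Real.exp_pos _), mul_comm]
    exact h2
  rw [measureReal_def, hm1, ← measureReal_def]
  calc _ ≤ P.real ({ω | T.θ ω ∉ G}
        ∪ {ω | ¬ Unchanged q.period fun i : Fin (t + 1) => T.state i ω}
        ∪ {ω | ENNReal.ofReal (Real.exp q.level) ≤ f ω}) := by
        refine measureReal_mono fun ω hω => ?_
        by_cases h1 : T.θ ω ∈ G
        · by_cases h2 : Unchanged q.period fun i : Fin (t + 1) => T.state i ω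
          · refine Or.inr ?_
            have hfω : f ω = _ := if_pos ⟨h1, h2⟩
            change _ ≤ f ω
            rw [hfω]
            exact ENNReal.ofReal_le_ofReal (Real.exp_le_exp.2 (le_of_lt hω))
          · exact Or.inl (Or.inr h2)
        · exact Or.inl (Or.inl h1)
    _ ≤ _ := by
        refine (measureReal_union_le _ _).trans ?_
        refine add_le_add (measureReal_union_le _ _) hmarkov

theorem integrable_confIncr (hM : M.IsSubGaussian σ)
    (hmean : ∀ a x s θ, M.mean a x s θ ∈ Set.Icc (0 : ℝ) 1) (hbest : Measurable best)
    (hE : T.FollowsEnvironment M P) (hU : T.IsUmTS best posterior P) (t : ℕ) (s : S) :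
    Integrable (fun ω => confIncr M best posterior q t (T.history t ω) (T.context t ω)
      (T.action t ω) (T.reward t ω) s) P := by
  let f : (Past K S Θ X t × X × (S × Θ) × Fin K) × ℝ → ℝ := fun z =>
    confIncr M best posterior q t z.1.1.2.2.2 z.1.2.1 z.1.2.2.2 z.2 s
  have hf : Measurable f := (measurable_confIncr hbest hU.markov t).comp
    (f := fun z : (Past K S Θ X t × X × (S × Θ) × Fin K) × ℝ =>
      (((z.1.1.2.2.2, z.1.2.1), z.1.2.2.2, z.2), s)) (by fun_prop)
  refine (hE.reward t).integrable_of_le hf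
    (C := ENNReal.ofReal (1 + |q.w| + 2 * q.l ^ 2 * secondMomentBound σ)) ENNReal.ofReal_ne_top ?_
  intro z
  rw [Kernel.comap_apply]
  set c := M.priorMean z.2.2.2 z.2.1 s
  obtain ⟨h1, h2⟩ := hM.integral_sq_le (hmean z.2.2.2 z.2.1 (z.1.2.1 (Fin.last t)) z.1.1.1)
    (LatentBandit.priorMean_mem_Icc hmean z.2.2.2 z.2.1 s)
  have h3 := h1.const_mul (2 * q.l ^ 2)
  calc ∫⁻ r, ‖f (z, r)‖ₑ ∂M.rewardLaw (z.2.2.2, z.2.1, z.1.2.1 (Fin.last t), z.1.1.1)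
      ≤ ∫⁻ r, ENNReal.ofReal (1 + |q.w| + 2 * q.l ^ 2 * (c - r) ^ 2)
          ∂M.rewardLaw (z.2.2.2, z.2.1, z.1.2.1 (Fin.last t), z.1.1.1) := by
        refine lintegral_mono fun r => ?_
        rw [Real.enorm_eq_ofReal_abs]
        refine ENNReal.ofReal_le_ofReal ?_
        simp only [f, confIncr, StatParams.incr]
        have hpos : 0 ≤ 1 + |q.w| + 2 * q.l ^ 2 * (c - r) ^ 2 := by positivity
        split_ifs
        · have hW := beliefWeight_mem_Icc best (posterior t) z.1.2.2.2 z.2.1 s z.2.2.2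
          rw [abs_mul, abs_of_nonneg hW.1]
          have hb : |q.l * (c - r) - (q.l * (c - r)) ^ 2 - q.w|
              ≤ 1 + |q.w| + 2 * q.l ^ 2 * (c - r) ^ 2 := by
            have h4 : 2 * q.l ^ 2 * (c - r) ^ 2 = 2 * (q.l * (c - r)) ^ 2 := by ring
            rw [h4]
            set u := q.l * (c - r)
            rw [abs_le]
            constructor <;> nlinarith [neg_abs_le q.w, le_abs_self q.w, sq_nonneg (u - 1 / 2),
              sq_nonneg (u + 1 / 2)]
          exact (mul_le_of_le_one_left (abs_nonneg _) hW.2).trans hb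
        · simpa using hpos
    _ = ENNReal.ofReal (∫ r, (1 + |q.w| + 2 * q.l ^ 2 * (c - r) ^ 2)
          ∂M.rewardLaw (z.2.2.2, z.2.1, z.1.2.1 (Fin.last t), z.1.1.1)) :=
        (ofReal_integral_eq_lintegral_ofReal ((integrable_const _).add h3)
          (ae_of_all _ fun r => by
            change 0 ≤ 1 + |q.w| + 2 * q.l ^ 2 * (c - r) ^ 2
            positivity)).symm
    _ ≤ _ := by
        refine ENNReal.ofReal_le_ofReal ?_
        rw [integral_add (integrable_const _) h3, integral_const_mul]
        simp only [integral_const, probReal_univ, one_smul]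
        gcongr

/-- Averaging over the belief given the action turns the score of the believed state into the
weighted sum over all states, which is what the statistics add up. Integrating out the reward then
compares each summand with its increment. -/
theorem integral_gap_le (hM : M.IsSubGaussian σ)
    (hmean : ∀ a x s θ, M.mean a x s θ ∈ Set.Icc (0 : ℝ) 1) (hbest : Measurable best)
    (hE : T.FollowsEnvironment M P) (hU : T.IsUmTS best posterior P) (t : ℕ) :
    ∫ ω, (if confStat M best posterior q t (T.history t ω) (T.belief t ω).1 ≤ q.level then
        q.l * (M.priorMean (T.action t ω) (T.context t ω) (T.belief t ω).1
          - M.mean (T.action t ω) (T.context t ω) (T.state t ω) (T.θ ω))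
          - q.l ^ 2 * secondMomentBound σ - q.w else 0) ∂P
      ≤ ∑ s, ∫ ω, confIncr M best posterior q t (T.history t ω) (T.context t ω)
          (T.action t ω) (T.reward t ω) s ∂P := by
  have hpost := hU.markov
  let F : ((Past K S Θ X t × X) × Fin K) × S → ℝ := fun z =>
    if confStat M best posterior q t z.1.1.1.2.2.2 z.2 ≤ q.level then
      q.l * (M.priorMean z.1.2 z.1.1.2 z.2
        - M.mean z.1.2 z.1.1.2 (z.1.1.1.2.1 (Fin.last t)) z.1.1.1.1.1)
        - q.l ^ 2 * secondMomentBound σ - q.w else 0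
  have hF : Measurable F := by
    refine Measurable.ite (measurableSet_le ((measurable_confStat hbest hpost t).comp
      (f := fun z : ((Past K S Θ X t × X) × Fin K) × S => (z.1.1.1.2.2.2, z.2)) (by fun_prop))
      measurable_const) ?_ measurable_const
    have h1 := M.measurable_priorMean.comp
      (f := fun z : ((Past K S Θ X t × X) × Fin K) × S => (z.1.2, z.1.1.2, z.2)) (by fun_prop)
    have h2 := M.measurable_mean.comp (f := fun z : ((Past K S Θ X t × X) × Fin K) × S =>
      (z.1.2, z.1.1.2, z.1.1.1.2.1 (Fin.last t), z.1.1.1.1.1)) (by fun_prop)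
    exact (((h1.sub h2).const_mul q.l).sub_const _).sub_const _
  have hFb : ∀ z, |F z| ≤ |q.l| + q.l ^ 2 * secondMomentBound σ + |q.w| := by
    intro z
    have hV := secondMomentBound_pos σ
    simp only [F]
    split_ifs
    · set a := M.priorMean z.1.2 z.1.1.2 z.2 with ha
      set b := M.mean z.1.2 z.1.1.2 (z.1.1.1.2.1 (Fin.last t)) z.1.1.1.1.1 with hb
      have h1 : a ∈ Set.Icc (0 : ℝ) 1 := LatentBandit.priorMean_mem_Icc hmean _ _ _
      have h2 : b ∈ Set.Icc (0 : ℝ) 1 := hmean _ _ _ _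
      have h3 : |q.l * (a - b)| ≤ |q.l| := by
        rw [abs_mul]
        refine mul_le_of_le_one_right (abs_nonneg _) ?_
        rw [abs_le]; constructor <;> linarith [h1.1, h1.2, h2.1, h2.2]
      have h4 : 0 ≤ q.l ^ 2 * secondMomentBound σ := by positivity
      have := abs_le.1 h3
      rw [abs_le]
      constructor <;> linarith [neg_abs_le q.w, le_abs_self q.w]
    · simp; positivity
  have hround := aemeasurable_round hE t
  have hWF : ∀ s, Measurable fun z : (Past K S Θ X t × X) × Fin K =>
      beliefWeight best (posterior t) z.1.1.2.2.2 z.1.2 s z.2 * F (z, s) := fun s =>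
    ((measurable_beliefWeight hbest (posterior t) s).comp
      (f := fun z : (Past K S Θ X t × X) × Fin K => ((z.1.1.2.2.2, z.1.2), z.2))
      (by fun_prop)).mul (hF.comp (by fun_prop))
  have hWFi : ∀ s, Integrable (fun ω => beliefWeight best (posterior t) (T.history t ω)
      (T.context t ω) s (T.action t ω)
      * F (((T.past t ω, T.context t ω), T.action t ω), s)) P := fun s => by
    refine Integrable.of_bound ((hWF s).comp_aemeasurable ((by fun_prop : Measurable fun z :
      (Past K S Θ X t × X × (S × Θ) × Fin K) × ℝ =>
        ((z.1.1, z.1.2.1), z.1.2.2.2)).comp_aemeasurable hround)).aestronglyMeasurable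
      (|q.l| + q.l ^ 2 * secondMomentBound σ + |q.w|) (ae_of_all _ fun ω => ?_)
    have hW := beliefWeight_mem_Icc best (posterior t) (T.history t ω) (T.context t ω) s
      (T.action t ω)
    rw [Real.norm_eq_abs, abs_mul, abs_of_nonneg hW.1]
    exact (mul_le_of_le_one_left (abs_nonneg _) hW.2).trans (hFb _)
  refine (integral_belief_weight hbest hU t hF hFb).trans_le ?_
  rw [integral_finsetSum _ fun s _ => hWFi s]
  refine Finset.sum_le_sum fun s _ => ?_
  let f : (Past K S Θ X t × X × (S × Θ) × Fin K) × ℝ → ℝ := fun z =>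
    confIncr M best posterior q t z.1.1.2.2.2 z.1.2.1 z.1.2.2.2 z.2 s
  have hf : Measurable f := (measurable_confIncr hbest hpost t).comp
    (f := fun z : (Past K S Θ X t × X × (S × Θ) × Fin K) × ℝ =>
      (((z.1.1.2.2.2, z.1.2.1), z.1.2.2.2, z.2), s)) (by fun_prop)
  have hfi := integrable_confIncr (q := q) hM hmean hbest hE hU t s
  have h1 := (hE.reward t).integral_eq hf hfi
  have hinner : Integrable (fun ω => ∫ r, f ((T.past t ω, T.context t ω, T.belief t ω,
      T.action t ω), r) ∂M.rewardLaw (T.action t ω, T.context t ω, T.state t ω, T.θ ω)) P := by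
    exact (hE.reward t).integrable_integral hf hfi
  refine (integral_mono (hWFi s) hinner fun ω => ?_).trans_eq h1.symm
  dsimp only [f, F, confIncr, StatParams.incr]
  have hW := beliefWeight_mem_Icc best (posterior t) (T.history t ω) (T.context t ω) s
      (T.action t ω)
  obtain ⟨h2, h3⟩ := hM.le_integral_score
    (hmean (T.action t ω) (T.context t ω) (T.state t ω) (T.θ ω))
    (LatentBandit.priorMean_mem_Icc hmean (T.action t ω) (T.context t ω) s) q.l q.w
  by_cases hg : confStat M best posterior q t (T.history t ω) s ≤ q.level
  · have hg' : confStat M best posterior q t (T.past t ω).2.2.2 s ≤ q.level := hg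
    simp only [if_pos hg']
    rw [integral_const_mul]
    exact mul_le_mul_of_nonneg_left h3 hW.1
  · have hg' : ¬ confStat M best posterior q t (T.past t ω).2.2.2 s ≤ q.level := hg
    simp only [if_neg hg']
    simp

end RegretBound

/-! ### Decomposition of the Bayes regret. -/

section BayesRegret

variable {K : ℕ} {S Θ X Ω : Type*} [Fintype S] [MeasurableSpace S] [MeasurableSingletonClass S]
  [MeasurableSpace Θ] [MeasurableSpace X] [MeasurableSpace Ω]
  {M : LatentBandit K S Θ X} {best : X × S × Θ → Fin K} {P : Measure Ω} [IsProbabilityMeasure P]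
  {T : Trajectory K S Θ X Ω} {posterior : ∀ t, Kernel (History K X t) (S × Θ)}
  {q : StatParams} {σ : ℝ}

/-- Both sides integrate one function of history, context and a pair (state, parameter); the played
action is `best` at the sampled pair. -/
theorem integral_priorMean_best (hmean : ∀ a x s θ, M.mean a x s θ ∈ Set.Icc (0 : ℝ) 1)
    (hbest : Measurable best) (hE : T.FollowsEnvironment M P) (hU : T.IsUmTS best posterior P)
    (t : ℕ) :
    ∫ ω, M.priorMean (best (T.context t ω, T.state t ω, T.θ ω)) (T.context t ω) (T.state t ω) ∂P
      = ∫ ω, M.priorMean (T.action t ω) (T.context t ω) (T.belief t ω).1 ∂P := by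
  have hround := aemeasurable_round hE t
  let f : (History K X t × X) × S × Θ → ℝ := fun z => M.priorMean (best (z.1.2, z.2)) z.1.2 z.2.1
  have hf : Measurable f := M.measurable_priorMean.comp
    (f := fun z : (History K X t × X) × S × Θ => (best (z.1.2, z.2), z.1.2, z.2.1))
    ((hbest.comp (by fun_prop)).prodMk (by fun_prop))
  have hnn : ∀ z, 0 ≤ f z := fun z => (LatentBandit.priorMean_mem_Icc hmean _ _ _).1
  have hbelief : AEMeasurable (fun ω => f ((T.history t ω, T.context t ω), T.belief t ω)) P :=
    hf.comp_aemeasurable ((by fun_prop : Measurable fun z :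
      (Past K S Θ X t × X × (S × Θ) × Fin K) × ℝ =>
        ((z.1.1.2.2.2, z.1.2.1), z.1.2.2.1)).comp_aemeasurable hround)
  have hstate : AEMeasurable (fun ω => f ((T.history t ω, T.context t ω), T.state t ω, T.θ ω)) P :=
    hf.comp_aemeasurable ((by fun_prop : Measurable fun z :
      (Past K S Θ X t × X × (S × Θ) × Fin K) × ℝ =>
        ((z.1.1.2.2.2, z.1.2.1), z.1.1.2.1 (Fin.last t), z.1.1.1.1)).comp_aemeasurable hround)
  have h := lintegral_posterior_match hE hU t (F := fun z => ENNReal.ofReal (f z)) hf.ennreal_ofReal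
  have h1 := integral_eq_lintegral_of_nonneg_ae (ae_of_all P fun ω =>
    hnn ((T.history t ω, T.context t ω), T.state t ω, T.θ ω)) hstate.aestronglyMeasurable
  have h2 := integral_eq_lintegral_of_nonneg_ae (ae_of_all P fun ω =>
    hnn ((T.history t ω, T.context t ω), T.belief t ω)) hbelief.aestronglyMeasurable
  have h3 : ∫ ω, M.priorMean (T.action t ω) (T.context t ω) (T.belief t ω).1 ∂P
      = ∫ ω, f ((T.history t ω, T.context t ω), T.belief t ω) ∂P := by
    refine integral_congr_ae (ae_of_all _ fun ω => ?_)
    simp only [f, hU.action_eq]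
  rw [h3, h2, ← h, ← h1]

theorem aemeasurable_parameter (hE : T.FollowsEnvironment M P) : AEMeasurable T.θ P :=
  (by fun_prop : Measurable fun z : (Θ × TransitionMatrix S) × S => z.1.1).comp_aemeasurable
    hE.initial.aemeasurable

theorem integrable_mean_comp (hmean : ∀ a x s θ, M.mean a x s θ ∈ Set.Icc (0 : ℝ) 1)
    {A : Ω → Fin K × X × S × Θ} (hA : AEMeasurable A P) :
    Integrable (fun ω => M.mean (A ω).1 (A ω).2.1 (A ω).2.2.1 (A ω).2.2.2) P := by
  refine Integrable.of_bound (M.measurable_mean.comp_aemeasurable hA).aestronglyMeasurable 1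
    (ae_of_all _ fun ω => ?_)
  rw [Real.norm_eq_abs, abs_of_nonneg (hmean _ _ _ _).1]
  exact (hmean _ _ _ _).2

theorem integrable_priorMean_comp (hmean : ∀ a x s θ, M.mean a x s θ ∈ Set.Icc (0 : ℝ) 1)
    {A : Ω → Fin K × X × S} (hA : AEMeasurable A P) :
    Integrable (fun ω => M.priorMean (A ω).1 (A ω).2.1 (A ω).2.2) P := by
  refine Integrable.of_bound (M.measurable_priorMean.comp_aemeasurable hA).aestronglyMeasurable 1
    (ae_of_all _ fun ω => ?_)
  have h := LatentBandit.priorMean_mem_Icc hmean (A ω).1 (A ω).2.1 (A ω).2.2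
  rw [Real.norm_eq_abs, abs_of_nonneg h.1]
  exact h.2

theorem aemeasurable_action_state (hE : T.FollowsEnvironment M P) (t : ℕ) :
    AEMeasurable (fun ω => (T.action t ω, T.context t ω, T.state t ω, T.θ ω)) P :=
  (by fun_prop : Measurable fun z : (Past K S Θ X t × X × (S × Θ) × Fin K) × ℝ =>
    (z.1.2.2.2, z.1.2.1, z.1.1.2.1 (Fin.last t), z.1.1.1.1)).comp_aemeasurable
      (aemeasurable_round hE t)

theorem aemeasurable_best_state (hbest : Measurable best) (hE : T.FollowsEnvironment M P) (t : ℕ) :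
    AEMeasurable (fun ω => (best (T.context t ω, T.state t ω, T.θ ω), T.context t ω, T.state t ω,
      T.θ ω)) P :=
  ((hbest.comp (f := fun z : Fin K × X × S × Θ => z.2) measurable_snd).prodMk
    measurable_snd).comp_aemeasurable (aemeasurable_action_state hE t)

theorem aemeasurable_action_belief (hE : T.FollowsEnvironment M P) (t : ℕ) :
    AEMeasurable (fun ω => (T.action t ω, T.context t ω, (T.belief t ω).1)) P :=
  (by fun_prop : Measurable fun z : (Past K S Θ X t × X × (S × Θ) × Fin K) × ℝ =>
    (z.1.2.2.2, z.1.2.1, z.1.2.2.1.1)).comp_aemeasurable (aemeasurable_round hE t)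

theorem integrable_gap (hmean : ∀ a x s θ, M.mean a x s θ ∈ Set.Icc (0 : ℝ) 1)
    (hE : T.FollowsEnvironment M P) (t : ℕ) :
    Integrable (fun ω => M.priorMean (T.action t ω) (T.context t ω) (T.belief t ω).1
      - M.mean (T.action t ω) (T.context t ω) (T.state t ω) (T.θ ω)) P :=
  (integrable_priorMean_comp hmean (aemeasurable_action_belief hE t)).sub
    (integrable_mean_comp hmean (aemeasurable_action_state hE t))

theorem integrable_instantRegret (hmean : ∀ a x s θ, M.mean a x s θ ∈ Set.Icc (0 : ℝ) 1)
    (hbest : Measurable best) (hE : T.FollowsEnvironment M P) (t : ℕ) :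
    Integrable (fun ω => M.mean (best (T.context t ω, T.state t ω, T.θ ω)) (T.context t ω)
        (T.state t ω) (T.θ ω)
      - M.mean (T.action t ω) (T.context t ω) (T.state t ω) (T.θ ω)) P :=
  (integrable_mean_comp hmean (aemeasurable_best_state hbest hE t)).sub
    (integrable_mean_comp hmean (aemeasurable_action_state hE t))

/-- The prior means of the best action in the true state and of the played action in the believed
state are inserted; their difference has expectation zero. Outside `G` the trivial bound `1` is
used. -/
theorem integral_instantRegret_le (hmean : ∀ a x s θ, M.mean a x s θ ∈ Set.Icc (0 : ℝ) 1)
    (hbest : Measurable best) (hE : T.FollowsEnvironment M P) (hU : T.IsUmTS best posterior P)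
    {G : Set Θ} (hG : MeasurableSet G) {ε : ℝ} (hε : 0 ≤ ε)
    (hGε : ∀ θ ∈ G, ∀ a x s, |M.priorMean a x s - M.mean a x s θ| ≤ ε) (t : ℕ) :
    ∫ ω, (M.mean (best (T.context t ω, T.state t ω, T.θ ω)) (T.context t ω) (T.state t ω) (T.θ ω)
        - M.mean (T.action t ω) (T.context t ω) (T.state t ω) (T.θ ω)) ∂P
      ≤ P.real {ω | T.θ ω ∉ G} + ε
        + ∫ ω, (M.priorMean (T.action t ω) (T.context t ω) (T.belief t ω).1
          - M.mean (T.action t ω) (T.context t ω) (T.state t ω) (T.θ ω)) ∂P := by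
  have hbad : NullMeasurableSet {ω | T.θ ω ∉ G} P :=
    (aemeasurable_parameter hE).nullMeasurableSet_preimage hG.compl
  have h0 : Integrable (Set.indicator {ω | T.θ ω ∉ G} fun _ => (1 : ℝ)) P :=
    (integrable_const 1).indicator₀ hbad
  have hb := aemeasurable_best_state hbest hE t
  have h1 : Integrable (fun ω => M.priorMean (best (T.context t ω, T.state t ω, T.θ ω))
      (T.context t ω) (T.state t ω)) P :=
    integrable_priorMean_comp hmean
      (A := fun ω => (best (T.context t ω, T.state t ω, T.θ ω), T.context t ω, T.state t ω))
      ((by fun_prop : Measurable fun z : Fin K × X × S × Θ => (z.1, z.2.1, z.2.2.1)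
        ).comp_aemeasurable hb)
  have h2 := integrable_priorMean_comp hmean (aemeasurable_action_belief hE t)
  have h3 := integrable_gap hmean hE t
  have h01 : Integrable (fun ω => Set.indicator {ω | T.θ ω ∉ G} (fun _ => (1 : ℝ)) ω + ε) P :=
    h0.add (integrable_const ε)
  have h12 : Integrable (fun ω => M.priorMean (best (T.context t ω, T.state t ω, T.θ ω))
      (T.context t ω) (T.state t ω)
        - M.priorMean (T.action t ω) (T.context t ω) (T.belief t ω).1) P := h1.sub h2
  have h123 : Integrable (fun ω => (M.priorMean (best (T.context t ω, T.state t ω, T.θ ω))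
      (T.context t ω) (T.state t ω)
        - M.priorMean (T.action t ω) (T.context t ω) (T.belief t ω).1)
      + (M.priorMean (T.action t ω) (T.context t ω) (T.belief t ω).1
        - M.mean (T.action t ω) (T.context t ω) (T.state t ω) (T.θ ω))) P := h12.add h3
  calc _ ≤ ∫ ω, ((Set.indicator {ω | T.θ ω ∉ G} (fun _ => (1 : ℝ)) ω + ε)
        + ((M.priorMean (best (T.context t ω, T.state t ω, T.θ ω)) (T.context t ω) (T.state t ω)
          - M.priorMean (T.action t ω) (T.context t ω) (T.belief t ω).1)
        + (M.priorMean (T.action t ω) (T.context t ω) (T.belief t ω).1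
          - M.mean (T.action t ω) (T.context t ω) (T.state t ω) (T.θ ω)))) ∂P := by
        refine integral_mono (integrable_instantRegret hmean hbest hE t)
          (h01.add h123) fun ω => ?_
        dsimp only
        by_cases hω : T.θ ω ∈ G
        · have h4 := (abs_le.1 (hGε _ hω (best (T.context t ω, T.state t ω, T.θ ω))
            (T.context t ω) (T.state t ω))).1
          rw [Set.indicator_of_notMem (by simpa using hω)]
          linarith
        · rw [Set.indicator_of_mem (by simpa using hω)]
          have h4 := (hmean (best (T.context t ω, T.state t ω, T.θ ω)) (T.context t ω)
            (T.state t ω) (T.θ ω)).2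
          have h5 := (LatentBandit.priorMean_mem_Icc hmean
            (best (T.context t ω, T.state t ω, T.θ ω)) (T.context t ω) (T.state t ω)).1
          linarith
    _ = _ := by
        rw [integral_add h01 h123, integral_add h0 (integrable_const ε),
          integral_add h12 h3,
          integral_sub h1 h2, integral_priorMean_best hmean hbest hE hU t,
          integral_indicator₀ hbad, setIntegral_const]
        simp

theorem bayesRegret_eq_sum (hmean : ∀ a x s θ, M.mean a x s θ ∈ Set.Icc (0 : ℝ) 1)
    (hbest : Measurable best) (hE : T.FollowsEnvironment M P) (n : ℕ) :
    T.bayesRegret M best P n = ∑ t ∈ Finset.range n,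
      ∫ ω, (M.mean (best (T.context t ω, T.state t ω, T.θ ω)) (T.context t ω) (T.state t ω) (T.θ ω)
        - M.mean (T.action t ω) (T.context t ω) (T.state t ω) (T.θ ω)) ∂P :=
  integral_finsetSum _ fun t _ => integrable_instantRegret hmean hbest hE t

theorem bayesRegret_le_horizon (hmean : ∀ a x s θ, M.mean a x s θ ∈ Set.Icc (0 : ℝ) 1)
    (hbest : Measurable best) (hE : T.FollowsEnvironment M P) (n : ℕ) :
    T.bayesRegret M best P n ≤ n := by
  rw [bayesRegret_eq_sum hmean hbest hE]
  calc _ ≤ ∑ t ∈ Finset.range n, (1 : ℝ) := by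
        refine Finset.sum_le_sum fun t _ => ?_
        calc _ ≤ ∫ _, (1 : ℝ) ∂P := by
              refine integral_mono (integrable_instantRegret hmean hbest hE t)
                (integrable_const 1) fun ω => ?_
              have h1 := (hmean (best (T.context t ω, T.state t ω, T.θ ω)) (T.context t ω)
                (T.state t ω) (T.θ ω)).2
              have h2 := (hmean (T.action t ω) (T.context t ω) (T.state t ω) (T.θ ω)).1
              dsimp only
              linarith
          _ = 1 := by simp
    _ = n := by simp

/-- The gap of one round, split according to whether the believed state has been ruled out. -/
theorem mul_integral_gap_le (hM : M.IsSubGaussian σ)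
    (hmean : ∀ a x s θ, M.mean a x s θ ∈ Set.Icc (0 : ℝ) 1) (hbest : Measurable best)
    (hE : T.FollowsEnvironment M P) (hU : T.IsUmTS best posterior P) (hl : 0 ≤ q.l)
    (hw : 0 ≤ q.w) (t : ℕ) :
    q.l * ∫ ω, (M.priorMean (T.action t ω) (T.context t ω) (T.belief t ω).1
        - M.mean (T.action t ω) (T.context t ω) (T.state t ω) (T.θ ω)) ∂P
      ≤ q.l * P.real {ω | q.level
          < confStat M best posterior q t (T.history t ω) (T.belief t ω).1}
        + (q.l ^ 2 * secondMomentBound σ + q.w)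
        + ∑ s, ∫ ω, confIncr M best posterior q t (T.history t ω) (T.context t ω)
          (T.action t ω) (T.reward t ω) s ∂P := by
  have hpost := hU.markov
  have hV := secondMomentBound_pos σ
  have hround := aemeasurable_round hE t
  set N : Set Ω := {ω | q.level < confStat M best posterior q t (T.history t ω) (T.belief t ω).1}
    with hN
  have hset : MeasurableSet {z : History K X t × S |
      q.level < confStat M best posterior q t z.1 z.2} :=
    measurableSet_lt measurable_const (measurable_confStat hbest hpost t)
  have hNm : NullMeasurableSet N P :=
    ((by fun_prop : Measurable fun z : (Past K S Θ X t × X × (S × Θ) × Fin K) × ℝ =>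
      (z.1.1.2.2.2, z.1.2.2.1.1)).comp_aemeasurable hround).nullMeasurableSet_preimage hset
  have h0 : Integrable (N.indicator fun _ => q.l) P := (integrable_const _).indicator₀ hNm
  have h3 := integrable_gap hmean hE t
  have h4 : Integrable (fun ω =>
      if confStat M best posterior q t (T.history t ω) (T.belief t ω).1 ≤ q.level then
        q.l * (M.priorMean (T.action t ω) (T.context t ω) (T.belief t ω).1
          - M.mean (T.action t ω) (T.context t ω) (T.state t ω) (T.θ ω))
          - q.l ^ 2 * secondMomentBound σ - q.w else 0) P := by
    refine ((((h3.const_mul q.l).sub (integrable_const (q.l ^ 2 * secondMomentBound σ))).sub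
      (integrable_const q.w)).indicator₀ hNm.compl).congr (ae_of_all _ fun ω => ?_)
    simp only [Set.indicator, Set.mem_compl_iff, hN, Set.mem_ofPred_eq, not_lt, Pi.sub_apply]
  have h01 : Integrable (fun ω => N.indicator (fun _ => q.l) ω
      + (q.l ^ 2 * secondMomentBound σ + q.w)) P := h0.add (integrable_const _)
  rw [← integral_const_mul]
  calc _ ≤ ∫ ω, ((N.indicator (fun _ => q.l) ω + (q.l ^ 2 * secondMomentBound σ + q.w))
        + if confStat M best posterior q t (T.history t ω) (T.belief t ω).1 ≤ q.level then
          q.l * (M.priorMean (T.action t ω) (T.context t ω) (T.belief t ω).1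
            - M.mean (T.action t ω) (T.context t ω) (T.state t ω) (T.θ ω))
            - q.l ^ 2 * secondMomentBound σ - q.w else 0) ∂P := by
        refine integral_mono (h3.const_mul _) (h01.add h4) fun ω => ?_
        dsimp only
        by_cases hω : q.level < confStat M best posterior q t (T.history t ω) (T.belief t ω).1
        · rw [Set.indicator_of_mem (show ω ∈ N from hω), if_neg (not_le.2 hω)]
          have h5 := (LatentBandit.priorMean_mem_Icc hmean (T.action t ω) (T.context t ω)
            (T.belief t ω).1).2
          have h6 := (hmean (T.action t ω) (T.context t ω) (T.state t ω) (T.θ ω)).1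
          have h7 := mul_le_mul_of_nonneg_left (show
            M.priorMean (T.action t ω) (T.context t ω) (T.belief t ω).1
              - M.mean (T.action t ω) (T.context t ω) (T.state t ω) (T.θ ω) ≤ 1 by linarith) hl
          have h8 : 0 ≤ q.l ^ 2 * secondMomentBound σ := by positivity
          linarith
        · rw [Set.indicator_of_notMem (show ω ∉ N from hω), if_pos (not_lt.1 hω)]
          linarith
    _ ≤ _ := by
        rw [integral_add h01 h4, integral_add h0 (integrable_const _),
          integral_indicator₀ hNm, setIntegral_const]
        simp only [integral_const, probReal_univ, one_mul, smul_eq_mul]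
        rw [mul_comm (P.real N)]
        exact add_le_add le_rfl (integral_gap_le hM hmean hbest hE hU t)

theorem sum_integral_confIncr_le (hM : M.IsSubGaussian σ)
    (hmean : ∀ a x s θ, M.mean a x s θ ∈ Set.Icc (0 : ℝ) 1) (hbest : Measurable best)
    (hE : T.FollowsEnvironment M P) (hU : T.IsUmTS best posterior P)
    (hw : 0 ≤ q.w) (hlevel : 0 ≤ q.level) (n : ℕ) :
    ∑ t ∈ Finset.range n, ∑ s, ∫ ω, confIncr M best posterior q t (T.history t ω)
        (T.context t ω) (T.action t ω) (T.reward t ω) s ∂P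
      ≤ Fintype.card S * (((n / q.period : ℕ) + 1) * (q.level + 1)) := by
  rw [Finset.sum_comm]
  calc _ ≤ ∑ _s : S, ((n / q.period : ℕ) + 1) * (q.level + 1) := by
        refine Finset.sum_le_sum fun s _ => ?_
        rw [← integral_finsetSum _ fun t _ => integrable_confIncr hM hmean hbest hE hU t s]
        calc _ ≤ ∫ _, ((n / q.period : ℕ) + 1) * (q.level + 1) ∂P :=
              integral_mono (integrable_finsetSum _ fun t _ =>
                integrable_confIncr hM hmean hbest hE hU t s) (integrable_const _)
                fun ω => sum_confIncr_le hw hlevel ω s n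
          _ = _ := by simp
    _ = _ := by simp

theorem sum_measure_not_unchanged_le (hE : T.FollowsEnvironment M P) {α : S → S → ℝ}
    (hα : ∀ s s', 0 < α s s') (hD : M.HasDirichletPrior α) {p : ℝ} (hp0 : 0 ≤ p)
    (hp : ∀ s, 1 - α s s / ∑ s', α s s' ≤ p) {period : ℕ} (hperiod : 0 < period)
    {n : ℕ} (hn : n ≠ 0) :
    ∑ t ∈ Finset.range n,
        P.real {ω | ¬ Unchanged period fun i : Fin (t + 1) => T.state i ω}
      ≤ period * (26 * (1 + p * n)) := by
  classical
  have hm : ∀ t, NullMeasurableSet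
      {ω | ¬ Unchanged period fun i : Fin (t + 1) => T.state i ω} P := fun t =>
    ((by fun_prop : Measurable fun z : (Past K S Θ X t × X × (S × Θ) × Fin K) × ℝ =>
      z.1.1.2.1).comp_aemeasurable (aemeasurable_round hE t)).nullMeasurableSet_preimage
      (Set.toFinite {y | ¬ Unchanged period y}).measurableSet
  have hi : ∀ t, Integrable (Set.indicator
      {ω | ¬ Unchanged period fun i : Fin (t + 1) => T.state i ω} fun _ => (1 : ℝ)) P :=
    fun t => (integrable_const 1).indicator₀ (hm t)
  have hc : AEMeasurable (fun ω => ((changeCount fun i : Fin (n + 1) => T.state i ω : ℕ) : ℝ)) P :=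
    (measurable_of_finite fun y : Fin (n + 1) → S => ((changeCount y : ℕ) : ℝ)).comp_aemeasurable
      ((by fun_prop : Measurable fun z : (Past K S Θ X n × X × (S × Θ) × Fin K) × ℝ =>
        z.1.1.2.1).comp_aemeasurable (aemeasurable_round hE n))
  have hci : Integrable (fun ω => ((changeCount fun i : Fin (n + 1) => T.state i ω : ℕ) : ℝ)) P := by
    refine Integrable.of_bound hc.aestronglyMeasurable n (ae_of_all _ fun ω => ?_)
    rw [Real.norm_natCast]
    unfold changeCount
    calc _ ≤ ((∑ _i : Fin n, 1 : ℕ) : ℝ) := by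
          exact_mod_cast Finset.sum_le_sum fun i _ => by split_ifs <;> simp
      _ = n := by simp
  calc _ = ∫ ω, ∑ t ∈ Finset.range n, Set.indicator
        {ω | ¬ Unchanged period fun i : Fin (t + 1) => T.state i ω} (fun _ => (1 : ℝ)) ω ∂P := by
        rw [integral_finsetSum _ fun t _ => hi t]
        refine Finset.sum_congr rfl fun t _ => ?_
        rw [integral_indicator₀ (hm t), setIntegral_const]
        simp
    _ ≤ ∫ ω, period * ((changeCount fun i : Fin (n + 1) => T.state i ω : ℕ) : ℝ) ∂P := by
        refine integral_mono (integrable_finsetSum _ fun t _ => hi t) (hci.const_mul _) fun ω => ?_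
        refine le_trans (le_of_eq ?_) (sum_not_unchanged_le (fun i => T.state i ω) hperiod n)
        refine Finset.sum_congr rfl fun t _ => ?_
        simp only [Set.indicator, Set.mem_ofPred_eq]
        split_ifs <;> rfl
    _ ≤ _ := by
        rw [integral_const_mul]
        gcongr
        exact hE.integral_changeCount_le hα hD hp0 hp hn

/-- The bad event counts twice: in the comparison with prior means and in the probability of ruling
out the true state. So does `ε`, through that comparison and through the drift, and the second
moment, through the drift and the expected score. -/
theorem mul_bayesRegret_le (hM : M.IsSubGaussian σ)
    (hmean : ∀ a x s θ, M.mean a x s θ ∈ Set.Icc (0 : ℝ) 1) (hbest : Measurable best)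
    (hE : T.FollowsEnvironment M P) (hU : T.IsUmTS best posterior P)
    {α : S → S → ℝ} (hα : ∀ s s', 0 < α s s') (hD : M.HasDirichletPrior α)
    {p : ℝ} (hp0 : 0 ≤ p) (hp : ∀ s, 1 - α s s / ∑ s', α s s' ≤ p)
    {G : Set Θ} (hG : MeasurableSet G) {ε δ : ℝ} (hε : 0 ≤ ε)
    (hGε : ∀ θ ∈ G, ∀ a x s, |M.priorMean a x s - M.mean a x s θ| ≤ ε)
    (hGδ : P.real {ω | T.θ ω ∉ G} ≤ δ)
    {n : ℕ} (hn : n ≠ 0) {l level : ℝ} (hl : 0 ≤ l) (hlevel : 0 ≤ level) {period : ℕ}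
    (hperiod : 0 < period) :
    l * T.bayesRegret M best P n
      ≤ l * (2 * (n * δ) + n * ε + period * (26 * (1 + p * n)) + n * Real.exp (-level))
        + n * (2 * (l ^ 2 * secondMomentBound σ) + l * ε)
        + Fintype.card S * (((n / period : ℕ) + 1) * (level + 1)) := by
  have hV := secondMomentBound_pos σ
  -- The smallest drift for which the exponential supermartingale works.
  let q : StatParams := ⟨l, l * ε + l ^ 2 * secondMomentBound σ, level, period⟩
  have hqw : 0 ≤ q.w := by simp only [q]; positivity
  have hround : ∀ t, l * ∫ ω,
      (M.mean (best (T.context t ω, T.state t ω, T.θ ω)) (T.context t ω) (T.state t ω) (T.θ ω)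
        - M.mean (T.action t ω) (T.context t ω) (T.state t ω) (T.θ ω)) ∂P
      ≤ l * P.real {ω | ¬ Unchanged period fun i : Fin (t + 1) => T.state i ω}
        + (l * (2 * δ + ε + Real.exp (-level))
          + (2 * (l ^ 2 * secondMomentBound σ) + l * ε))
        + ∑ s, ∫ ω, confIncr M best posterior q t (T.history t ω)
        (T.context t ω) (T.action t ω) (T.reward t ω) s ∂P := by
    intro t
    have h1 := mul_le_mul_of_nonneg_left
      (integral_instantRegret_le hmean hbest hE hU hG hε hGε t) hl
    have h2 := mul_integral_gap_le (q := q) hM hmean hbest hE hU hl hqw t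
    have h3 := mul_le_mul_of_nonneg_left
      (measure_level_lt_confStat_le (q := q) hM hmean hbest hE hU hG hGε hl le_rfl t) hl
    have h4 := mul_le_mul_of_nonneg_left hGδ hl
    simp only [q] at h1 h2 h3 ⊢
    linarith
  rw [bayesRegret_eq_sum hmean hbest hE, Finset.mul_sum]
  refine (Finset.sum_le_sum fun t _ => hround t).trans ?_
  rw [Finset.sum_add_distrib, Finset.sum_add_distrib, ← Finset.mul_sum, Finset.sum_const,
    Finset.card_range, nsmul_eq_mul]
  have h5 := mul_le_mul_of_nonneg_left
    (sum_measure_not_unchanged_le hE hα hD hp0 hp hperiod hn) hl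
  have h6 := sum_integral_confIncr_le (q := q) hM hmean hbest hE hU hqw hlevel n
  simp only [q] at h6 ⊢
  linarith

end BayesRegret

/-! ### Choice of the parameters and conclusion. -/

/-- With `y = n ^ (1/3)`, `L = 1 + p * n` and `r = √(c * L * log n)`, the choice `l = r / y`, `level
= log n`, `period ≈ y ^ 2 / √L` makes all remaining terms of order `y ^ 2 * r`. The total `164` is
`156` for the changes, `2` for `n * exp (-level) = 1` and `6` for the increments. -/
theorem le_of_forall_mul_le {V p δ ε c R : ℝ} {n : ℕ} (hn : 2 ≤ n) (hV : 0 ≤ V) (hc : 1 ≤ c)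
    (hp : 0 ≤ p) (hδ : 0 ≤ δ) (hε : 0 ≤ ε) (hRn : R ≤ n)
    (hR : ∀ (l level : ℝ) (period : ℕ), 0 ≤ l → 0 ≤ level → 0 < period →
      l * R ≤ l * (2 * (n * δ) + n * ε + period * (26 * (1 + p * n)) + n * Real.exp (-level))
        + n * (2 * (l ^ 2 * V) + l * ε) + c * (((n / period : ℕ) + 1) * (level + 1))) :
    R ≤ (164 + 2 * V) * (δ * n + ε * n + (n : ℝ) ^ (2 / 3 : ℝ) * √(c * (1 + p * n) * Real.log n)) := by
  have hn2 : (2 : ℝ) ≤ n := by exact_mod_cast hn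
  have hn0 : (0 : ℝ) < n := by linarith
  set y : ℝ := (n : ℝ) ^ (1 / 3 : ℝ) with hy
  have hy1 : 1 ≤ y := Real.one_le_rpow (by linarith) (by norm_num)
  have hy0 : 0 < y := by linarith
  have hy2 : (n : ℝ) ^ (2 / 3 : ℝ) = y ^ 2 := by
    rw [hy, ← Real.rpow_natCast, ← Real.rpow_mul hn0.le]; norm_num
  have hy3 : (n : ℝ) = y ^ 3 := by
    rw [hy, ← Real.rpow_natCast, ← Real.rpow_mul hn0.le]; norm_num
  have hpn : 0 ≤ p * n := by positivity
  set L : ℝ := 1 + p * n with hL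
  have hL1 : 1 ≤ L := by linarith
  set g : ℝ := Real.log n with hg
  have hg1 : 1 / 2 ≤ g :=
    (by linarith [Real.log_two_gt_d9] : (1 / 2 : ℝ) ≤ Real.log 2).trans
      (Real.log_le_log (by norm_num) hn2)
  have hD0 : 0 ≤ c * L * g := by positivity
  set r : ℝ := √(c * L * g) with hr
  have hr2 : r ^ 2 = c * L * g := Real.sq_sqrt hD0
  set u : ℝ := √L with hu
  have hu2 : u ^ 2 = L := Real.sq_sqrt (by linarith)
  have hu1 : 1 ≤ u := Real.one_le_sqrt.2 hL1
  have hr0 : 0 ≤ r := Real.sqrt_nonneg _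
  have hcg : 1 / 2 ≤ c * g := by nlinarith
  -- Here `n ≥ 2` enters, through `log n ≥ 1 / 2`, together with `c ≥ 1`.
  have hur : u ≤ 2 * r := by
    refine abs_le_of_sq_le_sq' ?_ (by positivity) |>.2
    have h1 : r ^ 2 = L * (c * g) := by rw [hr2]; ring
    rw [hu2]
    nlinarith
  have hrpos : 0 < r := by linarith
  rw [hy2]
  have hyy : y ≤ y ^ 2 := le_self_pow₀ hy1 two_ne_zero
  have huu : u ≤ u ^ 2 := le_self_pow₀ hu1 two_ne_zero
  have hW0 : 0 ≤ y ^ 2 * r := by positivity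
  have hδn : 0 ≤ δ * n := by positivity
  have hεn : 0 ≤ ε * n := by positivity
  -- If `y < r` the claimed bound exceeds `n = y ^ 3`, so the trivial bound suffices. Otherwise `u ≤
  -- 2 * r ≤ 2 * y`, which absorbs the rounding of the period.
  rcases lt_or_ge y r with hyr | hry
  · calc R ≤ n := hRn
      _ = y ^ 2 * y := by rw [hy3]; ring
      _ ≤ y ^ 2 * r := by gcongr
      _ ≤ δ * n + ε * n + y ^ 2 * r := by linarith
      _ ≤ _ := le_mul_of_one_le_left (by positivity) (by linarith)
  · have hx : 0 < y ^ 2 / u := by positivity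
    have hτ1 := Nat.le_ceil (y ^ 2 / u)
    have hτ2 := Nat.ceil_lt_add_one hx.le
    have hτ0 : 0 < ⌈y ^ 2 / u⌉₊ := Nat.ceil_pos.2 hx
    have h := hR (r / y) g ⌈y ^ 2 / u⌉₊ (by positivity) (by linarith) hτ0
    set τ := ⌈y ^ 2 / u⌉₊
    have hexp : n * Real.exp (-g) = 1 := by
      rw [Real.exp_neg, hg, Real.exp_log hn0, mul_inv_cancel₀ hn0.ne']
    have hblocks : (((n / τ : ℕ) : ℝ) + 1) ≤ 2 * (y * u) := by
      have h1 : ((n / τ : ℕ) : ℝ) ≤ y * u := by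
        calc ((n / τ : ℕ) : ℝ) ≤ n / τ := Nat.cast_div_le
          _ ≤ n / (y ^ 2 / u) := by gcongr
          _ = y * u := by rw [hy3]; field_simp
      have h2 : 1 ≤ y * u := one_le_mul_of_one_le_of_one_le hy1 hu1
      linarith
    have hlast : c * (((n / τ : ℕ) + 1) * (g + 1)) ≤ r / y * (6 * (y ^ 2 * r)) := by
      calc c * (((n / τ : ℕ) + 1) * (g + 1)) ≤ c * ((2 * (y * u)) * (3 * g)) := by
            gcongr; linarith
        _ = 6 * y * (c * u * g) := by ring
        _ ≤ 6 * y * (c * u ^ 2 * g) := by gcongr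
        _ = 6 * y * r ^ 2 := by rw [hu2, hr2]
        _ = r / y * (6 * (y ^ 2 * r)) := by field_simp
    have hchange : τ * (26 * L) ≤ 156 * (y ^ 2 * r) := by
      have h1 : τ * L ≤ y ^ 2 * u + u ^ 2 := by
        calc τ * L ≤ (y ^ 2 / u + 1) * u ^ 2 := by rw [hu2]; gcongr
          _ = _ := by field_simp
      have h2 : y ^ 2 * u ≤ y ^ 2 * (2 * r) := by gcongr
      have h3 : u ^ 2 ≤ 4 * (y ^ 2 * r) := by
        calc u ^ 2 = u * u := sq u
          _ ≤ (2 * r) * (2 * y) := by gcongr; linarith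
          _ = 4 * (y * r) := by ring
          _ ≤ 4 * (y ^ 2 * r) := by gcongr
      linarith
    have hone : 1 ≤ 2 * (y ^ 2 * r) := by
      have h1 : 1 * (1 / 2) ≤ y ^ 2 * r :=
        mul_le_mul (one_le_pow₀ hy1) (by linarith) (by norm_num) (by positivity)
      linarith
    have hnl : n * (2 * ((r / y) ^ 2 * V) + r / y * ε)
        = r / y * (2 * V * (y ^ 2 * r) + ε * n) := by
      rw [hy3]; field_simp
    rw [hexp, hnl] at h
    have hl : 0 < r / y := by positivity
    have h' : r / y * R ≤ r / y * (2 * (n * δ) + 2 * (n * ε) + (164 + 2 * V) * (y ^ 2 * r)) := by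
      refine h.trans ?_
      have h1 : r / y * (2 * (n * δ) + n * ε + τ * (26 * L) + 1)
          ≤ r / y * (2 * (n * δ) + n * ε + 158 * (y ^ 2 * r)) :=
        mul_le_mul_of_nonneg_left (by linarith) hl.le
      linarith
    have h'' := le_of_mul_le_mul_left h' hl
    have h1 : 2 * (δ * n) ≤ (164 + 2 * V) * (δ * n) := by gcongr; linarith
    have h2 : 2 * (ε * n) ≤ (164 + 2 * V) * (ε * n) := by gcongr; linarith
    linarith

theorem changeProb_nonneg {S : Type*} [Fintype S] [Nonempty S] {α : S → S → ℝ}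
    (hα : ∀ s s', 0 < α s s') : 0 ≤ changeProb α := by
  obtain ⟨s⟩ := ‹Nonempty S›
  have h1 : α s s / ∑ s', α s s' ≤ 1 :=
    div_le_one_of_le₀ (Finset.single_le_sum (fun s' _ => (hα s s').le) (Finset.mem_univ s))
      (Finset.sum_nonneg fun s' _ => (hα s s').le)
  have h2 := ciInf_le (Set.finite_range fun s => α s s / ∑ s', α s s').bddBelow s
  unfold changeProb
  linarith

theorem one_sub_le_changeProb {S : Type*} [Fintype S] (α : S → S → ℝ) (s : S) :
    1 - α s s / ∑ s', α s s' ≤ changeProb α := by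
  have h2 := ciInf_le (Set.finite_range fun s => α s s / ∑ s', α s s').bddBelow s
  unfold changeProb
  linarith

theorem measureReal_parameter_notMem {K : ℕ} {S Θ X Ω : Type*} [Fintype S] [MeasurableSpace S]
    [MeasurableSingletonClass S] [MeasurableSpace Θ] [MeasurableSpace X] [MeasurableSpace Ω]
    {M : LatentBandit K S Θ X} {P : Measure Ω} [IsProbabilityMeasure P]
    {T : Trajectory K S Θ X Ω} (hE : T.FollowsEnvironment M P) {G : Set Θ} (hG : MeasurableSet G) :
    P.real {ω | T.θ ω ∉ G} = M.prior.fst.real Gᶜ := by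
  have h1 : M.prior.fst = P.map T.θ := by
    have h2 : M.prior = (M.prior.prod M.initial).map Prod.fst := by
      rw [Measure.map_fst_prod]; simp
    rw [Measure.fst, h2, ← hE.initial.map_eq, Measure.map_map measurable_fst measurable_fst,
      AEMeasurable.map_map_of_aemeasurable (by fun_prop) hE.initial.aemeasurable]
    rfl
  rw [h1, map_measureReal_apply_of_aemeasurable (aemeasurable_parameter hE) hG.compl]
  rfl

theorem mainTheorem2 (σ : ℝ) :
    ∃ C : ℝ, 0 < C ∧
      ∀ (K : ℕ) (S Θ X Ω : Type*) [Fintype S]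
        [MeasurableSpace S] [MeasurableSingletonClass S] [MeasurableSpace Θ]
        [MeasurableSpace X] [MeasurableSpace Ω]
        (M : LatentBandit K S Θ X) (best : X × S × Θ → Fin K) (α : S → S → ℝ)
        (P : Measure Ω) [IsProbabilityMeasure P]
        (T : Trajectory K S Θ X Ω) (posterior : ∀ t, Kernel (History K X t) (S × Θ))
        (ε δ : ℝ) (n : ℕ),
        M.IsSubGaussian σ →
        (∀ a x s θ, M.mean a x s θ ∈ Set.Icc (0 : ℝ) 1) →
        M.IsArgmax best →
        (∀ s s', 0 < α s s') →
        M.HasDirichletPrior α →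
        T.FollowsEnvironment M P →
        T.IsUmTS best posterior P →
        0 < ε → 0 < δ →
        M.prior.fst {θ | ¬ ∀ a x s, |M.priorMean a x s - M.mean a x s θ| ≤ ε}
          ≤ ENNReal.ofReal δ →
        2 ≤ n →
        T.bayesRegret M best P n ≤
          C * (δ * n + ε * n + (n : ℝ) ^ (2 / 3 : ℝ) *
            √(Fintype.card S * (1 + changeProb α * n) * Real.log n)) := by
  have hV := secondMomentBound_pos σ
  refine ⟨164 + 2 * secondMomentBound σ, by positivity, ?_⟩
  intro K S Θ X Ω _ _ _ _ _ _ M best α P _ T posterior ε δ n hM hmean hA hα hD hE hU hε hδ hprior hn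
  obtain ⟨ω⟩ : Nonempty Ω := P.nonempty_of_neZero
  -- A state exists because trajectories do; it is needed for `1 ≤ |S|` and for a nonnegative change
  -- probability.
  have : Nonempty S := ⟨T.state 0 ω⟩
  -- The bad set of parameters need not be measurable; a measurable hull has the same outer measure.
  let B : Set Θ := toMeasurable M.prior.fst
    {θ | ¬ ∀ a x s, |M.priorMean a x s - M.mean a x s θ| ≤ ε}
  have hB : MeasurableSet B := measurableSet_toMeasurable _ _
  have hGδ : P.real {ω | T.θ ω ∉ Bᶜ} ≤ δ := by
    rw [measureReal_parameter_notMem hE hB.compl, compl_compl, measureReal_def, measure_toMeasurable]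
    exact ENNReal.toReal_le_of_le_ofReal hδ.le hprior
  refine le_of_forall_mul_le hn hV.le (by exact_mod_cast Fintype.card_pos) (changeProb_nonneg hα)
    hδ.le hε.le (bayesRegret_le_horizon hmean hA.measurable hE n) fun l level period hl hlevel hp =>
      mul_bayesRegret_le hM hmean hA.measurable hE hU hα hD (changeProb_nonneg hα)
        (one_sub_le_changeProb α) hB.compl hε.le (fun θ hθ => ?_) hGδ (by omega) hl hlevel hp
  by_contra hne
  exact hθ (subset_toMeasurable _ _ hne)
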